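/- For a finite simple graph $G=(V,E)$, a component of an induced subgraph $G[U]$ is an inclusion-wise maximal non-empty set $C\subseteq U$ such that $G[C]$ is connected. A non-empty set $S\subseteq V$ is a connected safe set of $G$ if $G[S]$ is connected and no component $C$ of $G[S]$ is joined by an edge to a component $D$ of $G-S=G[V\setminus S]$ with $|C|<|D|$. The problem Connected Safe Set has as input a graph $G$ and a non-negative integer $k$, and asks whether $G$ has a connected safe set of size at most $k$. Theorem. Connected Safe Set can be solved in $O^*(2^k k^k)$ time, where $O^*$ suppresses factors polynomial in the input size (and $0^0=1$). That is, there are a single random access machine program (time being measured with logarithmic cost) and a polynomial $p$ such that, for every $n$, every graph $G$ on the vertex set $\{0,\dots,n-1\}$, given by its adjacency matrix, and every integer $k\ge 0$, the program started on $(G,k)$ halts within time $2^k k^k\cdot p(N)$, where $N$ is the length of the input in bits ($n^2$ plus the binary lengths of $n$ and $k$), and decides correctly whether $G$ has a connected safe set of size at most $k$; if the answer is yes, it also returns such a set. -/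

import Mathlib

/-! ### Connected safe sets -/

namespace SafeSet

variable {V : Type*}

/-- `C` is a (connected) component of the induced subgraph `G[U]`: an inclusion-wise maximal
connected set of vertices inside `U`. (`SimpleGraph.Connected` includes nonemptiness.) -/
def IsComponent (G : SimpleGraph V) (U C : Finset V) : Prop :=
  Maximal (fun D : Finset V => D ⊆ U ∧ (G.induce (D : Set V)).Connected) C

/-- Two vertex sets are adjacent if some edge joins them. -/
def Adjacent (G : SimpleGraph V) (A B : Finset V) : Prop :=
  ∃ a ∈ A, ∃ b ∈ B, G.Adj a b

/-- A nonempty vertex set `S` is safe if no component `C` of `G[S]` has an adjacent component `D`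
of `G - S` with `|C| < |D|`. -/
def IsSafe [Fintype V] [DecidableEq V] (G : SimpleGraph V) (S : Finset V) : Prop :=
  S.Nonempty ∧
    ∀ C D : Finset V, IsComponent G S C → IsComponent G Sᶜ D → Adjacent G C D →
      ¬ C.card < D.card

/-- A connected safe set: a safe set that induces a connected subgraph. -/
def IsConnectedSafe [Fintype V] [DecidableEq V] (G : SimpleGraph V) (S : Finset V) : Prop :=
  IsSafe G S ∧ (G.induce (S : Set V)).Connected

end SafeSet

/-! ### A random access machine with logarithmic cost

Programs are while-programs over natural numbers. The memory consists of arrays (a program names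
finitely many of them), each with random access; a scalar variable is an array of which only
cell `0` is used. Every operation is charged according to the bit lengths of its operands. -/

namespace RAM

/-- Arithmetic and comparison operations. -/
inductive Op where
  | add | sub | mul | div | mod | lt | eq

/-- Values of the operations on natural numbers: `sub` is truncated, `div` and `mod` are quotient
and remainder (`a / 0 = 0`, `a % 0 = a`), comparisons return `1` or `0`. -/
def Op.apply : Op → ℕ → ℕ → ℕ
  | .add, a, b => a + b
  | .sub, a, b => a - b
  | .mul, a, b => a * b
  | .div, a, b => a / b
  | .mod, a, b => a % b
  | .lt, a, b => if a < b then 1 else 0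
  | .eq, a, b => if a = b then 1 else 0

/-- Expressions: constants, array cells `a[e]`, and operations. -/
inductive Expr where
  | lit (c : ℕ)
  | cell (a : ℕ) (e : Expr)
  | op (o : Op) (e₁ e₂ : Expr)

/-- Programs. -/
inductive Prog where
  | skip
  /-- the assignment `a[i] := e` -/
  | assign (a : ℕ) (i e : Expr)
  | seq (P Q : Prog)
  /-- run `P` if `e` is nonzero, and `Q` otherwise -/
  | ite (e : Expr) (P Q : Prog)
  /-- repeat `P` as long as `e` is nonzero -/
  | loop (e : Expr) (P : Prog)

/-- A memory state: `σ a i` is the content of cell `i` of array `a`. -/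
abbrev Mem := ℕ → ℕ → ℕ

/-- Overwrite cell `i` of array `a` by `x`. -/
def Mem.write (σ : Mem) (a i x : ℕ) : Mem :=
  fun b j => if b = a ∧ j = i then x else σ b j

/-- The value of an expression. -/
def Expr.eval (σ : Mem) : Expr → ℕ
  | .lit c => c
  | .cell a e => σ a (e.eval σ)
  | .op o e₁ e₂ => o.apply (e₁.eval σ) (e₂.eval σ)

/-- The cost of evaluating an expression, where `Nat.size x` is the number of binary digits
of `x`. A memory access costs the length of the address plus the length of the content; an
operation costs the (schoolbook) product of the lengths of its operands. -/
def Expr.cost (σ : Mem) : Expr → ℕ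
  | .lit c => 1 + Nat.size c
  | .cell a e => e.cost σ + (1 + Nat.size (e.eval σ) + Nat.size (σ a (e.eval σ)))
  | .op _ e₁ e₂ =>
      e₁.cost σ + e₂.cost σ + (1 + Nat.size (e₁.eval σ)) * (1 + Nat.size (e₂.eval σ))

/-- `Exec P σ t σ'`: started in memory `σ`, the program `P` halts in memory `σ'` at total
cost `t`. -/
inductive Exec : Prog → Mem → ℕ → Mem → Prop where
  | skip (σ : Mem) : Exec .skip σ 1 σ
  | assign (σ : Mem) (a : ℕ) (i e : Expr) :
      Exec (.assign a i e) σ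
        (i.cost σ + e.cost σ + (1 + Nat.size (i.eval σ) + Nat.size (e.eval σ)))
        (σ.write a (i.eval σ) (e.eval σ))
  | seq {P Q : Prog} {σ σ' σ'' : Mem} {s t : ℕ} :
      Exec P σ s σ' → Exec Q σ' t σ'' → Exec (.seq P Q) σ (s + t) σ''
  | ite_true {e : Expr} {P Q : Prog} {σ σ' : Mem} {t : ℕ} :
      e.eval σ ≠ 0 → Exec P σ t σ' → Exec (.ite e P Q) σ (e.cost σ + 1 + t) σ'
  | ite_false {e : Expr} {P Q : Prog} {σ σ' : Mem} {t : ℕ} :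
      e.eval σ = 0 → Exec Q σ t σ' → Exec (.ite e P Q) σ (e.cost σ + 1 + t) σ'
  | loop_true {e : Expr} {P : Prog} {σ σ' σ'' : Mem} {s t : ℕ} :
      e.eval σ ≠ 0 → Exec P σ s σ' → Exec (.loop e P) σ' t σ'' →
        Exec (.loop e P) σ (e.cost σ + 1 + s + t) σ''
  | loop_false {e : Expr} {P : Prog} {σ : Mem} :
      e.eval σ = 0 → Exec (.loop e P) σ (e.cost σ + 1) σ

end RAM

/-! ### Inputs and outputs of the problem Connected Safe Set -/

namespace SafeSet

open Classical in
/-- The initial memory for a graph `G` on the vertices `0, …, n - 1` and a number `k`: array `0`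
holds `n, k`, array `1` holds the adjacency matrix row by row, and all other cells are `0`. -/
noncomputable def input {n : ℕ} (G : SimpleGraph (Fin n)) (k : ℕ) : RAM.Mem
  | 0, 0 => n
  | 0, 1 => k
  | 1, i => if ∃ u v : Fin n, i = u.val * n + v.val ∧ G.Adj u v then 1 else 0
  | _, _ => 0

/-- The length of the input in bits: the adjacency matrix, `n` and `k` in binary. -/
def inputLength (n k : ℕ) : ℕ := n * n + Nat.size n + Nat.size k

/-- The answer of a computation is read from cell `0` of array `2`. -/
def answer (σ : RAM.Mem) : ℕ := σ 2 0

/-- The vertex set returned by a computation, given by its indicator vector in array `3`. -/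
def outputSet (n : ℕ) (σ : RAM.Mem) : Finset (Fin n) :=
  Finset.univ.filter (fun v => σ 3 v.val = 1)

/-- The final memory `σ` solves the instance `(G, k)` of Connected Safe Set: either the answer
is `1` (yes) and the returned set is a connected safe set of size at most `k`, or the answer
is `0` (no) and there is no connected safe set of size at most `k`. -/
def IsCorrect {n : ℕ} (G : SimpleGraph (Fin n)) (k : ℕ) (σ : RAM.Mem) : Prop :=
  (answer σ = 1 ∧ IsConnectedSafe G (outputSet n σ) ∧ (outputSet n σ).card ≤ k) ∨
    (answer σ = 0 ∧ ¬ ∃ S : Finset (Fin n), IsConnectedSafe G S ∧ S.card ≤ k)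

/-- The program `P` solves Connected Safe Set in time `O*(f k)`: on every instance `(G, k)` it
halts with a correct result, within time `f k` times a fixed polynomial in the input length. -/
def SolvesInTimeOStar (P : RAM.Prog) (f : ℕ → ℕ) : Prop :=
  ∃ p : Polynomial ℕ, ∀ (n : ℕ) (G : SimpleGraph (Fin n)) (k : ℕ),
    ∃ (t : ℕ) (σ : RAM.Mem), RAM.Exec P (input G k) t σ ∧ IsCorrect G k σ ∧
      t ≤ f k * p.eval (inputLength n k)

end SafeSet

/-! A connected set `T` is a connected safe set iff no connected set disjoint from `T` and adjacent
to it has more than `|T|` vertices (`isConnectedSafe_iff`, `Good`). Since `|T| ≤ n`, the bound `k`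
may be replaced by `min k n`; this matters because `k` is given in binary and may be exponentially
large.

Search. Guess one vertex of a solution `T` with `|T| ≤ k` and grow a set `S ⊆ T` from it. Suppose a
vertex `u` outside `S` is adjacent to `S` and its component of `G - S` has more than `k` vertices.
The first `k + 1` vertices of a breadth-first search from `u` in `G - S` form a connected set
adjacent to `S`; it cannot avoid `T`, so one of `k + 1` branches adds a vertex of `T`
(`Big.exists_getD_mem`). If there is no such `u`, then no connected superset of `S` with at most `k`
vertices has a connected neighbor with more than `k` vertices (`big_of_not_noLarge`). In that case
any new vertex will do that keeps `S` inside some connected set of at most `k` vertices. At the end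
`S` is connected. Either `|S| = k` and `S` is safe, or `S` has no neighbor at all, since adding one
would give a larger connected set of at most `k` vertices (`Witness.step`, `Witness.good`). The
guesses are encoded by a start vertex and `k - 1` digits in base `k + 1`, and `(k + 1) ^ (k - 1) ≤ k
^ k` (`succ_pow_pred_le`).

Extension test. Whether given vertices lie in a connected set of at most `k` vertices is a Steiner
tree question. Supports of branching walks with `k - 1` steps from a vertex are exactly the
connected sets of at most `k` vertices through it (`spec_of_mem_walks`, `Conn.mem_walks`).
Inclusion-exclusion over the `2 ^ k` sets of slots expresses the number of walks visiting all
required vertices by numbers of walks avoiding a set (`sum_walkCount`), and these obey a polynomial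
recursion (`walkCount_succ`). There are fewer than `(4 * n) ^ n` walks (`card_walks_lt`), so
counting modulo this number decides whether one exists.

Machine. In programs with bounded loops, whose limits are read from an array that stays fixed, the
final memory is a function `den`, and the cost is at most the number of steps times a constant times
the square of the bit length (`exec_compile`). A step of the main program raises the maximum of the
memory by at most one, so numbers keep polynomial length even after exponentially many steps. -/

namespace RAM

/-! ### Programs with bounded loops -/

/-- Programs whose loops run a counter (cell `0` of array `a`) from `0` up to the value of `e`. -/
inductive FProg where
  | skip
  | assign (a : ℕ) (i e : Expr)
  | seq (P Q : FProg)
  | ite (e : Expr) (P Q : FProg)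
  | loop (a : ℕ) (e : Expr) (P : FProg)

/-- All cells are at most `M`. -/
def Bounded (M : ℕ) (σ : Mem) : Prop := ∀ a i, σ a i ≤ M

theorem Bounded.mono {M M' : ℕ} {σ : Mem} (h : Bounded M σ) (hM : M ≤ M') : Bounded M' σ :=
  fun a i => (h a i).trans hM

theorem Bounded.write {M : ℕ} {σ : Mem} (h : Bounded M σ) {a i x : ℕ} (hx : x ≤ M) :
    Bounded M (σ.write a i x) := by
  intro b j
  unfold Mem.write
  split_ifs
  · exact hx
  · exact h b j

theorem Mem.write_ne (σ : Mem) {a b : ℕ} (i x : ℕ) (h : b ≠ a) : σ.write a i x b = σ b := by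
  funext j
  simp [Mem.write, h]

theorem Mem.write_same (σ : Mem) (a i x : ℕ) : σ.write a i x a i = x := by
  simp [Mem.write]

theorem Mem.write_eq (σ : Mem) (a i x : ℕ) :
    σ.write a i x a = Function.update (σ a) i x := by
  funext j
  simp [Mem.write, Function.update_apply]

theorem Mem.write_apply (σ : Mem) (a i x b j : ℕ) :
    σ.write a i x b j = if b = a ∧ j = i then x else σ b j := rfl

theorem size_mul_le (a b : ℕ) : Nat.size (a * b) ≤ Nat.size a + Nat.size b := by
  rw [Nat.size_le, pow_add]
  rcases Nat.eq_zero_or_pos b with rfl | hb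
  · simp
  · exact Nat.mul_lt_mul'' (Nat.lt_size_self a) (Nat.lt_size_self b)

theorem size_succ_le (a : ℕ) : Nat.size (a + 1) ≤ Nat.size a + 1 := by
  rw [Nat.size_le, pow_succ]
  have := Nat.lt_size_self a
  omega

/-- One bound for all operations, in product form so that bit lengths add up. -/
theorem Op.apply_le (o : Op) (a b : ℕ) : o.apply a b ≤ (a + 1) * (b + 1) := by
  have h1 : a ≤ (a + 1) * (b + 1) := by nlinarith [Nat.zero_le (a * b)]
  cases o <;> simp only [Op.apply]
  · nlinarith [Nat.zero_le (a * b)]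
  · exact (Nat.sub_le _ _).trans h1
  · nlinarith [Nat.zero_le (a * b)]
  · exact (Nat.div_le_self _ _).trans h1
  · exact (Nat.mod_le _ _).trans h1
  · split_ifs <;> nlinarith [Nat.zero_le (a * b)]
  · split_ifs <;> nlinarith [Nat.zero_le (a * b)]

/-- Evaluating a fixed expression on numbers of length at most `L` costs `O(L ^ 2)`. -/
theorem Expr.exists_cost_le (e : Expr) : ∃ C, ∀ (σ : Mem) (L : ℕ), (∀ a i, Nat.size (σ a i) ≤ L) →
    Nat.size (e.eval σ) ≤ C * (L + 1) ∧ e.cost σ ≤ C * (L + 1) ^ 2 := by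
  induction e with
  | lit c =>
    refine ⟨1 + Nat.size c, fun σ L _ => ⟨?_, ?_⟩⟩ <;> simp only [Expr.eval, Expr.cost]
    · nlinarith [Nat.zero_le (Nat.size c * L)]
    · exact Nat.le_mul_of_pos_right _ (by positivity)
  | cell a e ih =>
    obtain ⟨C, hC⟩ := ih
    refine ⟨2 * C + 2, fun σ L h => ⟨?_, ?_⟩⟩ <;> simp only [Expr.eval, Expr.cost]
    · refine (h _ _).trans ?_
      nlinarith [Nat.zero_le (C * L)]
    · obtain ⟨h1, h2⟩ := hC σ L h
      have h3 := h a (e.eval σ)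
      nlinarith [Nat.zero_le (C * L), Nat.zero_le (C * L ^ 2), Nat.zero_le (L ^ 2)]
  | op o e₁ e₂ ih₁ ih₂ =>
    obtain ⟨C, hC⟩ := ih₁
    obtain ⟨D, hD⟩ := ih₂
    refine ⟨C + D + 2 + (1 + C) * (1 + D), fun σ L h => ?_⟩
    obtain ⟨h1, h2⟩ := hC σ L h
    obtain ⟨h3, h4⟩ := hD σ L h
    simp only [Expr.eval, Expr.cost]
    constructor
    · have h5 := Nat.size_le_size (o.apply_le (e₁.eval σ) (e₂.eval σ))
      have h6 := size_mul_le (e₁.eval σ + 1) (e₂.eval σ + 1)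
      have h7 := size_succ_le (e₁.eval σ)
      have h8 := size_succ_le (e₂.eval σ)
      have : 0 ≤ (1 + C) * (1 + D) * (L + 1) := Nat.zero_le _
      nlinarith
    · have h5 : (1 + (e₁.eval σ).size) * (1 + (e₂.eval σ).size)
          ≤ ((1 + C) * (L + 1)) * ((1 + D) * (L + 1)) :=
        Nat.mul_le_mul (by nlinarith) (by nlinarith)
      nlinarith [Nat.zero_le ((L + 1) ^ 2)]

namespace Expr

/-- The expression reads array `z` only. -/
def readsOnly (z : ℕ) : Expr → Bool
  | lit _ => true
  | cell a e => a == z && e.readsOnly z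
  | op _ e₁ e₂ => e₁.readsOnly z && e₂.readsOnly z

/-- This makes the number of rounds of a loop known in advance: its limit reads only an array that
the program never changes. -/
theorem eval_congr_of_readsOnly {z : ℕ} {e : Expr} (h : e.readsOnly z) {σ τ : Mem}
    (hz : σ z = τ z) : e.eval σ = e.eval τ := by
  induction e with
  | lit c => rfl
  | cell a e ih =>
    simp only [readsOnly, Bool.and_eq_true, beq_iff_eq] at h
    obtain ⟨rfl, h⟩ := h
    simp only [eval, ih h, hz]
  | op o e₁ e₂ ih₁ ih₂ =>
    simp only [readsOnly, Bool.and_eq_true] at h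
    simp only [eval, ih₁ h.1, ih₂ h.2]

end Expr

/-! ### Semantics and cost of programs with bounded loops -/

namespace FProg

/-- Translation into programs of the machine. -/
def compile : FProg → Prog
  | skip => .skip
  | assign a i e => .assign a i e
  | seq P Q => .seq P.compile Q.compile
  | ite e P Q => .ite e P.compile Q.compile
  | loop a e P =>
    .seq (.assign a (.lit 0) (.lit 0))
      (.loop (.op .lt (.cell a (.lit 0)) e)
        (.seq P.compile (.assign a (.lit 0) (.op .add (.cell a (.lit 0)) (.lit 1)))))

/-- Run `f` for the values `0, …, N - 1` of the counter `a`. -/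
def iter (a : ℕ) (f : Mem → Mem) (σ : Mem) : ℕ → Mem
  | 0 => σ
  | i + 1 => f ((iter a f σ i).write a 0 i)

/-- The final memory. -/
def den : FProg → Mem → Mem
  | skip => fun σ => σ
  | assign a i e => fun σ => σ.write a (i.eval σ) (e.eval σ)
  | seq P Q => fun σ => Q.den (P.den σ)
  | ite e P Q => fun σ => if e.eval σ ≠ 0 then P.den σ else Q.den σ
  | loop a e P => fun σ => (iter a P.den σ (e.eval σ)).write a 0 (e.eval σ)

/-- The arrays a program writes to. -/
def writes : FProg → List ℕ
  | skip => []
  | assign a _ _ => [a]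
  | seq P Q => P.writes ++ Q.writes
  | ite _ P Q => P.writes ++ Q.writes
  | loop a _ P => a :: P.writes

/-- Loop counters are not modified by loop bodies, loop limits depend on array `z` only, and
array `z` is not modified. -/
def wf (z : ℕ) : FProg → Bool
  | skip => true
  | assign a _ _ => a != z
  | seq P Q => P.wf z && Q.wf z
  | ite _ P Q => P.wf z && Q.wf z
  | loop a e P => a != z && e.readsOnly z && !(P.writes.contains a) && P.wf z

/-- All assigned expressions satisfy `p`. -/
def Assigns (p : Expr → Prop) : FProg → Prop
  | skip => True
  | assign _ _ e => p e
  | seq P Q => P.Assigns p ∧ Q.Assigns p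
  | ite _ P Q => P.Assigns p ∧ Q.Assigns p
  | loop _ _ P => P.Assigns p

/-- A bound on the number of elementary steps when array `z` has content `s`. -/
def steps (s : ℕ → ℕ) : FProg → ℕ
  | skip => 1
  | assign _ _ _ => 1
  | seq P Q => P.steps s + Q.steps s
  | ite _ P Q => 1 + P.steps s + Q.steps s
  | loop _ e P => e.eval (fun _ => s) * (P.steps s + 2) + 2

/-- The frame rule. For concrete programs the side condition is decidable, so invariants need not
mention unaffected arrays. -/
theorem den_of_notMem {P : FProg} {a : ℕ} (h : a ∉ P.writes) (σ : Mem) : P.den σ a = σ a := by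
  induction P generalizing σ with
  | skip => rfl
  | assign b i e =>
    simp only [writes, List.mem_singleton] at h
    exact Mem.write_ne _ _ _ h
  | seq P Q ihP ihQ =>
    simp only [writes, List.mem_append, not_or] at h
    simp only [den, ihQ h.2, ihP h.1]
  | ite e P Q ihP ihQ =>
    simp only [writes, List.mem_append, not_or] at h
    simp only [den]
    split_ifs
    exacts [ihP h.1 σ, ihQ h.2 σ]
  | loop b e P ih =>
    simp only [writes, List.mem_cons, not_or] at h
    simp only [den, Mem.write_ne _ _ _ h.1]
    generalize e.eval σ = N
    induction N with
    | zero => rfl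
    | succ N ihN => rw [iter, ih h.2, Mem.write_ne _ _ _ h.1, ihN]

theorem notMem_writes_of_wf {z : ℕ} {P : FProg} (h : P.wf z) : z ∉ P.writes := by
  induction P with
  | skip => simp [writes]
  | assign b i e =>
    simp only [wf, bne_iff_ne] at h
    simpa [writes] using h.symm
  | seq P Q ihP ihQ =>
    simp only [wf, Bool.and_eq_true] at h
    simp [writes, ihP h.1, ihQ h.2]
  | ite e P Q ihP ihQ =>
    simp only [wf, Bool.and_eq_true] at h
    simp [writes, ihP h.1, ihQ h.2]
  | loop b e P ih =>
    simp only [wf, Bool.and_eq_true, bne_iff_ne] at h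
    simp [writes, ih h.2, h.1.1.1.symm]

/-- Invariant rule for loops. -/
theorem den_loop_induct {a : ℕ} {e : Expr} {P : FProg} {σ : Mem} (I : ℕ → Mem → Prop)
    {N : ℕ} (hN : e.eval σ = N) (h0 : I 0 σ) (hI : ∀ i τ x, I i τ → I i (τ.write a 0 x))
    (hs : ∀ i τ, i < N → (∀ b, b ∉ a :: P.writes → τ b = σ b) → τ a 0 = i →
      I i τ → I (i + 1) (P.den τ)) :
    I N ((loop a e P).den σ) := by
  subst hN
  have key : ∀ N ≤ e.eval σ, I N (iter a P.den σ N) ∧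
      ∀ b, b ∉ a :: P.writes → iter a P.den σ N b = σ b := by
    intro N
    induction N with
    | zero => exact fun _ => ⟨h0, fun _ _ => rfl⟩
    | succ N ih =>
      intro hN
      obtain ⟨ih1, ih2⟩ := ih (by omega)
      have fr : ∀ b, b ∉ a :: P.writes → ((iter a P.den σ N).write a 0 N) b = σ b := by
        intro b hb
        have : b ≠ a := fun h => hb (by simp [h])
        rw [Mem.write_ne _ _ _ this, ih2 b hb]
      refine ⟨hs N _ (by omega) fr (Mem.write_same ..) (hI _ _ _ ih1), fun b hb => ?_⟩
      rw [iter, den_of_notMem (fun h => hb (by simp [h])), fr b hb]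
  -- The loop finally stores its limit in the counter; the invariant does not depend on the counter.
  exact hI _ _ _ (key _ le_rfl).1

/-- The value of `e` is at most `g M` if all cells are at most `M`. -/
def Grows (z : ℕ) (s : ℕ → ℕ) (M₀ : ℕ) (g : ℕ → ℕ) (e : Expr) : Prop :=
  ∀ (σ : Mem) (M : ℕ), σ z = s → M₀ ≤ M → Bounded M σ → e.eval σ ≤ g M

/-- The compiled program computes `den`; its cost is bounded by the number of steps. -/
theorem exec_compile (P : FProg) : ∃ C, ∀ (z : ℕ) (s : ℕ → ℕ) (M₀ : ℕ) (g : ℕ → ℕ),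
    (∀ M, M + 1 ≤ g M) → P.wf z → P.Assigns (Grows z s M₀ g) →
    ∀ (σ : Mem) (M L : ℕ), σ z = s → M₀ ≤ M → Bounded M σ → Nat.size (g^[P.steps s] M) ≤ L →
    ∃ t, Exec P.compile σ t (P.den σ) ∧ t ≤ P.steps s * (C * (L + 1) ^ 2) ∧
      Bounded (g^[P.steps s] M) (P.den σ) := by
  have gle : ∀ {g : ℕ → ℕ}, (∀ M, M + 1 ≤ g M) → ∀ {i j : ℕ}, i ≤ j → ∀ M, g^[i] M ≤ g^[j] M := by
    intro g hg i j hij M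
    exact Function.monotone_iterate_of_id_le (fun x => (Nat.le_succ x).trans (hg x)) hij M
  have sz : ∀ {M L : ℕ} {σ : Mem}, Bounded M σ → Nat.size M ≤ L → ∀ a i, Nat.size (σ a i) ≤ L :=
    fun h hL a i => (Nat.size_le_size (h a i)).trans hL
  have asg : ∀ (a : ℕ) (i e : Expr), ∃ C, ∀ (σ : Mem) (L : ℕ), (∀ a i, Nat.size (σ a i) ≤ L) →
      i.cost σ + e.cost σ + (1 + Nat.size (i.eval σ) + Nat.size (e.eval σ))
        ≤ C * (L + 1) ^ 2 := by
    intro a i e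
    obtain ⟨C, hC⟩ := i.exists_cost_le
    obtain ⟨D, hD⟩ := e.exists_cost_le
    refine ⟨2 * C + 2 * D + 1, fun σ L h => ?_⟩
    obtain ⟨h1, h2⟩ := hC σ L h
    obtain ⟨h3, h4⟩ := hD σ L h
    nlinarith [Nat.zero_le (C * L), Nat.zero_le (C * L ^ 2), Nat.zero_le (D * L),
      Nat.zero_le (D * L ^ 2)]
  induction P with
  | skip =>
    refine ⟨1, fun z s M₀ g hg _ _ σ M L _ _ hM hL => ⟨1, .skip σ, ?_, ?_⟩⟩
    · simp only [steps, one_mul]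
      exact Nat.one_le_pow _ _ (by omega)
    · exact hM.mono (gle hg (Nat.zero_le _) M)
  | assign a i e =>
    obtain ⟨C, hC⟩ := asg a i e
    refine ⟨C, fun z s M₀ g hg _ he σ M L hz hM₀ hM hL => ⟨_, .assign σ a i e, ?_, ?_⟩⟩
    · simp only [steps, one_mul]
      exact hC σ L (sz hM ((Nat.size_le_size (gle hg (Nat.zero_le _) M)).trans hL))
    · exact (hM.mono (gle hg (Nat.zero_le 1) M)).write (he σ M hz hM₀ hM)
  | seq P Q ihP ihQ =>
    obtain ⟨C, hC⟩ := ihP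
    obtain ⟨D, hD⟩ := ihQ
    refine ⟨C + D, fun z s M₀ g hg hwf he σ M L hz hM₀ hM hL => ?_⟩
    simp only [wf, Bool.and_eq_true] at hwf
    obtain ⟨t, h1, h2, h3⟩ := hC z s M₀ g hg hwf.1 he.1 σ M L hz hM₀ hM
      ((Nat.size_le_size (gle hg (by simp [steps]) M)).trans hL)
    have hit : g^[Q.steps s] (g^[P.steps s] M) = g^[(seq P Q).steps s] M := by
      rw [← Function.iterate_add_apply, steps, add_comm]
    obtain ⟨t', h1', h2', h3'⟩ := hD z s M₀ g hg hwf.2 he.2 (P.den σ) (g^[P.steps s] M) L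
      ((den_of_notMem (notMem_writes_of_wf hwf.1) σ).trans hz)
      (hM₀.trans (gle hg (Nat.zero_le _) M)) h3 (by rwa [hit])
    refine ⟨t + t', .seq h1 h1', ?_, by rw [← hit]; exact h3'⟩
    simp only [steps]
    have a1 : P.steps s * (C * (L + 1) ^ 2) ≤ P.steps s * ((C + D) * (L + 1) ^ 2) := by
      gcongr; omega
    have a2 : Q.steps s * (D * (L + 1) ^ 2) ≤ Q.steps s * ((C + D) * (L + 1) ^ 2) := by
      gcongr; omega
    rw [add_mul]
    omega
  | ite e P Q ihP ihQ =>
    obtain ⟨C, hC⟩ := ihP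
    obtain ⟨D, hD⟩ := ihQ
    obtain ⟨E, hE⟩ := e.exists_cost_le
    refine ⟨C + D + E + 1, fun z s M₀ g hg hwf he σ M L hz hM₀ hM hL => ?_⟩
    simp only [wf, Bool.and_eq_true] at hwf
    have hE' := (hE σ L (sz hM ((Nat.size_le_size (gle hg (Nat.zero_le _) M)).trans hL))).2
    have a0 : e.cost σ + 1 ≤ (C + D + E + 1) * (L + 1) ^ 2 := by
      nlinarith [Nat.zero_le (C * (L + 1) ^ 2), Nat.zero_le (D * (L + 1) ^ 2)]
    have a1 : P.steps s * (C * (L + 1) ^ 2) ≤ P.steps s * ((C + D + E + 1) * (L + 1) ^ 2) := by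
      gcongr; omega
    have a2 : Q.steps s * (D * (L + 1) ^ 2) ≤ Q.steps s * ((C + D + E + 1) * (L + 1) ^ 2) := by
      gcongr; omega
    by_cases hv : e.eval σ = 0
    · obtain ⟨t, h1, h2, h3⟩ := hD z s M₀ g hg hwf.2 he.2 σ M L hz hM₀ hM
        ((Nat.size_le_size (gle hg (by simp [steps]) M)).trans hL)
      refine ⟨_, by simpa [compile, den, hv] using Exec.ite_false hv h1, ?_, ?_⟩
      · simp only [steps]
        rw [add_mul, add_mul, one_mul]
        omega
      · simpa [den, hv] using h3.mono (gle hg (by simp [steps]) M)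
    · obtain ⟨t, h1, h2, h3⟩ := hC z s M₀ g hg hwf.1 he.1 σ M L hz hM₀ hM
        ((Nat.size_le_size (gle hg (by simp only [steps]; omega) M)).trans hL)
      refine ⟨_, by simpa [compile, den, hv] using Exec.ite_true hv h1, ?_, ?_⟩
      · simp only [steps]
        rw [add_mul, add_mul, one_mul]
        omega
      · simpa [den, hv] using h3.mono (gle hg (by simp only [steps]; omega) M)
  | loop a e P ih =>
    obtain ⟨C, hC⟩ := ih
    obtain ⟨D, hD⟩ := asg a (.lit 0) (.lit 0)
    obtain ⟨E, hE⟩ := (Expr.op .lt (.cell a (.lit 0)) e).exists_cost_le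
    obtain ⟨F, hF⟩ := asg a (.lit 0) (.op .add (.cell a (.lit 0)) (.lit 1))
    refine ⟨C + D + E + F + 1, fun z s M₀ g hg hwf he σ M L hz hM₀ hM hL => ?_⟩
    simp only [wf, Bool.and_eq_true, bne_iff_ne, Bool.not_eq_true', List.contains_eq_mem,
      decide_eq_false_iff_not] at hwf
    obtain ⟨⟨⟨haz, hez⟩, haP⟩, hwfP⟩ := hwf
    set N := e.eval (fun _ => s) with hN
    set p := P.steps s with hp
    have heval : ∀ τ : Mem, τ z = s → e.eval τ = N := fun τ hτ =>
      Expr.eval_congr_of_readsOnly hez hτ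
    set K := (C + D + E + F + 1) * (L + 1) ^ 2 with hK
    have one_le : 1 ≤ (L + 1) ^ 2 := Nat.one_le_pow _ _ (by omega)
    have hst : (loop a e P).steps s = N * (p + 2) + 2 := rfl
    -- Induction on the number `r` of remaining rounds. The exponent of `g` counts the initial reset
    -- of the counter once, and per round the `p` steps of the body and the increment.
    have key : ∀ r i : ℕ, i + r = N → ∀ τ : Mem,
        τ = iter a P.den σ i → τ z = s → Bounded (g^[1 + i * (p + 1)] M) (τ.write a 0 i) →
        ∃ t, Exec (.loop (.op .lt (.cell a (.lit 0)) e)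
          (.seq P.compile (.assign a (.lit 0) (.op .add (.cell a (.lit 0)) (.lit 1)))))
          (τ.write a 0 i) t ((iter a P.den σ N).write a 0 N) ∧ t ≤ (r * (p + 2) + 1) * K ∧
          Bounded (g^[1 + N * (p + 1)] M) ((iter a P.den σ N).write a 0 N) := by
      intro r
      induction r with
      | zero =>
        intro i hi τ hne hτ hb
        obtain rfl : i = N := by omega
        subst hne
        have hz' : ((iter a P.den σ N).write a 0 N) z = s := by
          rw [Mem.write_ne _ _ _ haz.symm, hτ]
        refine ⟨_, .loop_false ?_, ?_, hb⟩
        · simp [Expr.eval, Op.apply, Mem.write_same, heval _ hz']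
        · have := (hE _ L (sz hb ((Nat.size_le_size (gle hg (by
            rw [hst]; nlinarith) M)).trans hL))).2
          have h2 : E * (L + 1) ^ 2 + 1 ≤ K := by
            rw [hK]; nlinarith [Nat.zero_le ((C + D + F) * (L + 1) ^ 2)]
          rw [zero_mul, zero_add, one_mul]
          omega
      | succ r ihr =>
        intro i hi τ hne hτ hb
        have hz' : (τ.write a 0 i) z = s := by
          rw [Mem.write_ne _ _ _ haz.symm, hτ]
        have hiN : (i + 1) * (p + 1) ≤ N * (p + 1) := Nat.mul_le_mul_right _ (by omega)
        have hNp : N * (p + 1) ≤ N * (p + 2) := Nat.mul_le_mul_left _ (by omega)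
        have hexp : 1 + (i + 1) * (p + 1) = 1 + (p + (1 + i * (p + 1))) := by ring
        obtain ⟨t, h1, h2, h3⟩ := hC z s M₀ g hg hwfP he (τ.write a 0 i)
          (g^[1 + i * (p + 1)] M) L hz' (hM₀.trans (gle hg (Nat.zero_le _) M)) hb (by
            rw [← Function.iterate_add_apply]
            exact (Nat.size_le_size (gle hg (by rw [hst, ← hp]; omega) M)).trans hL)
        rw [← Function.iterate_add_apply, ← hp] at h3
        rw [← hp] at h2
        have hval : (P.den (τ.write a 0 i)) a 0 = i := by
          rw [den_of_notMem haP, Mem.write_same]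
        have hz'' : (P.den (τ.write a 0 i)) z = s := by
          rw [den_of_notMem (notMem_writes_of_wf hwfP), hz']
        have hb' : Bounded (g^[1 + (i + 1) * (p + 1)] M)
            ((P.den (τ.write a 0 i)).write a 0 (i + 1)) := by
          have h4 : g^[1 + (i + 1) * (p + 1)] M = g (g^[p + (1 + i * (p + 1))] M) := by
            rw [hexp, add_comm 1, Function.iterate_succ_apply']
          rw [h4]
          have h5 := h3 a 0
          rw [hval] at h5
          exact (h3.mono ((Nat.le_succ _).trans (hg _))).write ((Nat.succ_le_succ h5).trans (hg _))
        obtain ⟨t', h1', h2', h3'⟩ := ihr (i + 1) (by omega) (P.den (τ.write a 0 i))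
          (by rw [iter, hne]) hz'' hb'
        obtain ⟨u, hu, hx⟩ : ∃ u ≤ F * (L + 1) ^ 2,
            Exec (.assign a (.lit 0) (.op .add (.cell a (.lit 0)) (.lit 1)))
              (P.den (τ.write a 0 i)) u ((P.den (τ.write a 0 i)).write a 0 (i + 1)) := by
          have := Exec.assign (P.den (τ.write a 0 i)) a (.lit 0)
            (.op .add (.cell a (.lit 0)) (.lit 1))
          have c2 := hF _ L (sz h3 ((Nat.size_le_size (gle hg (by
            rw [hst]; omega) M)).trans hL))
          have hev : Expr.eval (P.den (τ.write a 0 i)) (.op .add (.cell a (.lit 0)) (.lit 1))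
              = i + 1 := by simp [Expr.eval, Op.apply, hval]
          rw [hev] at this c2
          exact ⟨_, c2, this⟩
        refine ⟨_, .loop_true ?_ (.seq h1 hx) h1', ?_, h3'⟩
        · have : i < N := by omega
          simp [Expr.eval, Op.apply, Mem.write_same, heval _ hz', this]
        · have c1 := (hE _ L (sz hb ((Nat.size_le_size (gle hg (by
            rw [hst]; nlinarith) M)).trans hL))).2
          have k1 : E * (L + 1) ^ 2 + 1 ≤ K := by
            rw [hK]; nlinarith [Nat.zero_le ((C + D + F) * (L + 1) ^ 2)]
          have k2 : F * (L + 1) ^ 2 ≤ K := by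
            rw [hK]; exact Nat.mul_le_mul_right _ (by omega)
          have k3 : p * (C * (L + 1) ^ 2) ≤ p * K := by
            rw [hK]; gcongr; omega
          have : ((r + 1) * (p + 2) + 1) * K = (r * (p + 2) + 1) * K + p * K + K + K := by ring
          rw [this]
          omega
    have hb0 : Bounded (g^[1 + 0 * (p + 1)] M) (σ.write a 0 0) :=
      (hM.mono (gle hg (Nat.zero_le _) M)).write (Nat.zero_le _)
    obtain ⟨t, h1, h2, h3⟩ := key N 0 (by omega) σ rfl hz hb0
    have c0 := hD σ L (sz hM ((Nat.size_le_size (gle hg (Nat.zero_le _) M)).trans hL))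
    refine ⟨(Expr.lit 0).cost σ + (Expr.lit 0).cost σ
      + (1 + ((Expr.lit 0).eval σ).size + ((Expr.lit 0).eval σ).size) + t, ?_, ?_, ?_⟩
    · simp only [compile, den, heval σ hz]
      exact .seq (.assign σ a (.lit 0) (.lit 0)) h1
    · have k0 : D * (L + 1) ^ 2 ≤ K := by
        rw [hK]; exact Nat.mul_le_mul_right _ (by omega)
      have : (N * (p + 2) + 2) * K = (N * (p + 2) + 1) * K + K := by ring
      rw [hst, this]
      omega
    · simp only [den, heval σ hz]
      refine h3.mono (gle hg ?_ M)
      rw [hst]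
      nlinarith

end FProg

end RAM

namespace SafeSet

open Finset

/-! ### Connected sets of natural numbers -/

/-- `T` is nonempty and connected with respect to `A`: every nonempty proper subset of `T` is left
by an edge inside `T`. -/
def Conn {V : Type*} [DecidableEq V] (A : V → V → Prop) (T : Finset V) : Prop :=
  T.Nonempty ∧ ∀ U ⊆ T, U.Nonempty → U ≠ T → ∃ a ∈ U, ∃ b ∈ T \ U, A a b

section Conn

variable {V : Type*} [DecidableEq V] {A : V → V → Prop}

theorem Conn.singleton (u : V) : Conn A {u} := by
  refine ⟨singleton_nonempty u, fun U hU hne hU' => ?_⟩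
  rcases subset_singleton_iff.1 hU with h | h
  · exact absurd h hne.ne_empty
  · exact absurd h hU'

/-- A cut of the union that splits `T₁` or `T₂` is crossed inside that part. Only cuts separating
the whole of `T₁` from the whole of `T₂` need a hypothesis, which is vacuous if the two sets meet.
-/
theorem Conn.union_of {T₁ T₂ : Finset V} (h₁ : Conn A T₁) (h₂ : Conn A T₂)
    (h : ∀ U, T₁ ⊆ U → Disjoint U T₂ → ∃ a ∈ T₁, ∃ b ∈ T₂, A a b)
    (h' : ∀ U, T₂ ⊆ U → Disjoint U T₁ → ∃ a ∈ T₂, ∃ b ∈ T₁, A a b) : Conn A (T₁ ∪ T₂) := by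
  refine ⟨h₁.1.mono subset_union_left, fun U hU hne hU' => ?_⟩
  have part : ∀ {T}, Conn A T → T ⊆ T₁ ∪ T₂ → ¬ T ⊆ U → ¬ Disjoint U T →
      ∃ a ∈ U, ∃ b ∈ (T₁ ∪ T₂) \ U, A a b := by
    intro T hT hsub h1 h2
    obtain ⟨a, ha, b, hb, hab⟩ := hT.2 (U ∩ T) inter_subset_right
      (by rwa [nonempty_iff_ne_empty, ne_eq, ← disjoint_iff_inter_eq_empty])
      (fun h => h1 (inter_eq_right.1 h))
    refine ⟨a, (mem_inter.1 ha).1, b, ?_, hab⟩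
    rw [mem_sdiff] at hb ⊢
    exact ⟨hsub hb.1, fun h => hb.2 (mem_inter.2 ⟨h, hb.1⟩)⟩
  by_cases c1 : T₁ ⊆ U <;> by_cases c2 : T₂ ⊆ U
  · exact absurd (hU.antisymm (union_subset c1 c2)) hU'
  · by_cases d : Disjoint U T₂
    · obtain ⟨a, ha, b, hb, hab⟩ := h U c1 d
      exact ⟨a, c1 ha, b, mem_sdiff.2 ⟨mem_union_right _ hb, disjoint_right.1 d hb⟩, hab⟩
    · exact part h₂ subset_union_right c2 d
  · by_cases d : Disjoint U T₁
    · obtain ⟨a, ha, b, hb, hab⟩ := h' U c2 d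
      exact ⟨a, c2 ha, b, mem_sdiff.2 ⟨mem_union_left _ hb, disjoint_right.1 d hb⟩, hab⟩
    · exact part h₁ subset_union_left c1 d
  · by_cases d : Disjoint U T₁
    · by_cases d' : Disjoint U T₂
      · obtain ⟨x, hx⟩ := hne
        rcases mem_union.1 (hU hx) with h | h
        · exact absurd h (disjoint_left.1 d hx)
        · exact absurd h (disjoint_left.1 d' hx)
      · exact part h₂ subset_union_right c2 d'
    · exact part h₁ subset_union_left c1 d

theorem Conn.union_of_mem {T₁ T₂ : Finset V} (h₁ : Conn A T₁) (h₂ : Conn A T₂) {x : V}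
    (hx₁ : x ∈ T₁) (hx₂ : x ∈ T₂) : Conn A (T₁ ∪ T₂) :=
  h₁.union_of h₂ (fun _ h d => absurd hx₂ (disjoint_left.1 d (h hx₁)))
    (fun _ h d => absurd hx₁ (disjoint_left.1 d (h hx₂)))

theorem Conn.union_of_adj (hA : ∀ ⦃x y⦄, A x y → A y x) {T₁ T₂ : Finset V} (h₁ : Conn A T₁)
    (h₂ : Conn A T₂) {x y : V} (hx : x ∈ T₁) (hy : y ∈ T₂) (hxy : A x y) : Conn A (T₁ ∪ T₂) :=
  h₁.union_of h₂ (fun _ _ _ => ⟨x, hx, y, hy, hxy⟩) (fun _ _ _ => ⟨y, hy, x, hx, hA hxy⟩)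

theorem Conn.insert_of_adj (hA : ∀ ⦃x y⦄, A x y → A y x) {T : Finset V} (h : Conn A T) {x y : V}
    (hx : x ∈ T) (hxy : A x y) : Conn A (insert y T) := by
  rw [insert_eq, union_comm]
  exact h.union_of_adj hA (.singleton y) hx (mem_singleton_self y) hxy

/-- A connected set is contained in every set that meets it and is closed inside it. -/
theorem Conn.subset_of_closed {T R : Finset V} (h : Conn A T) {x : V} (hx : x ∈ T) (hxR : x ∈ R)
    (hR : ∀ a ∈ R, ∀ b ∈ T, A a b → b ∈ R) : T ⊆ R := by
  by_contra hTR
  obtain ⟨a, ha, b, hb, hab⟩ := h.2 (T ∩ R) inter_subset_left ⟨x, mem_inter.2 ⟨hx, hxR⟩⟩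
    (fun h => hTR (inter_eq_left.1 h))
  rw [mem_sdiff, mem_inter, not_and] at hb
  exact hb.2 hb.1 (hR a (mem_inter.1 ha).2 b hb.1 hab)

end Conn

/-! ### Branching walks -/

section Walks

open Classical in
/-- The supports of the branching walks with `l` steps from `u` on the vertices `0, …, n - 1`,
where a step may also stay at its vertex. -/
noncomputable def walks (n : ℕ) (A : ℕ → ℕ → Prop) : ℕ → ℕ → Multiset (Finset ℕ)
  | 0, u => {{u}}
  | l + 1, u => ∑ w ∈ (range n).filter (fun w => w = u ∨ A u w), ∑ a : Fin (l + 1),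
      (walks n A a w).bind fun U => (walks n A (l - a) u).map (U ∪ ·)

variable {n : ℕ} {A : ℕ → ℕ → Prop}

theorem mem_walks_succ {l u : ℕ} {U : Finset ℕ} : U ∈ walks n A (l + 1) u ↔
    ∃ w < n, (w = u ∨ A u w) ∧ ∃ a ≤ l, ∃ U₁ ∈ walks n A a w, ∃ U₂ ∈ walks n A (l - a) u,
      U₁ ∪ U₂ = U := by
  rw [walks]
  simp only [Multiset.mem_sum, mem_filter, mem_range, Multiset.mem_bind, Multiset.mem_map,
    mem_univ, true_and, and_assoc]
  refine exists_congr fun w => and_congr_right fun _ => and_congr_right fun _ => ?_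
  constructor
  · rintro ⟨a, h⟩
    exact ⟨a, by omega, h⟩
  · rintro ⟨a, ha, h⟩
    exact ⟨⟨a, by omega⟩, h⟩

/-- A walk splits into a first step from `u` to `w`, a walk from `w`, and a further walk from `u`;
the two supports meet or are joined by the edge `uw`, and each step adds at most one vertex. -/
theorem spec_of_mem_walks (hA : ∀ ⦃x y⦄, A x y → A y x) {l u : ℕ} {U : Finset ℕ} (h : U ∈ walks n A l u)
    (hu : u < n) : u ∈ U ∧ Conn A U ∧ U.card ≤ l + 1 ∧ U ⊆ range n := by
  induction l using Nat.strong_induction_on generalizing u U with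
  | _ l ih =>
    cases l with
    | zero =>
      rw [walks, Multiset.mem_singleton] at h
      subst h
      simp [Conn.singleton, hu]
    | succ l =>
      obtain ⟨w, hw, hwu, a, ha, U₁, h₁, U₂, h₂, rfl⟩ := mem_walks_succ.1 h
      obtain ⟨a1, a2, a3, a4⟩ := ih a (by omega) h₁ hw
      obtain ⟨b1, b2, b3, b4⟩ := ih (l - a) (by omega) h₂ hu
      refine ⟨mem_union_right _ b1, ?_, (card_union_le _ _).trans (by omega), union_subset a4 b4⟩
      rcases hwu with rfl | hwu
      · exact a2.union_of_mem b2 a1 b1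
      · exact a2.union_of_adj hA b2 a1 b1 (hA hwu)

/-- Steps that stay in place pad a walk to any greater length, so walks of the single length `k - 1`
cover all sets of at most `k` vertices. -/
theorem mem_walks_mono {l u : ℕ} {U : Finset ℕ} (h : U ∈ walks n A l u) (hu : u < n) {m : ℕ}
    (hm : l ≤ m) (huU : u ∈ U) : U ∈ walks n A m u := by
  induction m, hm using Nat.le_induction with
  | base => exact h
  | succ m _ ih =>
    refine mem_walks_succ.2 ⟨u, hu, .inl rfl, 0, Nat.zero_le _, {u}, by simp [walks], U, ih, ?_⟩
    rw [← insert_eq, insert_eq_of_mem huU]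

/-- Descend into the branch that visits `w` until a walk without steps at `w` is reached, and hang
the new step there. -/
theorem insert_mem_walks {l u : ℕ} {U : Finset ℕ} (h : U ∈ walks n A l u) {w x : ℕ} (hw : w ∈ U)
    (hwx : A w x) (hx : x < n) : insert x U ∈ walks n A (l + 1) u := by
  induction l using Nat.strong_induction_on generalizing u U with
  | _ l ih =>
    cases l with
    | zero =>
      rw [walks, Multiset.mem_singleton] at h
      subst h
      rw [mem_singleton] at hw
      subst hw
      exact mem_walks_succ.2 ⟨x, hx, .inr hwx, 0, le_rfl, {x}, by simp [walks], {w},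
        by simp [walks], rfl⟩
    | succ l =>
      obtain ⟨v, hv, hvu, a, ha, U₁, h₁, U₂, h₂, rfl⟩ := mem_walks_succ.1 h
      rcases mem_union.1 hw with hw | hw
      · refine mem_walks_succ.2 ⟨v, hv, hvu, a + 1, by omega, _, ih a (by omega) h₁ hw, U₂, ?_,
          insert_union _ _ _⟩
        rwa [Nat.add_sub_add_right]
      · refine mem_walks_succ.2 ⟨v, hv, hvu, a, by omega, U₁, h₁, _, ?_, union_insert _ _ _⟩
        rw [Nat.sub_add_comm ha]
        exact ih (l - a) (by omega) h₂ hw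

/-- Starting from `{u}`, the cut property provides one new vertex of `T` per step; the resulting
walk is then padded. -/
theorem Conn.mem_walks {T : Finset ℕ} (hT : Conn A T) {u : ℕ} (hu : u ∈ T) (hTn : T ⊆ range n)
    {l : ℕ} (hl : T.card ≤ l + 1) : T ∈ walks n A l u := by
  have key : ∀ m < T.card, ∃ U ⊆ T, U.card = m + 1 ∧ U ∈ walks n A m u ∧ u ∈ U := by
    intro m
    induction m with
    | zero => exact fun _ => ⟨{u}, by simpa using hu, rfl, by simp [walks], mem_singleton_self u⟩
    | succ m ih =>
      intro hm
      obtain ⟨U, h1, h2, h3, h4⟩ := ih (by omega)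
      obtain ⟨a, ha, b, hb, hab⟩ := hT.2 U h1 ⟨u, h4⟩ (fun h => by rw [h] at h2; omega)
      rw [mem_sdiff] at hb
      exact ⟨insert b U, insert_subset hb.1 h1, by rw [card_insert_of_notMem hb.2, h2],
        insert_mem_walks h3 ha hab (mem_range.1 (hTn hb.1)), mem_insert_of_mem h4⟩
  have hpos := hT.1.card_pos
  obtain ⟨U, h1, h2, h3, h4⟩ := key (T.card - 1) (by omega)
  obtain rfl : U = T := eq_of_subset_of_card_le h1 (by omega)
  exact mem_walks_mono h3 (mem_range.1 (hTn hu)) (by omega) hu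

/-- The recursion is that of the Catalan numbers, with a factor of at most `n` for the target of
each step. -/
theorem card_walks_le (l u : ℕ) : (walks n A l u).card ≤ n ^ l * catalan l := by
  classical
  induction l using Nat.strong_induction_on generalizing u with
  | _ l ih =>
    cases l with
    | zero => simp [walks]
    | succ l =>
      rw [walks, Multiset.card_sum, catalan_succ, pow_succ', mul_assoc]
      refine (sum_le_card_nsmul _ _ (n ^ l * ∑ i : Fin (l + 1), catalan i * catalan (l - i))
        fun w _ => ?_).trans ?_
      · rw [Multiset.card_sum, mul_sum]
        refine sum_le_sum fun a _ => ?_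
        rw [Multiset.card_bind]
        simp only [Function.comp_def, Multiset.card_map, Multiset.map_const', Multiset.sum_replicate,
          smul_eq_mul]
        calc _ ≤ (n ^ (a : ℕ) * catalan a) * (n ^ (l - a) * catalan (l - a)) :=
              Nat.mul_le_mul (ih a (by omega) w) (ih (l - a) (by omega) u)
          _ = n ^ ((a : ℕ) + (l - a)) * (catalan a * catalan (l - a)) := by rw [pow_add]; ring
          _ = _ := by rw [Nat.add_sub_cancel' (by omega)]
      · rw [smul_eq_mul]
        exact Nat.mul_le_mul_right _ ((card_filter_le _ _).trans (card_range n).le)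

theorem card_walks_lt {k u : ℕ} (hk : k < n) : (walks n A k u).card < (4 * n) ^ n := by
  have h1 : catalan k ≤ 4 ^ k := by
    rw [catalan_eq_centralBinom_div]
    exact (Nat.div_le_self _ _).trans (Nat.centralBinom_le_four_pow k)
  calc _ ≤ n ^ k * 4 ^ k := (card_walks_le k u).trans (Nat.mul_le_mul_left _ h1)
    _ = (4 * n) ^ k := by rw [mul_pow, mul_comm]
    _ < (4 * n) ^ n := Nat.pow_lt_pow_right (by omega) hk

/-! ### Counting walks by inclusion-exclusion -/

theorem sum_map_finsetSum {ι α M : Type*} [AddCommMonoid M] (s : Finset ι) (f : ι → Multiset α)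
    (g : α → M) : ((∑ i ∈ s, f i).map g).sum = ∑ i ∈ s, ((f i).map g).sum := by
  classical
  induction s using Finset.induction_on with
  | empty => simp
  | insert i s hi ih => simp [sum_insert hi, ih]

open Classical in
/-- The number of branching walks that avoid `F`, as an element of `R`. -/
noncomputable def walkCount (R : Type*) [CommRing R] (n : ℕ) (A : ℕ → ℕ → Prop) (F : ℕ → Prop)
    (l u : ℕ) : R :=
  ((walks n A l u).map fun U => if ∀ y ∈ U, ¬ F y then (1 : R) else 0).sum

variable {R : Type*} [CommRing R] {F : ℕ → Prop}

open Classical in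
theorem walkCount_zero (u : ℕ) :
    walkCount R n A F 0 u = if F u then 0 else 1 := by
  by_cases h : F u <;> simp [walkCount, walks, h]

-- Avoiding `F` is required of both parts of a walk independently, so the indicator of a union is a
-- product. This is the dynamic program that the machine runs.
open Classical in
theorem walkCount_succ (l u : ℕ) :
    walkCount R n A F (l + 1) u = ∑ w ∈ range n, if w = u ∨ A u w then
      ∑ a ∈ range (l + 1), walkCount R n A F a w * walkCount R n A F (l - a) u else 0 := by
  rw [walkCount, walks, ← sum_filter, sum_map_finsetSum]
  refine sum_congr rfl fun w _ => ?_
  rw [sum_map_finsetSum, sum_range]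
  refine sum_congr rfl fun a _ => ?_
  rw [Multiset.map_bind, Multiset.sum_bind, walkCount, walkCount, ← Multiset.sum_map_mul_right]
  congr 1
  refine Multiset.map_congr rfl fun U _ => ?_
  rw [Multiset.map_map, ← Multiset.sum_map_mul_left]
  congr 1
  refine Multiset.map_congr rfl fun U' _ => ?_
  rw [Function.comp_apply, ite_zero_mul_ite_zero, mul_one]
  refine if_congr ?_ rfl rfl
  simp only [mem_union, or_imp, forall_and]

theorem walkCount_of_forbidden (hA : ∀ ⦃x y⦄, A x y → A y x) {l u : ℕ} (hu : u < n) (h : F u) :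
    walkCount R n A F l u = 0 := by
  classical
  refine Multiset.sum_eq_zero fun x hx => ?_
  obtain ⟨U, hU, rfl⟩ := Multiset.mem_map.1 hx
  exact if_neg fun h' => h' u (spec_of_mem_walks hA hU hu).1 h

/-- Expansion of a product over the binary representations. -/
theorem sum_prod_testBit (k : ℕ) (c : ℕ → R) :
    ∑ x ∈ range (2 ^ k), ∏ j ∈ range k, (if x.testBit j then c j else 1)
      = ∏ j ∈ range k, (1 + c j) := by
  induction k with
  | zero => simp
  | succ k ih =>
    rw [pow_succ, mul_two, sum_range_add, prod_range_succ, ← ih, mul_add, mul_one, sum_mul]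
    congr 1
    · refine sum_congr rfl fun x hx => ?_
      rw [prod_range_succ, Nat.testBit_lt_two_pow (mem_range.1 hx)]
      simp
    · refine sum_congr rfl fun x hx => ?_
      rw [prod_range_succ, Nat.testBit_two_pow_add_eq, Nat.testBit_lt_two_pow (mem_range.1 hx)]
      simp only [Bool.not_false, if_true]
      congr 1
      refine prod_congr rfl fun j hj => ?_
      rw [Nat.testBit_two_pow_add_gt (mem_range.1 hj)]

open Classical in
/-- Inclusion-exclusion: signed counting of the walks that avoid a set of required vertices
yields the number of walks that visit all of them. -/
theorem sum_walkCount (k l u : ℕ) (s : ℕ → ℕ) :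
    ∑ x ∈ range (2 ^ k), (∏ j ∈ range k, if x.testBit j then (-1 : R) else 1) *
      walkCount R n A (fun y => ∃ j < k, x.testBit j ∧ s j = y) l u
      = ((walks n A l u).countP (fun U => ∀ j < k, s j ∈ U) : ℕ) := by
  have key : ∀ U : Finset ℕ,
      ∑ x ∈ range (2 ^ k), (∏ j ∈ range k, if x.testBit j then (-1 : R) else 1) *
        (if ∀ y ∈ U, ¬ ∃ j < k, x.testBit j ∧ s j = y then (1 : R) else 0)
      = if ∀ j < k, s j ∈ U then 1 else 0 := by
    intro U
    -- The sign and the avoidance indicator merge into one product over the slots. Summed over all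
    -- `x` it becomes a product of factors `1 + 0` if `s j ∈ U` and `1 - 1` otherwise; repeated
    -- values of `s` do no harm.
    have h1 : ∀ x : ℕ, (∏ j ∈ range k, if x.testBit j then (-1 : R) else 1) *
        (if ∀ y ∈ U, ¬ ∃ j < k, x.testBit j ∧ s j = y then (1 : R) else 0)
        = ∏ j ∈ range k, if x.testBit j then (if s j ∈ U then 0 else -1) else 1 := by
      intro x
      by_cases h : ∀ y ∈ U, ¬ ∃ j < k, x.testBit j ∧ s j = y
      · rw [if_pos h, mul_one]
        refine prod_congr rfl fun j hj => ?_
        by_cases hb : x.testBit j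
        · have : s j ∉ U := fun hU => h _ hU ⟨j, mem_range.1 hj, hb, rfl⟩
          simp [this]
        · simp [hb]
      · rw [if_neg h, mul_zero]
        push Not at h
        obtain ⟨y, hy, j, hj, hb, rfl⟩ := h
        exact (prod_eq_zero (mem_range.2 hj) (by simp [hb, hy])).symm
    rw [sum_congr rfl fun x _ => h1 x, sum_prod_testBit]
    by_cases h : ∀ j < k, s j ∈ U
    · rw [if_pos h]
      exact prod_eq_one fun j hj => by simp [h j (mem_range.1 hj)]
    · rw [if_neg h]
      push Not at h
      obtain ⟨j, hj, hU⟩ := h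
      exact prod_eq_zero (mem_range.2 hj) (by simp [hU])
  simp only [walkCount, ← Multiset.sum_map_mul_left]
  rw [← Multiset.sum_map_sum]
  refine (congrArg Multiset.sum (Multiset.map_congr rfl fun U _ => ?_)).trans
    (b := ((walks n A l u).map fun U => if ∀ j < k, s j ∈ U then (1 : R) else 0).sum) ?_
  · convert key U
  induction walks n A l u using Multiset.induction_on with
  | empty => simp
  | cons U W ih =>
    rw [Multiset.map_cons, Multiset.sum_cons, ih, Multiset.countP_cons]
    split_ifs <;> simp [add_comm]

theorem countP_walks_ne_zero_iff (hA : ∀ ⦃x y⦄, A x y → A y x) {k : ℕ} {s : ℕ → ℕ} (hk : 0 < k)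
    (hs : s 0 < n) [DecidablePred fun U : Finset ℕ => ∀ j < k, s j ∈ U] :
    (walks n A (k - 1) (s 0)).countP (fun U => ∀ j < k, s j ∈ U) ≠ 0 ↔
      ∃ T, Conn A T ∧ T ⊆ range n ∧ (∀ j < k, s j ∈ T) ∧ T.card ≤ k := by
  rw [← Nat.pos_iff_ne_zero, Multiset.countP_pos]
  constructor
  · rintro ⟨T, h1, h2⟩
    obtain ⟨_, h3, h4, h5⟩ := spec_of_mem_walks hA h1 hs
    exact ⟨T, h3, h5, h2, by omega⟩
  · rintro ⟨T, h1, h2, h3, h4⟩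
    exact ⟨T, h1.mem_walks (h3 0 hk) h2 (by omega), h3⟩

end Walks

end SafeSet

namespace SafeSet

open Finset

/-! ### Searching -/

section Search

open Classical in
/-- The largest number below `m` that satisfies `p`. -/
noncomputable def lastSat (p : ℕ → Prop) : ℕ → Option ℕ
  | 0 => none
  | m + 1 => if p m then some m else lastSat p m

theorem of_lastSat_eq_some {p : ℕ → Prop} {m u : ℕ} (h : lastSat p m = some u) : u < m ∧ p u := by
  induction m with
  | zero => simp [lastSat] at h
  | succ m ih =>
    rw [lastSat] at h
    split_ifs at h with hp
    · obtain rfl := Option.some.inj h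
      exact ⟨by omega, hp⟩
    · exact ⟨(ih h).1.trans (by omega), (ih h).2⟩

theorem lastSat_eq_none_iff {p : ℕ → Prop} {m : ℕ} : lastSat p m = none ↔ ∀ u < m, ¬ p u := by
  induction m with
  | zero => simp [lastSat]
  | succ m ih =>
    rw [lastSat]
    split_ifs with hp
    · simp only [false_iff, not_forall]
      exact ⟨m, by omega, by simpa using hp⟩
    · rw [ih, Nat.forall_lt_succ_right]
      exact ⟨fun h => ⟨h, hp⟩, fun h => h.1⟩

open Classical in
/-- One step of breadth-first search: append `w` if it is a new neighbor of the `i`-th vertex. -/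
noncomputable def bfsStep (A : ℕ → ℕ → Prop) (ok : ℕ → Prop) (i w : ℕ) (l : List ℕ) : List ℕ :=
  if i < l.length ∧ w ∉ l ∧ ok w ∧ A (l.getD i 0) w then l ++ [w] else l

/-- Append the new neighbors `w < m` of the `i`-th vertex. -/
noncomputable def bfsRow (A : ℕ → ℕ → Prop) (ok : ℕ → Prop) (i : ℕ) (l : List ℕ) : ℕ → List ℕ
  | 0 => l
  | w + 1 => bfsStep A ok i w (bfsRow A ok i l w)

/-- Breadth-first search from `u`, the first `i` vertices in the queue having been processed. -/
noncomputable def bfsUpto (A : ℕ → ℕ → Prop) (n : ℕ) (ok : ℕ → Prop) (u : ℕ) : ℕ → List ℕ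
  | 0 => [u]
  | i + 1 => bfsRow A ok i (bfsUpto A n ok u i) n

/-- The vertices reachable from `u` through vertices satisfying `ok`, in breadth-first order. -/
noncomputable def bfs (A : ℕ → ℕ → Prop) (n : ℕ) (ok : ℕ → Prop) (u : ℕ) : List ℕ :=
  bfsUpto A n ok u n

/-- Lists that arise from `[u]` by appending new neighbors satisfying `ok`. -/
inductive Grown (A : ℕ → ℕ → Prop) (ok : ℕ → Prop) (u : ℕ) : List ℕ → Prop
  | single : Grown A ok u [u]
  | snoc {l : List ℕ} {x w : ℕ} : Grown A ok u l → x ∈ l → A x w → w ∉ l → ok w →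
      Grown A ok u (l ++ [w])

variable {A : ℕ → ℕ → Prop} {n : ℕ} {ok : ℕ → Prop} {u : ℕ} {l : List ℕ}

theorem Grown.mem (h : Grown A ok u l) : u ∈ l := by
  induction h with
  | single => simp
  | snoc _ _ _ _ _ ih => simp [ih]

theorem Grown.nodup (h : Grown A ok u l) : l.Nodup := by
  induction h with
  | single => simp
  | snoc _ _ _ hw _ ih => exact List.nodup_append.2 ⟨ih, by simp, by grind⟩

theorem Grown.eq_or (h : Grown A ok u l) {x : ℕ} (hx : x ∈ l) : x = u ∨ ok x := by
  induction h with
  | single => exact .inl (List.mem_singleton.1 hx)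
  | snoc _ _ _ _ hw ih =>
    rcases List.mem_append.1 hx with h | h
    · exact ih h
    · rw [List.mem_singleton.1 h]
      exact .inr hw

theorem Grown.conn (hA : ∀ ⦃x y⦄, A x y → A y x) (h : Grown A ok u l) : Conn A l.toFinset := by
  induction h with
  | single => simpa using Conn.singleton u
  | @snoc l x w _ hx hxw _ _ ih =>
    have : (l ++ [w]).toFinset = insert w l.toFinset := by ext; simp
    rw [this]
    exact ih.insert_of_adj hA (List.mem_toFinset.2 hx) hxw

/-- Every nonempty prefix of the search order is connected; this yields connected sets of a
prescribed size inside a large component. -/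
theorem Grown.take (h : Grown A ok u l) (m : ℕ) : Grown A ok u (l.take (m + 1)) := by
  induction h with
  | single => simpa using Grown.single
  | @snoc l x w hl hx hxw hw hok ih =>
    by_cases hm : m + 1 ≤ l.length
    · rwa [List.take_append_of_le_length hm]
    · rw [List.take_of_length_le (by simp; omega)]
      exact .snoc hl hx hxw hw hok

theorem bfsRow_grown (h : Grown A (fun w => ok w ∧ w < n) u l) (i : ℕ) {m : ℕ} (hm : m ≤ n) :
    Grown A (fun w => ok w ∧ w < n) u (bfsRow A ok i l m) := by
  induction m with
  | zero => exact h
  | succ m ih =>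
    rw [bfsRow, bfsStep]
    split_ifs with hc
    · obtain ⟨h1, h2, h3, h4⟩ := hc
      rw [List.getD_eq_getElem _ _ h1] at h4
      exact .snoc (ih (by omega)) (List.getElem_mem h1) h4 h2 ⟨h3, by omega⟩
    · exact ih (by omega)

theorem bfsUpto_grown (i : ℕ) : Grown A (fun w => ok w ∧ w < n) u (bfsUpto A n ok u i) := by
  induction i with
  | zero => exact .single
  | succ i ih => exact bfsRow_grown ih i le_rfl

theorem bfs_grown : Grown A (fun w => ok w ∧ w < n) u (bfs A n ok u) := bfsUpto_grown n

theorem prefix_bfsStep (i w : ℕ) : l <+: bfsStep A ok i w l := by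
  rw [bfsStep]
  split_ifs
  · exact List.prefix_append _ _
  · exact List.prefix_refl _

theorem prefix_bfsRow (i m : ℕ) : l <+: bfsRow A ok i l m := by
  induction m with
  | zero => exact List.prefix_refl _
  | succ m ih => exact ih.trans (prefix_bfsStep i m)

theorem bfsRow_eq_self {i : ℕ} (hi : l.length ≤ i) (m : ℕ) : bfsRow A ok i l m = l := by
  induction m with
  | zero => rfl
  | succ m ih => rw [bfsRow, ih, bfsStep, if_neg (by omega)]

theorem getD_of_prefix {l l' : List ℕ} (h : l <+: l') {i : ℕ} (hi : i < l.length) :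
    l'.getD i 0 = l.getD i 0 := by
  obtain ⟨r, rfl⟩ := h
  rw [List.getD_append _ _ _ _ hi]

theorem mem_bfsRow {i : ℕ} (hi : i < l.length) {m w : ℕ} (hw : w < m) (hok : ok w)
    (hA : A (l.getD i 0) w) : w ∈ bfsRow A ok i l m := by
  induction m with
  | zero => omega
  | succ m ih =>
    by_cases h : w < m
    · exact (prefix_bfsStep i m).subset (ih h)
    · obtain rfl : w = m := by omega
      rw [bfsRow, bfsStep]
      have hp : l <+: bfsRow A ok i l w := prefix_bfsRow i w
      split_ifs with hc
      · simp
      · by_contra hmem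
        exact hc ⟨hi.trans_le hp.length_le, hmem, hok, by rwa [getD_of_prefix hp hi]⟩

/-- The queue only grows at its end, so entry `j` is still the one processed in round `j`; rounds
beyond the end of the queue change nothing. -/
theorem mem_bfsUpto {i j : ℕ} (hj : j < i) (hlen : j < (bfsUpto A n ok u i).length) {w : ℕ}
    (hw : w < n) (hok : ok w) (hA : A ((bfsUpto A n ok u i).getD j 0) w) :
    w ∈ bfsUpto A n ok u i := by
  induction i with
  | zero => omega
  | succ i ih =>
    rw [bfsUpto] at hlen hA ⊢
    have hp : bfsUpto A n ok u i <+: bfsRow A ok i (bfsUpto A n ok u i) n := prefix_bfsRow i n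
    by_cases hi : i < (bfsUpto A n ok u i).length
    · rw [getD_of_prefix hp (by omega)] at hA
      rcases Nat.lt_succ_iff_lt_or_eq.1 hj with h | rfl
      · exact hp.subset (ih h (by omega) hA)
      · exact mem_bfsRow hi hw hok hA
    · rw [bfsRow_eq_self (by omega)] at hlen hA ⊢
      exact ih (by omega) hlen hA

theorem mem_bfs_lt (hu : u < n) {x : ℕ} (hx : x ∈ bfs A n ok u) : x < n := by
  rcases bfs_grown.eq_or hx with rfl | h
  exacts [hu, h.2]

theorem mem_bfs_ok (hu : ok u) {x : ℕ} (hx : x ∈ bfs A n ok u) : ok x := by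
  rcases bfs_grown.eq_or hx with rfl | h
  exacts [hu, h.1]

theorem length_bfs_le (hu : u < n) : (bfs A n ok u).length ≤ n := by
  rw [← List.toFinset_card_of_nodup bfs_grown.nodup]
  refine (card_le_card (t := range n) fun x hx => ?_).trans (card_range n).le
  exact mem_range.2 (mem_bfs_lt hu (List.mem_toFinset.1 hx))

/-- The queue has no repetitions and hence at most `n` entries, so `n` rounds process all of them.
-/
theorem mem_bfs_of_adj (hu : u < n) {x w : ℕ} (hx : x ∈ bfs A n ok u) (hw : w < n) (hok : ok w)
    (hxw : A x w) : w ∈ bfs A n ok u := by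
  obtain ⟨j, hj, rfl⟩ := List.mem_iff_getElem.1 hx
  refine mem_bfsUpto (j := j) (hj.trans_le (length_bfs_le hu)) hj hw hok ?_
  change A ((bfs A n ok u).getD j 0) w
  rwa [List.getD_eq_getElem _ _ hj]

theorem subset_bfs (hu : u < n) {D : Finset ℕ} (hD : Conn A D) (huD : u ∈ D)
    (h : ∀ x ∈ D, x < n ∧ ok x) : D ⊆ (bfs A n ok u).toFinset := by
  refine hD.subset_of_closed huD (List.mem_toFinset.2 bfs_grown.mem) fun a ha b hb hab => ?_
  rw [List.mem_toFinset] at ha ⊢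
  exact mem_bfs_of_adj hu ha (h b hb).1 (h b hb).2 hab

end Search

/-! ### The algorithm -/

section Algorithm

variable {A : ℕ → ℕ → Prop} {n k : ℕ}

/-- No connected set outside of `T` that is adjacent to `T` has more than `q` elements. -/
def NoLarge (A : ℕ → ℕ → Prop) (n q : ℕ) (T : Finset ℕ) : Prop :=
  ∀ D ⊆ range n, Conn A D → Disjoint D T → (∃ a ∈ D, ∃ b ∈ T, A a b) → D.card ≤ q

/-- A connected set that is not adjacent to a larger connected set outside. -/
def Good (A : ℕ → ℕ → Prop) (n : ℕ) (T : Finset ℕ) : Prop :=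
  Conn A T ∧ T ⊆ range n ∧ NoLarge A n T.card T

/-- The set of the first `k` values of `s`. -/
def supp (k : ℕ) (s : ℕ → ℕ) : Finset ℕ := (range k).image s

theorem mem_supp {s : ℕ → ℕ} {u : ℕ} : u ∈ supp k s ↔ ∃ j < k, s j = u := by
  simp [supp]

/-- The vertex `u` lies outside of `S`, is adjacent to `S`, and its component of the complement
of `S` has more than `q` vertices. -/
def Big (A : ℕ → ℕ → Prop) (n q : ℕ) (S : Finset ℕ) (u : ℕ) : Prop :=
  u ∉ S ∧ (∃ w < n, w ∈ S ∧ A u w) ∧ q < (bfs A n (· ∉ S) u).length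

/-- The first `k` values of `s` lie in a connected set of at most `k` vertices. -/
def Extends (A : ℕ → ℕ → Prop) (n k : ℕ) (s : ℕ → ℕ) : Prop :=
  ∃ T, Conn A T ∧ T ⊆ range n ∧ (∀ j < k, s j ∈ T) ∧ T.card ≤ k

/-- The vertex put into slot `j` of `s`, given the digit `d` of the code. -/
noncomputable def pick (A : ℕ → ℕ → Prop) (n k : ℕ) (s : ℕ → ℕ) (j d : ℕ) : ℕ :=
  match lastSat (Big A n k (supp k s)) n with
  | some u => (bfs A n (· ∉ supp k s) u).getD d 0
  | none =>
    (lastSat (fun u => u ∉ supp k s ∧ Extends A n k (Function.update s j u)) n).getD (s 0)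

/-- Fill slot `j` and remove a digit from the code. -/
noncomputable def step (A : ℕ → ℕ → Prop) (n k j : ℕ) (p : (ℕ → ℕ) × ℕ) : (ℕ → ℕ) × ℕ :=
  (Function.update p.1 j (pick A n k p.1 j (p.2 % (k + 1))), p.2 / (k + 1))

/-- Fill `r` slots, starting at slot `j`. -/
noncomputable def fill (A : ℕ → ℕ → Prop) (n k j : ℕ) (p : (ℕ → ℕ) × ℕ) : ℕ → (ℕ → ℕ) × ℕ
  | 0 => p
  | r + 1 => step A n k (j + r) (fill A n k j p r)

theorem fill_succ (j : ℕ) (p : (ℕ → ℕ) × ℕ) (r : ℕ) :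
    fill A n k j p (r + 1) = fill A n k (j + 1) (step A n k j p) r := by
  induction r with
  | zero => rfl
  | succ r ih =>
    rw [fill, ih, fill]
    congr 1
    omega

/-- A large connected set `D` next to `T` lies in a component `R` of the complement of `S`. As `D ∪
T` is connected and reaches `S`, the component `R` is adjacent to `S`. Thus absence of big vertices
for `S` is inherited, as `NoLarge`, by all connected supersets. -/
theorem big_of_not_noLarge (hA : ∀ ⦃x y⦄, A x y → A y x) {S T : Finset ℕ} (hS : S.Nonempty)
    (hST : S ⊆ T) (hT : Conn A T) (hTn : T ⊆ range n) {q : ℕ} (h : ¬ NoLarge A n q T) :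
    ∃ u < n, Big A n q S u := by
  simp only [NoLarge, not_forall, not_le] at h
  obtain ⟨D, hDn, hD, hDT, ⟨a, ha, b, hb, hab⟩, hq⟩ := h
  have han : a < n := mem_range.1 (hDn ha)
  have hDS : ∀ x ∈ D, x < n ∧ x ∉ S := fun x hx =>
    ⟨mem_range.1 (hDn hx), fun hxS => disjoint_left.1 hDT hx (hST hxS)⟩
  set R := (bfs A n (· ∉ S) a).toFinset with hR
  have hRS : ∀ x ∈ R, x < n ∧ x ∉ S := fun x hx =>
    ⟨mem_bfs_lt han (List.mem_toFinset.1 hx),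
      mem_bfs_ok (ok := (· ∉ S)) (hDS a ha).2 (List.mem_toFinset.1 hx)⟩
  have hDR : D ⊆ R := subset_bfs han hD ha hDS
  have hDT' : Conn A (D ∪ T) := hD.union_of_adj hA hT ha hb hab
  obtain ⟨s, hs⟩ := hS
  -- An edge of `D ∪ T` leaving `R` must end in `S`, for otherwise the search would have continued
  -- to its end `y`. The vertex `x` is the big vertex.
  obtain ⟨x, hx, y, hy, hxy⟩ := hDT'.2 (R ∩ (D ∪ T)) inter_subset_right
    ⟨a, mem_inter.2 ⟨hDR ha, mem_union_left _ ha⟩⟩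
    (fun h => (hRS s (mem_inter.1 (h ▸ mem_union_right D (hST hs))).1).2 hs)
  have hxR : x ∈ R := (mem_inter.1 hx).1
  have hyn : y < n := mem_range.1 (union_subset hDn hTn (mem_sdiff.1 hy).1)
  have hyS : y ∈ S := by
    by_contra hyS
    refine (mem_sdiff.1 hy).2 (mem_inter.2 ⟨?_, (mem_sdiff.1 hy).1⟩)
    rw [hR, List.mem_toFinset] at hxR ⊢
    exact mem_bfs_of_adj (ok := (· ∉ S)) han hxR hyn hyS hxy
  refine ⟨x, (hRS x hxR).1, (hRS x hxR).2, ⟨y, hyn, hyS, hxy⟩, ?_⟩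
  rw [← List.toFinset_card_of_nodup bfs_grown.nodup]
  exact hq.trans_le ((card_le_card hDR).trans (card_le_card
    (subset_bfs (hRS x hxR).1 (bfs_grown.conn hA) hxR hRS)))

/-- A set with a big vertex is met by every connected set without large neighbors. -/
theorem Big.exists_getD_mem (hA : ∀ ⦃x y⦄, A x y → A y x) {S T : Finset ℕ} (hST : S ⊆ T) {q u : ℕ}
    (hT : NoLarge A n q T) (hu : u < n) (h : Big A n q S u) :
    ∃ d < q + 1, (bfs A n (· ∉ S) u).getD d 0 ∈ T ∧ (bfs A n (· ∉ S) u).getD d 0 ∉ S := by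
  obtain ⟨huS, ⟨w, hw, hwS, huw⟩, hq⟩ := h
  by_contra! hcon
  -- The queue never meets `S`, so a failure for all digits puts the first `q + 1` entries outside
  -- `T`. They form a connected set adjacent to `T` through `u`, which is too large for `NoLarge`.
  have hmem : ∀ x ∈ (bfs A n (· ∉ S) u).take (q + 1), x ∉ T := by
    intro x hx
    obtain ⟨d, hd, rfl⟩ := List.mem_iff_getElem.1 hx
    rw [List.length_take] at hd
    rw [List.getElem_take]
    intro hxT
    have h1 : d < (bfs A n (· ∉ S) u).length := by omega
    have := hcon d (by omega)
    rw [List.getD_eq_getElem _ _ h1] at this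
    exact mem_bfs_ok (ok := (· ∉ S)) huS (List.getElem_mem h1) (this hxT)
  have hg := (bfs_grown (A := A) (n := n) (ok := (· ∉ S)) (u := u)).take q
  have := hT ((bfs A n (· ∉ S) u).take (q + 1)).toFinset ?_ (hg.conn hA) ?_
    ⟨u, List.mem_toFinset.2 hg.mem, w, hST hwS, huw⟩
  · rw [List.toFinset_card_of_nodup hg.nodup, List.length_take] at this
    omega
  · intro x hx
    exact mem_range.2 (mem_bfs_lt hu (List.mem_of_mem_take (List.mem_toFinset.1 hx)))
  · exact disjoint_left.2 fun x hx => hmem x (List.mem_toFinset.1 hx)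

/-- With `T = S` the branching lemma would yield a vertex both inside and outside `S`. -/
theorem Big.not_noLarge (hA : ∀ ⦃x y⦄, A x y → A y x) {S : Finset ℕ} {q u : ℕ} (hu : u < n)
    (h : Big A n q S u) : ¬ NoLarge A n q S := by
  intro hS
  obtain ⟨d, _, h1, h2⟩ := h.exists_getD_mem hA Subset.rfl hS hu
  exact h2 h1

/-- The criterion by which a set `S` is checked. -/
theorem good_iff (hA : ∀ ⦃x y⦄, A x y → A y x) {S : Finset ℕ} {v : ℕ} (hv : v ∈ S)
    (hS : S ⊆ range n) : Good A n S ↔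
      (bfs A n (· ∈ S) v).length = S.card ∧ lastSat (Big A n S.card S) n = none := by
  have hvn := mem_range.1 (hS hv)
  have hsub : (bfs A n (· ∈ S) v).toFinset ⊆ S := fun x hx =>
    mem_bfs_ok (ok := (· ∈ S)) hv (List.mem_toFinset.1 hx)
  have hconn : Conn A S ↔ (bfs A n (· ∈ S) v).length = S.card := by
    rw [← List.toFinset_card_of_nodup bfs_grown.nodup]
    constructor
    · intro h
      rw [hsub.antisymm (subset_bfs hvn h hv fun x hx => ⟨mem_range.1 (hS hx), hx⟩)]
    · intro h
      rw [← eq_of_subset_of_card_le hsub h.ge]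
      exact bfs_grown.conn hA
  rw [← hconn, lastSat_eq_none_iff, Good]
  refine and_congr_right fun hc => ⟨fun h u hu hb => hb.not_noLarge hA hu h.2, fun h => ⟨hS, ?_⟩⟩
  by_contra hn
  obtain ⟨u, hu, hb⟩ := big_of_not_noLarge hA ⟨v, hv⟩ Subset.rfl hc hS hn
  exact h u hu hb

/-! ### Correctness of the search tree -/

/-- The invariant of the algorithm: `T` is a witness for the choices made in the first `j`
slots. -/
structure Witness (A : ℕ → ℕ → Prop) (n k j : ℕ) (s : ℕ → ℕ) (T : Finset ℕ) : Prop where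
  const : ∀ i, j ≤ i → s i = s 0
  conn : Conn A T
  lt : T ⊆ range n
  sub : supp k s ⊆ T
  card_le : T.card ≤ k
  noLarge : NoLarge A n k T
  progress : (supp k s).card = j ∨ ∀ T', Conn A T' → T' ⊆ range n → supp k s ⊆ T' →
    T'.card ≤ k → T' = supp k s

/-- An unused slot repeats slot `0`, so overwriting it loses no vertex. -/
theorem supp_update {s : ℕ → ℕ} {j : ℕ} (h0 : 0 < j) (hj : j < k) (hs : s j = s 0) (x : ℕ) :
    supp k (Function.update s j x) = insert x (supp k s) := by
  ext u
  simp only [mem_insert, mem_supp]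
  constructor
  · rintro ⟨i, hi, rfl⟩
    by_cases hij : i = j
    · subst hij
      simp
    · exact .inr ⟨i, hi, by rw [Function.update_of_ne hij]⟩
  · rintro (rfl | ⟨i, hi, rfl⟩)
    · exact ⟨j, hj, by simp⟩
    · by_cases hij : i = j
      · exact ⟨0, by omega, by rw [Function.update_of_ne (by omega), hij, hs]⟩
      · exact ⟨i, hi, by rw [Function.update_of_ne hij]⟩

/-- The three cases of `pick`. With a big vertex, some digit names a vertex of `T` outside the
support, and `T` remains the witness. Without one, if a new vertex passes the extension test, the
set certifying this becomes the witness; it inherits `NoLarge`. If no vertex passes, the support is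
the only connected set of at most `k` vertices containing it, and the slot is wasted on `s 0`. -/
theorem Witness.step (hA : ∀ ⦃x y⦄, A x y → A y x) {j : ℕ} {s : ℕ → ℕ} {T : Finset ℕ}
    (h : Witness A n k j s T) (h0 : 0 < j) (hj : j < k) :
    ∃ d < k + 1, ∃ T', Witness A n k (j + 1) (Function.update s j (pick A n k s j d)) T' := by
  have hsj : s j = s 0 := h.const j le_rfl
  have hconst : ∀ x i, j + 1 ≤ i →
      Function.update s j x i = Function.update s j x 0 := fun x i hi => by
    rw [Function.update_of_ne (by omega), Function.update_of_ne (by omega), h.const i (by omega)]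
  have hne : (supp k s).Nonempty := ⟨s 0, mem_supp.2 ⟨0, by omega, rfl⟩⟩
  have hself : ∀ d, pick A n k s j d = s 0 → (∀ T', Conn A T' → T' ⊆ range n → supp k s ⊆ T' →
      T'.card ≤ k → T' = supp k s) →
      Witness A n k (j + 1) (Function.update s j (pick A n k s j d)) T := by
    intro d hd hmax
    have : Function.update s j (pick A n k s j d) = s := by rw [hd, ← hsj, Function.update_eq_self]
    rw [this]
    exact ⟨fun i hi => h.const i (by omega), h.conn, h.lt, h.sub, h.card_le, h.noLarge,
      .inr hmax⟩
  cases hb : lastSat (Big A n k (supp k s)) n with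
  | some u =>
    obtain ⟨hu, hbig⟩ := of_lastSat_eq_some hb
    obtain ⟨d, hd, h1, h2⟩ := hbig.exists_getD_mem hA h.sub h.noLarge hu
    refine ⟨d, hd, T, hconst _, h.conn, h.lt, ?_, h.card_le, h.noLarge, ?_⟩
    · rw [supp_update h0 hj hsj, pick, hb]
      exact insert_subset h1 h.sub
    · rw [supp_update h0 hj hsj, pick, hb]
      simp only
      rcases h.progress with hp | hp
      · exact .inl (by rw [card_insert_of_notMem h2, hp])
      · exact absurd (hp T h.conn h.lt h.sub h.card_le ▸ h1) h2
  | none =>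
    have hnb := lastSat_eq_none_iff.1 hb
    cases hg : lastSat (fun u => u ∉ supp k s ∧ Extends A n k (Function.update s j u)) n with
    | some u =>
      obtain ⟨hu, huS, T', c1, c2, c3, c4⟩ := of_lastSat_eq_some hg
      have hpick : pick A n k s j 0 = u := by simp [pick, hb, hg]
      have hsub : supp k (Function.update s j u) ⊆ T' := fun x hx => by
        obtain ⟨i, hi, rfl⟩ := mem_supp.1 hx
        exact c3 i hi
      refine ⟨0, by omega, T', ?_⟩
      rw [hpick]
      refine ⟨hconst _, c1, c2, hsub, c4, ?_, ?_⟩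
      · by_contra hn
        rw [supp_update h0 hj hsj] at hsub
        obtain ⟨x, hx, hx'⟩ := big_of_not_noLarge hA hne
          ((subset_insert _ _).trans hsub) c1 c2 hn
        exact hnb x hx hx'
      · rw [supp_update h0 hj hsj] at hsub ⊢
        rcases h.progress with hp | hp
        · exact .inl (by rw [card_insert_of_notMem huS, hp])
        · have := hp T' c1 c2 ((subset_insert _ _).trans hsub) c4
          exact absurd (this ▸ hsub (mem_insert_self _ _)) huS
    | none =>
      refine ⟨0, by omega, T, hself 0 (by simp [pick, hb, hg]) ?_⟩
      intro T' c1 c2 c3 c4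
      by_contra hne'
      obtain ⟨u, hu, huS⟩ := exists_of_ssubset (c3.ssubset_of_ne (Ne.symm hne'))
      refine lastSat_eq_none_iff.1 hg u (mem_range.1 (c2 hu)) ⟨huS, T', c1, c2, fun i hi => ?_, c4⟩
      have : Function.update s j u i ∈ supp k (Function.update s j u) := mem_supp.2 ⟨i, hi, rfl⟩
      rw [supp_update h0 hj hsj] at this
      exact insert_subset hu c3 this

/-- With all slots filled, either alternative of `progress` forces the witness to equal the support.
-/
theorem Witness.good (hA : ∀ ⦃x y⦄, A x y → A y x) {s : ℕ → ℕ} {T : Finset ℕ}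
    (h : Witness A n k k s T) : Good A n (supp k s) := by
  have hmax : ∀ T', Conn A T' → T' ⊆ range n → supp k s ⊆ T' → T'.card ≤ k → T' = supp k s := by
    rcases h.progress with hp | hp
    · exact fun T' _ _ c3 c4 => (eq_of_subset_of_card_le c3 (by omega)).symm
    · exact hp
  have hT := hmax T h.conn h.lt h.sub h.card_le
  rw [← hT]
  refine ⟨h.conn, h.lt, fun D hDn hD hDT hadj => ?_⟩
  -- If `T` had fewer than `k` vertices, adding its neighbor `a` would give another connected
  -- superset of at most `k` vertices. So a set smaller than `k` has no neighbors and nothing is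
  -- left to show.
  have hk : T.card = k := by
    by_contra hk
    have hlt := lt_of_le_of_ne h.card_le hk
    obtain ⟨a, ha, b, hb, hab⟩ := hadj
    have haT : a ∉ T := disjoint_left.1 hDT ha
    have := hmax (insert a T) (h.conn.insert_of_adj hA hb (hA hab)) (insert_subset (hDn ha) h.lt)
      (h.sub.trans (subset_insert _ _)) (by rw [card_insert_of_notMem haT]; omega)
    exact haT (by rw [hT, ← this]; exact mem_insert_self _ _)
  rw [hk]
  exact h.noLarge D hDn hD hDT hadj

/-- The algorithm finds a solution for one of the codes. -/
theorem exists_good_fill (hA : ∀ ⦃x y⦄, A x y → A y x) {T : Finset ℕ} (hT : Good A n T)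
    (hk : T.card ≤ k) : ∃ v < n, ∃ c < (k + 1) ^ (k - 1),
      Good A n (supp k (fill A n k 1 (fun _ => v, c) (k - 1)).1) := by
  have key : ∀ r j s T, 0 < j → j + r = k → Witness A n k j s T →
      ∃ c < (k + 1) ^ r, Good A n (supp k (fill A n k j (s, c) r).1) := by
    intro r
    induction r with
    | zero =>
      intro j s T _ hj h
      obtain rfl : j = k := by omega
      exact ⟨0, by simp, h.good hA⟩
    | succ r ih =>
      intro j s T h0 hj h
      obtain ⟨d, hd, T', h'⟩ := h.step hA h0 (by omega)
      obtain ⟨c, hc, hgood⟩ := ih (j + 1) _ T' (by omega) (by omega) h'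
      -- The digit of the current slot is the least significant one, as `step` consumes the code by
      -- remainder and quotient.
      refine ⟨d + (k + 1) * c, ?_, ?_⟩
      · rw [pow_succ']
        calc d + (k + 1) * c < (k + 1) * (c + 1) := by rw [mul_add, mul_one]; omega
          _ ≤ _ := Nat.mul_le_mul_left _ hc
      · rw [fill_succ, SafeSet.step]
        simp only
        rw [Nat.add_mul_mod_self_left, Nat.mod_eq_of_lt hd, Nat.add_mul_div_left _ _ (by omega),
          Nat.div_eq_of_lt hd, zero_add]
        exact hgood
  obtain ⟨v, hv⟩ := hT.1.1
  have hpos : 0 < k := (card_pos.2 ⟨v, hv⟩).trans_le hk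
  have hsupp : supp k (fun _ => v) = {v} := by
    ext u
    simp only [mem_supp, mem_singleton]
    exact ⟨fun ⟨_, _, h⟩ => h.symm, fun h => ⟨0, hpos, h.symm⟩⟩
  refine ⟨v, mem_range.1 (hT.2.1 hv), key (k - 1) 1 _ T one_pos (by omega)
    ⟨fun _ _ => rfl, hT.1, hT.2.1, ?_, hk, fun D h1 h2 h3 h4 => (hT.2.2 D h1 h2 h3 h4).trans hk,
      .inl ?_⟩⟩
  · rw [hsupp]
    exact singleton_subset_iff.2 hv
  · rw [hsupp, card_singleton]

theorem card_supp_le (k : ℕ) (s : ℕ → ℕ) : (supp k s).card ≤ k :=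
  card_image_le.trans (card_range k).le

end Algorithm

end SafeSet

namespace SafeSet

open Finset

/-! ### Connected safe sets in terms of `Good` -/

section Transfer

/-- A walk from inside `U` to outside has a boundary edge; conversely, the vertices reachable from a
fixed one are closed under adjacency in `T`, hence all of `T`. -/
theorem connected_induce_iff_conn {V : Type*} [DecidableEq V] (G : SimpleGraph V) (T : Finset V) :
    (G.induce (T : Set V)).Connected ↔ Conn G.Adj T := by
  constructor
  · intro h
    obtain ⟨⟨v, hv⟩⟩ := h.nonempty
    refine ⟨⟨v, hv⟩, fun U hU ⟨x, hx⟩ hUT => ?_⟩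
    obtain ⟨y, hy, hyU⟩ := exists_of_ssubset (hU.ssubset_of_ne hUT)
    obtain ⟨p⟩ := h.preconnected ⟨x, hU hx⟩ ⟨y, hy⟩
    obtain ⟨d, _, h1, h2⟩ := p.exists_boundary_dart {z | z.1 ∈ U} hx hyU
    exact ⟨d.fst.1, h1, d.snd.1, mem_sdiff.2 ⟨d.snd.2, h2⟩, d.adj⟩
  · rintro h
    obtain ⟨v, hv⟩ := h.1
    classical
    have : T ⊆ T.filter (fun x => ∃ hx : x ∈ T,
        (G.induce (T : Set V)).Reachable ⟨v, hv⟩ ⟨x, hx⟩) := by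
      refine h.subset_of_closed hv (mem_filter.2 ⟨hv, hv, .refl _⟩) fun a ha b hb hab => ?_
      obtain ⟨_, ha, hr⟩ := mem_filter.1 ha
      exact mem_filter.2 ⟨hb, hb, hr.trans (SimpleGraph.Adj.reachable (by simpa using hab))⟩
    rw [SimpleGraph.connected_iff_exists_forall_reachable]
    exact ⟨⟨v, hv⟩, fun ⟨x, hx⟩ => (mem_filter.1 (this hx)).2.2⟩

/-- Every connected subset lies in a component. -/
theorem exists_isComponent {V : Type*} (G : SimpleGraph V) {U D : Finset V} (hD : D ⊆ U)
    (h : (G.induce (D : Set V)).Connected) : ∃ C, IsComponent G U C ∧ D ⊆ C := by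
  have hfin : {C : Finset V | C ⊆ U ∧ (G.induce (C : Set V)).Connected}.Finite :=
    (finite_toSet U.powerset).subset fun C hC => by simpa using hC.1
  obtain ⟨C, hDC, hC⟩ := hfin.exists_le_maximal (a := D) ⟨hD, h⟩
  exact ⟨C, hC, hDC⟩

/-- A connected `S` is its own only component. On the other side components may be replaced by
arbitrary connected sets: each lies in a component, which is then adjacent to `S` and at least as
large. -/
theorem isConnectedSafe_iff {V : Type*} [Fintype V] [DecidableEq V] (G : SimpleGraph V)
    (S : Finset V) : IsConnectedSafe G S ↔ Conn G.Adj S ∧ ∀ D, Conn G.Adj D → Disjoint D S →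
      (∃ a ∈ D, ∃ b ∈ S, G.Adj a b) → D.card ≤ S.card := by
  rw [IsConnectedSafe, connected_induce_iff_conn, and_comm]
  refine and_congr_right fun hS => ?_
  have hcomp : ∀ C, IsComponent G S C ↔ C = S := by
    have hSc := (connected_induce_iff_conn G S).2 hS
    intro C
    constructor
    · intro h
      exact h.prop.1.antisymm (h.le_of_ge ⟨Subset.rfl, hSc⟩ h.prop.1)
    · rintro rfl
      exact ⟨⟨Subset.rfl, hSc⟩, fun D hD _ => hD.1⟩
  constructor
  · intro h D hD hDS ⟨a, ha, b, hb, hab⟩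
    obtain ⟨C, hC, hDC⟩ := exists_isComponent G (U := Sᶜ)
      (fun x hx => mem_compl.2 (disjoint_left.1 hDS hx)) ((connected_induce_iff_conn G D).2 hD)
    have := h.2 S C ((hcomp S).2 rfl) hC ⟨b, hb, a, hDC ha, hab.symm⟩
    exact (card_le_card hDC).trans (not_lt.1 this)
  · intro h
    refine ⟨hS.1, fun C D hC hD hadj => ?_⟩
    obtain rfl := (hcomp C).1 hC
    obtain ⟨a, ha, b, hb, hab⟩ := hadj
    refine not_lt.2 (h D ((connected_induce_iff_conn G D).1 hD.prop.2) ?_ ⟨b, hb, a, ha, hab.symm⟩)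
    exact disjoint_left.2 fun x hx => mem_compl.1 (hD.prop.1 hx)

variable {n : ℕ} (G : SimpleGraph (Fin n))

/-- The adjacency relation of `G` on natural numbers. -/
def natAdj (x y : ℕ) : Prop := ∃ u v : Fin n, u.val = x ∧ v.val = y ∧ G.Adj u v

theorem natAdj_symm ⦃x y : ℕ⦄ (h : natAdj G x y) : natAdj G y x := by
  obtain ⟨u, v, hu, hv, h⟩ := h
  exact ⟨v, u, hv, hu, h.symm⟩

theorem natAdj_val (u v : Fin n) : natAdj G u v ↔ G.Adj u v := by
  constructor
  · rintro ⟨u', v', hu, hv, h⟩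
    rwa [← Fin.ext hu, ← Fin.ext hv]
  · exact fun h => ⟨u, v, rfl, rfl, h⟩

theorem conn_map_iff (T : Finset (Fin n)) :
    Conn (natAdj G) (T.map Fin.valEmbedding) ↔ Conn G.Adj T := by
  constructor
  · rintro ⟨h1, h2⟩
    refine ⟨map_nonempty.1 h1, fun U hU hne hUT => ?_⟩
    obtain ⟨a, ha, b, hb, hab⟩ := h2 (U.map Fin.valEmbedding) (map_subset_map.2 hU) (hne.map)
      (fun h => hUT (map_injective _ h))
    rw [← Finset.map_sdiff] at hb
    obtain ⟨a, ha', rfl⟩ := mem_map.1 ha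
    obtain ⟨b, hb', rfl⟩ := mem_map.1 hb
    exact ⟨a, ha', b, hb', (natAdj_val G a b).1 hab⟩
  · rintro ⟨h1, h2⟩
    refine ⟨h1.map, fun U hU hne hUT => ?_⟩
    obtain ⟨U, rfl⟩ : ∃ U' : Finset (Fin n), U = U'.map Fin.valEmbedding := by
      obtain ⟨U', _, h⟩ := subset_map_iff.1 hU
      exact ⟨U', h⟩
    obtain ⟨a, ha, b, hb, hab⟩ := h2 U (map_subset_map.1 hU) (map_nonempty.1 hne)
      (fun h => hUT (by rw [h]))
    refine ⟨a, mem_map_of_mem _ ha, b, ?_, (natAdj_val G a b).2 hab⟩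
    rw [← Finset.map_sdiff]
    exact mem_map_of_mem _ hb

theorem exists_map_of_subset_range {T : Finset ℕ} (hT : T ⊆ range n) :
    ∃ S : Finset (Fin n), S.map Fin.valEmbedding = T := by
  refine ⟨univ.filter (fun v => v.val ∈ T), ?_⟩
  ext x
  simp only [mem_map, mem_filter, mem_univ, true_and, Fin.valEmbedding_apply]
  exact ⟨fun ⟨v, h, hx⟩ => hx ▸ h, fun h => ⟨⟨x, mem_range.1 (hT h)⟩, h, rfl⟩⟩

theorem map_val_subset_range (S : Finset (Fin n)) : S.map Fin.valEmbedding ⊆ range n := by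
  intro x hx
  obtain ⟨v, _, rfl⟩ := mem_map.1 hx
  exact mem_range.2 v.isLt

theorem good_map_iff (S : Finset (Fin n)) :
    Good (natAdj G) n (S.map Fin.valEmbedding) ↔ IsConnectedSafe G S := by
  rw [isConnectedSafe_iff, Good, conn_map_iff, card_map]
  refine and_congr_right fun _ => ⟨fun h D hD hDS ⟨a, ha, b, hb, hab⟩ => ?_, fun h =>
    ⟨map_val_subset_range S, fun D hDn hD hDS ⟨a, ha, b, hb, hab⟩ => ?_⟩⟩
  · rw [← card_map Fin.valEmbedding]
    exact h.2 _ (map_val_subset_range D) ((conn_map_iff G D).2 hD) ((disjoint_map _).2 hDS)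
      ⟨a, mem_map_of_mem _ ha, b, mem_map_of_mem _ hb, (natAdj_val G a b).2 hab⟩
  · obtain ⟨D, rfl⟩ := exists_map_of_subset_range hDn
    obtain ⟨a, ha', rfl⟩ := mem_map.1 ha
    obtain ⟨b, hb', rfl⟩ := mem_map.1 hb
    rw [card_map]
    exact h D ((conn_map_iff G D).1 hD) ((disjoint_map _).1 hDS)
      ⟨a, ha', b, hb', (natAdj_val G a b).1 hab⟩

end Transfer

end SafeSet

namespace RAM

/-! ### Evaluation rules for expressions and programs -/

namespace Expr

instance : Add Expr := ⟨.op .add⟩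
instance : Sub Expr := ⟨.op .sub⟩
instance : Mul Expr := ⟨.op .mul⟩
instance : Div Expr := ⟨.op .div⟩
instance : Mod Expr := ⟨.op .mod⟩
instance (c : ℕ) : OfNat Expr c := ⟨.lit c⟩

@[simp] theorem eval_zero (σ : Mem) : (0 : Expr).eval σ = 0 := rfl
@[simp] theorem eval_one (σ : Mem) : (1 : Expr).eval σ = 1 := rfl
@[simp] theorem eval_two (σ : Mem) : (2 : Expr).eval σ = 2 := rfl
@[simp] theorem eval_three (σ : Mem) : (3 : Expr).eval σ = 3 := rfl
@[simp] theorem eval_four (σ : Mem) : (4 : Expr).eval σ = 4 := rfl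
@[simp] theorem eval_cell (σ : Mem) (a : ℕ) (e : Expr) : (cell a e).eval σ = σ a (e.eval σ) := rfl
@[simp] theorem eval_add (σ : Mem) (e f : Expr) : (e + f).eval σ = e.eval σ + f.eval σ := rfl
@[simp] theorem eval_sub (σ : Mem) (e f : Expr) : (e - f).eval σ = e.eval σ - f.eval σ := rfl
@[simp] theorem eval_mul (σ : Mem) (e f : Expr) : (e * f).eval σ = e.eval σ * f.eval σ := rfl
@[simp] theorem eval_div (σ : Mem) (e f : Expr) : (e / f).eval σ = e.eval σ / f.eval σ := rfl
@[simp] theorem eval_mod (σ : Mem) (e f : Expr) : (e % f).eval σ = e.eval σ % f.eval σ := rfl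
@[simp] theorem eval_lt (σ : Mem) (e f : Expr) :
    (op .lt e f).eval σ = if e.eval σ < f.eval σ then 1 else 0 := rfl
@[simp] theorem eval_eq (σ : Mem) (e f : Expr) :
    (op .eq e f).eval σ = if e.eval σ = f.eval σ then 1 else 0 := rfl

end Expr

namespace FProg

@[simp] theorem den_skip (σ : Mem) : skip.den σ = σ := rfl
@[simp] theorem den_assign (σ : Mem) (a : ℕ) (i e : Expr) :
    (assign a i e).den σ = σ.write a (i.eval σ) (e.eval σ) := rfl
@[simp] theorem den_seq (σ : Mem) (P Q : FProg) : (seq P Q).den σ = Q.den (P.den σ) := rfl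
@[simp] theorem den_ite (σ : Mem) (e : Expr) (P Q : FProg) :
    (ite e P Q).den σ = if e.eval σ ≠ 0 then P.den σ else Q.den σ := rfl

end FProg

end RAM

namespace SafeSet

open Finset RAM RAM.FProg

attribute [local simp] Mem.write_apply

/-! ### The program -/

/-- A scalar variable. -/
abbrev var (a : ℕ) : Expr := .cell a 0

/-- The number of vertices. -/
abbrev numV : Expr := .cell 5 0

/-- The size bound. -/
abbrev bound : Expr := .cell 5 1

infixr:50 " ;; " => FProg.seq

/-- The memory holds the constants and the adjacency matrix. -/
structure Env (A : ℕ → ℕ → Prop) (n k : ℕ) (σ : Mem) : Prop where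
  numV : σ 5 0 = n
  bound : σ 5 1 = k
  two : σ 5 2 = 2 ^ k
  codes : σ 5 3 = (k + 1) ^ (k - 1)
  modulus : σ 5 4 = (4 * n) ^ n
  adj : ∀ u < n, ∀ w < n, (A u w → σ 1 (u * n + w) = 1) ∧ (¬ A u w → σ 1 (u * n + w) = 0)

theorem Env.congr {A : ℕ → ℕ → Prop} {n k : ℕ} {σ τ : Mem} (h : Env A n k σ) (h1 : τ 1 = σ 1)
    (h5 : τ 5 = σ 5) : Env A n k τ := by
  obtain ⟨a, b, c, d, e, f⟩ := h
  exact ⟨by rwa [h5], by rwa [h5], by rwa [h5], by rwa [h5], by rwa [h5], by rwa [h1]⟩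

theorem Env.den {A : ℕ → ℕ → Prop} {n k : ℕ} {σ : Mem} (h : Env A n k σ) {P : FProg}
    (h1 : 1 ∉ P.writes) (h5 : 5 ∉ P.writes) : Env A n k (P.den σ) :=
  h.congr (den_of_notMem h1 σ) (den_of_notMem h5 σ)

theorem Env.adj_ne_zero {A : ℕ → ℕ → Prop} {n k : ℕ} {σ : Mem} (h : Env A n k σ) {u w : ℕ}
    (hu : u < n) (hw : w < n) : σ 1 (u * n + w) ≠ 0 ↔ A u w := by
  obtain ⟨h1, h2⟩ := h.adj u hu w hw
  by_cases hA : A u w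
  · simp [h1 hA, hA]
  · simp [h2 hA, hA]

/-- Array `a` holds the indicator vector of `S` on the vertices. -/
def Marks (a n : ℕ) (S : Finset ℕ) (σ : Mem) : Prop :=
  ∀ u < n, σ a u = if u ∈ S then 1 else 0

theorem Marks.ne_zero {a n : ℕ} {S : Finset ℕ} {σ : Mem} (h : Marks a n S σ) {u : ℕ} (hu : u < n) :
    σ a u ≠ 0 ↔ u ∈ S := by
  rw [h u hu]
  split_ifs <;> simp [*]

theorem Marks.congr {a n : ℕ} {S : Finset ℕ} {σ τ : Mem} (h : Marks a n S σ) (ha : τ a = σ a) :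
    Marks a n S τ := by
  rw [Marks, ha]
  exact h

/-- Set the cells `0, …, n - 1` of array `a` to zero. -/
def clear (i a : ℕ) : FProg := .loop i numV (.assign a (var i) 0)

theorem clear_spec {A : ℕ → ℕ → Prop} {n k i a : ℕ} {σ : Mem} (h : Env A n k σ) (hia : i ≠ a) :
    ∀ u < n, (clear i a).den σ a u = 0 := by
  refine den_loop_induct (fun m τ => ∀ u < m, τ a u = 0) (by simp [h.numV]) (by simp) ?_ ?_
  · intro m τ x hI u hu
    rw [Mem.write_ne _ _ _ hia.symm]
    exact hI u hu
  · intro m τ _ _ hm hI u hu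
    by_cases hum : u = m
    · simp [hum, hm]
    · simpa [hum, hm] using hI u (by omega)

/-- Mark the vertices in the slots (array `10`) and count them (array `21`). -/
def markSlots : FProg :=
  clear 20 10 ;; .assign 21 0 0 ;;
  .loop 20 bound (.ite (.cell 10 (.cell 7 (var 20))) .skip
    (.assign 10 (.cell 7 (var 20)) 1 ;; .assign 21 0 (var 21 + 1)))

theorem markSlots_spec {A : ℕ → ℕ → Prop} {n k : ℕ} {σ : Mem} (h : Env A n k σ)
    (hs : ∀ j < k, σ 7 j < n) :
    Marks 10 n (supp k (σ 7)) (markSlots.den σ) ∧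
      markSlots.den σ 21 0 = (supp k (σ 7)).card := by
  have hc := clear_spec (i := 20) (a := 10) h (by decide)
  have hE := h.den (P := clear 20 10) (by decide) (by decide)
  have h7 : (clear 20 10).den σ 7 = σ 7 := den_of_notMem (by decide) σ
  generalize hτ : (clear 20 10).den σ = τ at hc hE h7
  rw [markSlots, den_seq, hτ, den_seq]
  refine den_loop_induct (fun m ρ => Marks 10 n (supp m (σ 7)) ρ ∧ ρ 21 0 = (supp m (σ 7)).card)
    (N := k) (by simp [hE.bound]) ?_ ?_ ?_
  · simp only [Marks, den_assign, Expr.eval_zero, Mem.write_apply]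
    simpa [supp] using hc
  · simp [Marks]
  · intro m ρ hm hfr hρ ⟨h1, h2⟩
    have h7' : ρ 7 = σ 7 := by rw [hfr 7 (by decide), ← h7]; simp [Mem.write_ne]
    have hsm : supp (m + 1) (σ 7) = insert (σ 7 m) (supp m (σ 7)) := by
      simp [supp, range_add_one]
    have hn := h1.ne_zero (hs m hm)
    rw [hsm]
    have hcond : (Expr.cell 10 (.cell 7 (var 20))).eval ρ ≠ 0 ↔ σ 7 m ∈ supp m (σ 7) := by
      simpa [hρ, h7'] using hn
    rw [den_ite]
    by_cases hmem : σ 7 m ∈ supp m (σ 7)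
    · rw [if_pos (hcond.2 hmem), insert_eq_of_mem hmem]
      exact ⟨h1, h2⟩
    · rw [if_neg (mt hcond.1 hmem)]
      refine ⟨fun u hu => ?_, ?_⟩
      · have := h1 u hu
        by_cases hum : u = σ 7 m
        · simp [hum, hρ, h7']
        · simp [hum, hρ, h7', this]
      · simp [h2, card_insert_of_notMem hmem]

/-- Breadth-first search from the vertex in array `13` among the vertices with mark (array `10`)
equal to the content of array `14`; array `16` is the queue, array `17` its length. -/
def search : FProg :=
  clear 19 15 ;; .assign 15 (var 13) 1 ;; .assign 16 0 (var 13) ;; .assign 17 0 1 ;;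
  .loop 18 numV (.loop 19 numV
    (.ite (.op .lt (var 18) (var 17) * (.op .eq (.cell 15 (var 19)) 0 *
        (.op .eq (.cell 10 (var 19)) (var 14) * .cell 1 (.cell 16 (var 18) * numV + var 19))))
      (.assign 15 (var 19) 1 ;; .assign 16 (var 17) (var 19) ;; .assign 17 0 (var 17 + 1)) .skip))

/-- The arrays `15`, `16`, `17` represent the list `l`. -/
structure Queue (n : ℕ) (l : List ℕ) (σ : Mem) : Prop where
  len : σ 17 0 = l.length
  get : ∀ i < l.length, σ 16 i = l.getD i 0
  mark : ∀ w < n, σ 15 w = if w ∈ l then 1 else 0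

theorem Queue.congr {n : ℕ} {l : List ℕ} {σ τ : Mem} (h : Queue n l σ) (h1 : τ 15 = σ 15)
    (h2 : τ 16 = σ 16) (h3 : τ 17 = σ 17) : Queue n l τ :=
  ⟨by rw [h3, h.len], by rw [h2]; exact h.get, by rw [h1]; exact h.mark⟩

theorem Queue.append {n : ℕ} {l : List ℕ} {σ : Mem} (h : Queue n l σ) (w : ℕ) :
    Queue n (l ++ [w]) (((σ.write 15 w 1).write 16 l.length w).write 17 0 (l.length + 1)) := by
  refine ⟨by simp, fun i hi => ?_, fun x hx => ?_⟩
  · rw [List.length_append, List.length_singleton] at hi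
    by_cases hil : i = l.length
    · subst hil
      simp
    · have : i < l.length := by omega
      simp [hil, h.get i this, List.getElem?_append_left, this]
  · have := h.mark x hx
    by_cases hxw : x = w
    · simp [hxw]
    · simp [hxw, this]

theorem search_spec {A : ℕ → ℕ → Prop} {n k : ℕ} {σ : Mem} (h : Env A n k σ) {ok : ℕ → Prop}
    (hok : ∀ w < n, σ 10 w = σ 14 0 ↔ ok w) (hu : σ 13 0 < n) :
    Queue n (bfs A n ok (σ 13 0)) (search.den σ) := by
  have hc := clear_spec (i := 19) (a := 15) h (by decide)
  have hfr : ∀ b, b ∉ (clear 19 15).writes → (clear 19 15).den σ b = σ b :=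
    fun b hb => den_of_notMem hb σ
  generalize hτ : (clear 19 15).den σ = τ at hc hfr
  have hE : Env A n k τ := h.congr (hfr 1 (by decide)) (hfr 5 (by decide))
  have h10 := hfr 10 (by decide)
  have h13 := hfr 13 (by decide)
  have h14 := hfr 14 (by decide)
  rw [search, den_seq, hτ]
  simp only [den_seq, den_assign, Expr.eval_cell, Expr.eval_zero, Expr.eval_one]
  generalize hρ : ((τ.write 15 (τ 13 0) 1).write 16 0 _).write 17 0 1 = ρ
  have hq : Queue n [σ 13 0] ρ := by
    subst hρ
    refine ⟨by simp, fun i hi => ?_, fun w hw => ?_⟩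
    · obtain rfl : i = 0 := by simpa using hi
      simp [h13]
    · have := hc w hw
      by_cases hw' : w = σ 13 0 <;> simp [h13, hw', hc w hw]
  have hfr' : ∀ b, b ≠ 15 → b ≠ 16 → b ≠ 17 → ρ b = τ b := by
    intro b h1 h2 h3
    subst hρ
    rw [Mem.write_ne _ _ _ h3, Mem.write_ne _ _ _ h2, Mem.write_ne _ _ _ h1]
  refine den_loop_induct (fun i ρ => Queue n (bfsUpto A n ok (σ 13 0) i) ρ) (N := n)
    (by simp [hfr', hE.numV]) hq (fun i ρ x hI => hI.congr ?_ ?_ ?_) ?_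
  iterate 3 exact Mem.write_ne _ _ _ (by decide)
  intro i ρ₁ hi hf₁ h18 hI
  refine den_loop_induct
    (fun w ρ => Queue n (bfsRow A ok i (bfsUpto A n ok (σ 13 0) i) w) ρ) (N := n) ?_ hI
    (fun i ρ x hI => hI.congr ?_ ?_ ?_) ?_
  · simp only [Expr.eval_cell, Expr.eval_zero]
    rw [hf₁ 5 (by decide), hfr' 5 (by decide) (by decide) (by decide), hE.numV]
  iterate 3 exact Mem.write_ne _ _ _ (by decide)
  intro w ρ₂ hw hf₂ h19 hI₂
  have fr : ∀ b, b ∉ [15, 16, 17, 18, 19] → ρ₂ b = τ b := by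
    intro b hb
    rw [hf₂ b ?_, hf₁ b ?_, hfr' b]
    all_goals
      simp only [FProg.writes, List.mem_cons, List.cons_append, List.nil_append,
        List.append_nil] at hb ⊢
      grind
  have hE₂ : Env A n k ρ₂ := hE.congr (fr 1 (by decide)) (fr 5 (by decide))
  have h18' : ρ₂ 18 0 = i := by rw [hf₂ 18 (by decide), h18]
  rw [bfsRow, bfsStep]
  set l := bfsRow A ok i (bfsUpto A n ok (σ 13 0) i) w with hl
  clear_value l
  have hln : ∀ x ∈ l, x < n := by
    intro x hx
    rcases (bfsRow_grown (bfsUpto_grown i) i hw.le).eq_or (hl ▸ hx) with h | h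
    · rw [h]; exact hu
    · exact h.2
  have hcond : (Expr.op .lt (var 18) (var 17) * (.op .eq (.cell 15 (var 19)) 0 *
        (.op .eq (.cell 10 (var 19)) (var 14) *
          .cell 1 (.cell 16 (var 18) * numV + var 19)))).eval ρ₂ ≠ 0 ↔
      i < l.length ∧ w ∉ l ∧ ok w ∧ A (l.getD i 0) w := by
    simp only [Expr.eval_mul, Expr.eval_lt, Expr.eval_eq, Expr.eval_cell, Expr.eval_zero,
      Expr.eval_add, h18', h19, hI₂.len, hE₂.numV, mul_ne_zero_iff, ne_eq, ite_eq_right_iff,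
      one_ne_zero, imp_false, not_not]
    refine and_congr_right fun hil => and_congr ?_ (and_congr ?_ ?_)
    · rw [hI₂.mark w hw]
      split_ifs with hwl <;> simp [hwl]
    · rw [fr 10 (by decide), fr 14 (by decide), h10, h14]
      exact hok w hw
    · rw [hI₂.get i hil]
      refine hE₂.adj_ne_zero (hln _ ?_) hw
      rw [List.getD_eq_getElem _ _ hil]
      exact List.getElem_mem hil
  rw [den_ite]
  by_cases hc' : i < l.length ∧ w ∉ l ∧ ok w ∧ A (l.getD i 0) w
  · rw [if_pos (hcond.2 hc'), if_pos hc']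
    have := hI₂.append w
    simpa [h19, hI₂.len] using this
  · rw [if_neg (mt hcond.1 hc'), if_neg hc']
    exact hI₂

/-- Search for a vertex outside of the marked set that is adjacent to it and whose component has
more than `q` vertices, where `q` is the content of array `22`. -/
def findBig : FProg :=
  .assign 14 0 0 ;; .assign 23 0 0 ;; .loop 25 numV (.ite (.cell 10 (var 25)) .skip
    (.assign 27 0 0 ;;
      .loop 26 numV (.ite (.cell 10 (var 26) * .cell 1 (var 25 * numV + var 26))
        (.assign 27 0 1) .skip) ;;
      .ite (var 27)
        (.assign 13 0 (var 25) ;; search ;;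
          .ite (.op .lt (var 22) (var 17)) (.assign 23 0 1 ;; .assign 24 0 (var 25)) .skip)
        .skip))

/-- Arrays `23` and `24` represent an optional number. -/
def Found (o : Option ℕ) (σ : Mem) : Prop :=
  match o with
  | some u => σ 23 0 = 1 ∧ σ 24 0 = u
  | none => σ 23 0 = 0

theorem Found.congr {o : Option ℕ} {σ τ : Mem} (h : Found o σ) (h1 : τ 23 = σ 23)
    (h2 : τ 24 = σ 24) : Found o τ := by
  cases o <;> simpa [Found, h1, h2] using h

theorem findBig_spec {A : ℕ → ℕ → Prop} {n k : ℕ} {σ : Mem} (h : Env A n k σ) {S : Finset ℕ}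
    (hS : Marks 10 n S σ) : Found (lastSat (Big A n (σ 22 0) S) n) (findBig.den σ) := by
  rw [findBig, den_seq, den_seq]
  simp only [den_assign, Expr.eval_zero]
  generalize hτ : (σ.write 14 0 0).write 23 0 0 = τ
  have hfr : ∀ b, b ≠ 14 → b ≠ 23 → τ b = σ b := by
    intro b h1 h2
    subst hτ
    rw [Mem.write_ne _ _ _ h2, Mem.write_ne _ _ _ h1]
  have h14 : τ 14 0 = 0 := by simp [← hτ]
  have h23 : τ 23 0 = 0 := by simp [← hτ]
  have hE := h.congr (hfr 1 (by decide) (by decide)) (hfr 5 (by decide) (by decide))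
  have hS := hS.congr (hfr 10 (by decide) (by decide))
  rw [← hfr 22 (by decide) (by decide)]
  clear hτ hfr h
  refine den_loop_induct (fun m ρ => Found (lastSat (Big A n (τ 22 0) S) m) ρ) (N := n)
    (by simp [hE.numV]) (by simpa [lastSat, Found] using h23)
    (fun i ρ x hI => hI.congr (Mem.write_ne _ _ _ (by decide)) (Mem.write_ne _ _ _ (by decide))) ?_
  intro u ρ hu hfr hρ hI
  have hS₁ := hS.congr (hfr 10 (by decide))
  have hE₁ := hE.congr (hfr 1 (by decide)) (hfr 5 (by decide))
  have h14' : ρ 14 0 = 0 := by rw [hfr 14 (by decide), h14]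
  have h22' : ρ 22 0 = τ 22 0 := by rw [hfr 22 (by decide)]
  rw [← h22'] at hI ⊢
  clear hfr
  have hcond : (Expr.cell 10 (var 25)).eval ρ ≠ 0 ↔ u ∈ S := by
    simpa [hρ] using hS₁.ne_zero hu
  rw [den_ite, lastSat]
  by_cases huS : u ∈ S
  · rw [if_pos (hcond.2 huS), if_neg (fun hb => hb.1 huS)]
    exact hI
  rw [if_neg (mt hcond.1 huS), den_seq, den_seq]
  generalize hρ₁ : (FProg.loop 26 numV _).den _ = ρ₁
  have hfr : ∀ b, b ∉ [26, 27] → ρ₁ b = ρ b := by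
    intro b hb
    rw [← hρ₁, den_of_notMem (by simpa [FProg.writes] using hb),
      den_of_notMem (by simp [FProg.writes] at hb ⊢; tauto)]
  have h27 : ρ₁ 27 0 ≠ 0 ↔ ∃ w < n, w ∈ S ∧ A u w := by
    rw [← hρ₁]
    refine den_loop_induct (fun m ρ => ρ 27 0 ≠ 0 ↔ ∃ w < m, w ∈ S ∧ A u w) (N := n)
      (by simp [hE₁.numV]) (by simp) (by simp) ?_
    intro w ρ₂ hw hf₂ h26 hI₂
    have hE₂ := hE₁.congr (σ := ρ) (τ := ρ₂) (hf₂ 1 (by decide)) (hf₂ 5 (by decide))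
    have hS₂ := hS₁.congr (σ := ρ) (τ := ρ₂) (hf₂ 10 (by decide))
    have h25 : ρ₂ 25 0 = u := by rw [hf₂ 25 (by decide)]; exact hρ
    have hc : (Expr.cell 10 (var 26) * .cell 1 (var 25 * numV + var 26)).eval ρ₂ ≠ 0 ↔
        w ∈ S ∧ A u w := by
      simp only [Expr.eval_mul, Expr.eval_cell, Expr.eval_zero, Expr.eval_add, h25, h26,
        hE₂.numV, mul_ne_zero_iff, hS₂.ne_zero hw, hE₂.adj_ne_zero hu hw]
    rw [den_ite]
    by_cases hwS : w ∈ S ∧ A u w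
    · rw [if_pos (hc.2 hwS)]
      simp only [den_assign, Expr.eval_zero, Expr.eval_one, Mem.write_same, ne_eq, one_ne_zero,
        not_false_eq_true, true_iff]
      exact ⟨w, by omega, hwS⟩
    · rw [if_neg (mt hc.1 hwS), den_skip, hI₂]
      refine exists_congr fun x => ⟨fun hx => ⟨by omega, hx.2⟩, fun hx => ⟨?_, hx.2⟩⟩
      rcases Nat.lt_succ_iff_lt_or_eq.1 hx.1 with h | rfl
      · exact h
      · exact absurd hx.2 hwS
  have hS₂ := hS₁.congr (hfr 10 (by decide))
  have hE₂ := hE₁.congr (hfr 1 (by decide)) (hfr 5 (by decide))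
  have hI₂ := hI.congr (hfr 23 (by decide)) (hfr 24 (by decide))
  have h14₂ : ρ₁ 14 0 = 0 := by rw [hfr 14 (by decide), h14']
  have h25₂ : ρ₁ 25 0 = u := by rw [hfr 25 (by decide), hρ]
  rw [show ρ 22 0 = ρ₁ 22 0 by rw [hfr 22 (by decide)]] at hI₂ ⊢
  clear hfr hρ₁ hS₁ hE₁ hI h14' hρ h22' hcond
  rw [den_ite]
  have hc27 : (var 27).eval ρ₁ ≠ 0 ↔ ∃ w < n, w ∈ S ∧ A u w := by simpa using h27
  by_cases hadj : ∃ w < n, w ∈ S ∧ A u w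
  swap
  · rw [if_neg (mt hc27.1 hadj), if_neg (fun hb => hadj hb.2.1)]
    exact hI₂
  rw [if_pos (hc27.2 hadj), den_seq, den_seq]
  have hq := search_spec (σ := (FProg.assign 13 0 (var 25)).den ρ₁) (ok := (· ∉ S))
    (hE₂.den (by decide) (by decide)) (fun w hw => by
      have := hS₂ w hw
      by_cases hwS : w ∈ S <;> simp [hwS, this, h14₂]) (by simpa [h25₂] using hu)
  have h13 : (FProg.assign 13 0 (var 25)).den ρ₁ 13 0 = u := by simp [h25₂]
  rw [h13] at hq
  have hfr : ∀ b, b ∉ 13 :: search.writes →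
      search.den ((FProg.assign 13 0 (var 25)).den ρ₁) b = ρ₁ b := by
    intro b hb
    rw [List.mem_cons, not_or] at hb
    rw [den_of_notMem hb.2, den_of_notMem (by simpa [FProg.writes] using hb.1)]
  generalize search.den ((FProg.assign 13 0 (var 25)).den ρ₁) = ρ₂ at hq hfr
  have h22 : ρ₂ 22 0 = ρ₁ 22 0 := by rw [hfr 22 (by decide)]
  have h25 : ρ₂ 25 0 = u := by rw [hfr 25 (by decide), h25₂]
  have hc : (Expr.op .lt (var 22) (var 17)).eval ρ₂ ≠ 0 ↔
      ρ₁ 22 0 < (bfs A n (· ∉ S) u).length := by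
    simp [hq.len, h22]
  rw [den_ite]
  by_cases hlt : ρ₁ 22 0 < (bfs A n (· ∉ S) u).length
  · rw [if_pos (hc.2 hlt), if_pos ⟨huS, hadj, hlt⟩]
    simp [Found, h25]
  · rw [if_neg (mt hc.1 hlt), if_neg (fun hb => hlt hb.2.2)]
    exact hI₂.congr (hfr 23 (by decide)) (hfr 24 (by decide))

end SafeSet

namespace SafeSet

open Finset RAM RAM.FProg

attribute [local simp] Mem.write_apply

/-! ### Counting branching walks -/

/-- Mark the vertices in the slots selected by the bits of array `29` in array `31`, and compute
the sign of the selection in array `32`. -/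
def select : FProg :=
  clear 30 31 ;; .assign 32 0 1 ;; .assign 33 0 (var 29) ;;
  .loop 30 bound (.ite (var 33 % 2)
    (.assign 31 (.cell 7 (var 30)) 1 ;;
      .assign 32 0 ((var 32 * (.cell 5 4 - 1)) % .cell 5 4)) .skip ;;
    .assign 33 0 (var 33 / 2))

/-- The nonzero entries of array `31` represent the predicate `F`. -/
def Forbidden (n : ℕ) (F : ℕ → Prop) (σ : Mem) : Prop := ∀ u < n, σ 31 u ≠ 0 ↔ F u

theorem Forbidden.congr {n : ℕ} {F : ℕ → Prop} {σ τ : Mem} (h : Forbidden n F σ)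
    (h31 : τ 31 = σ 31) : Forbidden n F τ := by
  rw [Forbidden, h31]
  exact h

/-- The machine has no negative numbers, so a sign change is multiplication by `q - 1` modulo `q`.
-/
theorem cast_modulus_sub_one {q : ℕ} (hq : 0 < q) : ((q - 1 : ℕ) : ZMod q) = -1 := by
  rw [Nat.cast_pred hq, ZMod.natCast_self, zero_sub]

theorem select_spec {A : ℕ → ℕ → Prop} {n k : ℕ} {σ : Mem} (h : Env A n k σ) (hn : 0 < n) :
    Forbidden n (fun y => ∃ j < k, (σ 29 0).testBit j ∧ σ 7 j = y) (select.den σ) ∧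
      ((select.den σ 32 0 : ℕ) : ZMod ((4 * n) ^ n))
        = ∏ j ∈ range k, if (σ 29 0).testBit j then -1 else 1 := by
  have hc := clear_spec (i := 30) (a := 31) h (by decide)
  have hq : 0 < (4 * n) ^ n := by positivity
  have hfr : ∀ b, b ∉ (clear 30 31).writes → (clear 30 31).den σ b = σ b :=
    fun b hb => den_of_notMem hb σ
  rw [select, den_seq]
  generalize (clear 30 31).den σ = τ at hc hfr
  have hE : Env A n k τ := h.congr (hfr 1 (by decide)) (hfr 5 (by decide))
  rw [← hfr 7 (by decide), ← hfr 29 (by decide), den_seq, den_seq]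
  have := den_loop_induct (a := 30) (e := bound)
    (P := .ite (var 33 % 2)
      (.assign 31 (.cell 7 (var 30)) 1 ;;
        .assign 32 0 ((var 32 * (.cell 5 4 - 1)) % .cell 5 4)) .skip ;;
      .assign 33 0 (var 33 / 2))
    (σ := (FProg.assign 33 0 (var 29)).den ((FProg.assign 32 0 1).den τ))
    (fun m ρ => Forbidden n (fun y => ∃ j < m, (τ 29 0).testBit j ∧ τ 7 j = y) ρ ∧
      ((ρ 32 0 : ℕ) : ZMod ((4 * n) ^ n))
        = ∏ j ∈ range m, (if (τ 29 0).testBit j then -1 else 1) ∧ ρ 33 0 = τ 29 0 / 2 ^ m)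
    (N := k) (by simp [hE.bound]) ?_ ?_ ?_
  · exact ⟨this.1, this.2.1⟩
  · refine ⟨fun u hu => ?_, by simp, by simp⟩
    simp [hc u hu]
  · intro i ρ x hI
    simpa [Forbidden] using hI
  intro m ρ hm hfr hρ ⟨h1, h2, h3⟩
  have h7 : ρ 7 = τ 7 := by rw [hfr 7 (by decide)]; simp [Mem.write_ne]
  have hE' : ρ 5 4 = (4 * n) ^ n := by
    rw [hfr 5 (by decide)]
    simpa [Mem.write_ne] using hE.modulus
  have hc : (var 33 % 2 : Expr).eval ρ ≠ 0 ↔ (τ 29 0).testBit m := by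
    simp only [Expr.eval_mod, Expr.eval_cell, Expr.eval_zero, Expr.eval_two, h3,
      Nat.testBit_eq_decide_div_mod_eq, decide_eq_true_eq]
    omega
  have hdiv : τ 29 0 / 2 ^ m / 2 = τ 29 0 / 2 ^ (m + 1) := by
    rw [Nat.div_div_eq_div_mul, pow_succ]
  rw [den_seq, den_ite, prod_range_succ, ← h2]
  by_cases hb : (τ 29 0).testBit m
  · rw [if_pos (hc.2 hb), if_pos hb]
    refine ⟨fun u hu => ?_, ?_, by simp [h3, hdiv]⟩
    · have := h1 u hu
      by_cases hum : u = τ 7 m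
      · subst hum
        refine iff_of_true (by simp [hρ, h7]) ⟨m, by omega, hb, rfl⟩
      · have hex : (∃ j < m + 1, (τ 29 0).testBit j ∧ τ 7 j = u) ↔
            ∃ j < m, (τ 29 0).testBit j ∧ τ 7 j = u := by
          refine exists_congr fun j => ⟨fun hj => ⟨?_, hj.2⟩, fun hj => ⟨by omega, hj.2⟩⟩
          rcases Nat.lt_succ_iff_lt_or_eq.1 hj.1 with h | rfl
          · exact h
          · exact absurd hj.2.2.symm hum
        refine Iff.trans ?_ (this.trans hex.symm)
        simp [hρ, h7, hum]
    · have : ((ρ 32 0 * ((4 * n) ^ n - 1) % (4 * n) ^ n : ℕ) : ZMod ((4 * n) ^ n))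
          = ρ 32 0 * -1 := by
        rw [ZMod.natCast_mod, Nat.cast_mul, cast_modulus_sub_one hq]
      rw [← this]
      simp [hE']
  · rw [if_neg (mt hc.1 hb), if_neg hb, mul_one]
    refine ⟨fun u hu => ?_, by simp, by simp [h3, hdiv]⟩
    have hex : (∃ j < m + 1, (τ 29 0).testBit j ∧ τ 7 j = u) ↔
        ∃ j < m, (τ 29 0).testBit j ∧ τ 7 j = u := by
      refine exists_congr fun j => ⟨fun hj => ⟨?_, hj.2⟩, fun hj => ⟨by omega, hj.2⟩⟩
      rcases Nat.lt_succ_iff_lt_or_eq.1 hj.1 with h | rfl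
      · exact h
      · exact absurd hj.2.1 hb
    refine Iff.trans ?_ ((h1 u hu).trans hex.symm)
    simp

/-- Array `34` holds the numbers of walks with fewer than `l` steps. -/
def Table (A : ℕ → ℕ → Prop) (n : ℕ) (F : ℕ → Prop) (l : ℕ) (σ : Mem) : Prop :=
  ∀ a < l, ∀ u < n, ((σ 34 (a * n + u) : ℕ) : ZMod ((4 * n) ^ n)) = walkCount _ n A F a u

theorem Table.congr {A : ℕ → ℕ → Prop} {n l : ℕ} {F : ℕ → Prop} {σ τ : Mem}
    (h : Table A n F l σ) (h34 : τ 34 = σ 34) : Table A n F l τ := by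
  rw [Table, h34]
  exact h

/-- Add the contributions of the first step from array `36` to array `38`. -/
def addTerms : FProg :=
  .loop 39 bound (.ite (.op .lt (var 39) (var 35))
    (.assign 37 0 ((var 37 + .cell 34 (var 39 * numV + var 38) *
      .cell 34 ((var 35 - 1 - var 39) * numV + var 36)) % .cell 5 4)) .skip)

/-- Loop limits may depend on array `5` only, so the loop runs up to `k` and skips the rounds from
`l + 1` on; hence the `min m (l + 1)` in the invariant. -/
theorem addTerms_spec {A : ℕ → ℕ → Prop} {n k : ℕ} {σ : Mem} (h : Env A n k σ) {F : ℕ → Prop}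
    {l : ℕ} (hl : l < k) (h35 : σ 35 0 = l + 1) (hu : σ 36 0 < n) (hw : σ 38 0 < n)
    (hT : Table A n F (l + 1) σ) :
    ((addTerms.den σ 37 0 : ℕ) : ZMod ((4 * n) ^ n)) = σ 37 0 + ∑ a ∈ range (l + 1),
      walkCount _ n A F a (σ 38 0) * walkCount _ n A F (l - a) (σ 36 0) := by
  have := den_loop_induct (a := 39) (e := bound) (P := .ite (.op .lt (var 39) (var 35))
      (.assign 37 0 ((var 37 + .cell 34 (var 39 * numV + var 38) *
        .cell 34 ((var 35 - 1 - var 39) * numV + var 36)) % .cell 5 4)) .skip) (σ := σ)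
    (fun m ρ => ((ρ 37 0 : ℕ) : ZMod ((4 * n) ^ n)) = σ 37 0 + ∑ a ∈ range (min m (l + 1)),
      walkCount _ n A F a (σ 38 0) * walkCount _ n A F (l - a) (σ 36 0)) (N := k)
    (by simp [h.bound]) (by simp) (by simp) ?_
  · rwa [min_eq_right (by omega)] at this
  intro m ρ _ hfr hρ hI
  have e35 : ρ 35 0 = l + 1 := by rw [hfr 35 (by decide), h35]
  have hE := h.congr (hfr 1 (by decide)) (hfr 5 (by decide))
  rw [den_ite]
  by_cases hml : m < l + 1
  · rw [if_pos (by simp [hρ, e35, hml]), min_eq_left (by omega), sum_range_succ, ← add_assoc]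
    rw [min_eq_left hml.le] at hI
    rw [← hI, ← hT m hml _ hw, ← hT (l - m) (by omega) _ hu]
    simp [hρ, e35, hE.numV, hE.modulus, hfr 34 (by decide), hfr 36 (by decide),
      hfr 38 (by decide)]
  · rw [if_neg (by simp [hρ, e35, hml]), min_eq_right (by omega)]
    rwa [min_eq_right (by omega)] at hI

/-- Compute the number of walks with `l` steps from `u` in array `37`, where `l` and `u` are the
contents of arrays `35` and `36`. -/
def countWalks : FProg :=
  .assign 37 0 0 ;; .ite (.cell 31 (var 36)) .skip (.ite (var 35)
    (.loop 38 numV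
      (.ite (.op .eq (var 38) (var 36) + .cell 1 (var 36 * numV + var 38)) addTerms .skip))
    (.assign 37 0 1))

theorem countWalks_spec {A : ℕ → ℕ → Prop} (hA : ∀ ⦃x y⦄, A x y → A y x) {n k : ℕ} {σ : Mem}
    (h : Env A n k σ) {F : ℕ → Prop} (hF : Forbidden n F σ) (hl : σ 35 0 < k) (hu : σ 36 0 < n)
    (hT : Table A n F (σ 35 0) σ) :
    ((countWalks.den σ 37 0 : ℕ) : ZMod ((4 * n) ^ n)) = walkCount _ n A F (σ 35 0) (σ 36 0) := by
  classical
  rw [countWalks, den_seq]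
  have hfr : ∀ b, b ≠ 37 → (FProg.assign 37 0 0).den σ b = σ b :=
    fun b hb => Mem.write_ne _ _ _ hb
  have h37 : (FProg.assign 37 0 0).den σ 37 0 = 0 := by simp
  generalize (FProg.assign 37 0 0).den σ = τ at hfr h37
  rw [← hfr 35 (by decide), ← hfr 36 (by decide)] at *
  replace h := h.congr (hfr 1 (by decide)) (hfr 5 (by decide))
  replace hF := hF.congr (hfr 31 (by decide))
  replace hT := hT.congr (hfr 34 (by decide))
  clear hfr
  have hc : (Expr.cell 31 (var 36)).eval τ ≠ 0 ↔ F (τ 36 0) := hF _ hu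
  rw [den_ite]
  by_cases hFu : F (τ 36 0)
  · rw [if_pos (hc.2 hFu), walkCount_of_forbidden hA hu hFu, den_skip, h37, Nat.cast_zero]
  rw [if_neg (mt hc.1 hFu), den_ite]
  cases hl' : τ 35 0 with
  | zero =>
    rw [if_neg (by simp [hl']), walkCount_zero, if_neg hFu]
    simp
  | succ l =>
    rw [if_pos (by simp [hl']), walkCount_succ]
    refine den_loop_induct (fun m ρ => ((ρ 37 0 : ℕ) : ZMod ((4 * n) ^ n)) =
      ∑ w ∈ range m, if w = τ 36 0 ∨ A (τ 36 0) w then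
        ∑ a ∈ range (l + 1), walkCount _ n A F a w * walkCount _ n A F (l - a) (τ 36 0) else 0)
      (N := n) (by simp [h.numV]) (by simp [h37]) (by simp) ?_
    intro w ρ hw hfr hρ hI
    have hE := h.congr (hfr 1 (by decide)) (hfr 5 (by decide))
    have h36 : ρ 36 0 = τ 36 0 := by rw [hfr 36 (by decide)]
    have h35 : ρ 35 0 = l + 1 := by rw [hfr 35 (by decide), hl']
    have hc : (Expr.op .eq (var 38) (var 36) + .cell 1 (var 36 * numV + var 38)).eval ρ ≠ 0 ↔
        w = τ 36 0 ∨ A (τ 36 0) w := by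
      rw [← hE.adj_ne_zero hu hw]
      simp only [Expr.eval_add, Expr.eval_eq, Expr.eval_cell, Expr.eval_zero, Expr.eval_mul, hρ,
        h36, hE.numV]
      split_ifs with hwu <;> simp [hwu]
    rw [sum_range_succ, ← hI, den_ite]
    by_cases hwu : w = τ 36 0 ∨ A (τ 36 0) w
    · rw [if_pos (hc.2 hwu), if_pos hwu]
      have := addTerms_spec hE (by omega) h35 (by rwa [h36]) (by rwa [hρ])
        ((hl' ▸ hT).congr (hfr 34 (by decide)))
      rwa [hρ, h36] at this
    · rw [if_neg (mt hc.1 hwu), if_neg hwu, add_zero, den_skip]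

/-- Compute the numbers of walks with fewer than `k` steps. -/
def fillTable : FProg :=
  .loop 35 bound (.loop 36 numV
    (countWalks ;; .assign 34 (var 35 * numV + var 36) (var 37)))

theorem fillTable_spec {A : ℕ → ℕ → Prop} (hA : ∀ ⦃x y⦄, A x y → A y x) {n k : ℕ} {σ : Mem}
    (h : Env A n k σ) {F : ℕ → Prop} (hF : Forbidden n F σ) :
    Table A n F k (fillTable.den σ) := by
  refine den_loop_induct (Table A n F) (N := k) (by simp [h.bound])
    (fun a ha => absurd ha (Nat.not_lt_zero a))
    (fun i ρ x hI => hI.congr (Mem.write_ne _ _ _ (by decide))) ?_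
  intro l ρ hl hfr hρ hI
  have hE := h.congr (hfr 1 (by decide)) (hfr 5 (by decide))
  have hF := hF.congr (hfr 31 (by decide))
  have := den_loop_induct (a := 36) (e := numV)
    (P := countWalks ;; .assign 34 (var 35 * numV + var 36) (var 37)) (σ := ρ)
    (fun m ρ => Table A n F l ρ ∧ ∀ u < m, ((ρ 34 (l * n + u) : ℕ) : ZMod ((4 * n) ^ n))
      = walkCount _ n A F l u) (N := n) (by simp [hE.numV])
    ⟨hI, fun u hu => absurd hu (Nat.not_lt_zero u)⟩
    (fun i ρ x hI => ⟨hI.1.congr (Mem.write_ne _ _ _ (by decide)), by simpa using hI.2⟩) ?_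
  · intro a ha u hu
    rcases Nat.lt_succ_iff_lt_or_eq.1 ha with h | rfl
    · exact this.1 a h u hu
    · exact this.2 u hu
  intro u ρ₁ hu hf₁ h36 ⟨hI₁, hI₂⟩
  have hE₁ := hE.congr (σ := ρ) (τ := ρ₁) (hf₁ 1 (by decide)) (hf₁ 5 (by decide))
  have hF₁ := hF.congr (σ := ρ) (τ := ρ₁) (hf₁ 31 (by decide))
  have h35 : ρ₁ 35 0 = l := by rw [hf₁ 35 (by decide)]; exact hρ
  have hw := countWalks_spec hA hE₁ hF₁ (by rwa [h35]) (by rwa [h36]) (by rwa [h35])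
  rw [h35, h36] at hw
  have hf₂ : ∀ b, b ∉ countWalks.writes → countWalks.den ρ₁ b = ρ₁ b :=
    fun b hb => den_of_notMem hb _
  rw [den_seq]
  generalize countWalks.den ρ₁ = ρ₂ at hw hf₂
  have h34 : ((assign 34 (var 35 * numV + var 36) (var 37)).den ρ₂) 34
      = Function.update (ρ₁ 34) (l * n + u) (ρ₂ 37 0) := by
    simp only [den_assign, Mem.write_eq, Expr.eval_add, Expr.eval_mul, Expr.eval_cell,
      Expr.eval_zero]
    rw [hf₂ 34 (by decide), hf₂ 35 (by decide), hf₂ 36 (by decide), hf₂ 5 (by decide), h35, h36,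
      hE₁.numV]
  rw [Table, h34]
  constructor
  · intro a ha x hx
    -- Row `a < l` occupies cells below `l * n`, so writing to row `l` leaves it alone.
    rw [Function.update_of_ne, hI₁ a ha x hx]
    have : (a + 1) * n ≤ l * n := Nat.mul_le_mul_right _ ha
    rw [add_mul, one_mul] at this
    omega
  · intro x hx
    by_cases hxu : x = u
    · rw [hxu, Function.update_self, hw]
    · rw [Function.update_of_ne (by omega), hI₂ x (by omega)]

/-- Decide whether the vertices in the slots lie in a connected set of at most `k` vertices; the
answer is the content of array `28`, yes being represented by nonzero numbers. -/
def testSlots : FProg :=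
  .assign 28 0 0 ;; .loop 29 (.cell 5 2) (select ;; fillTable ;;
    .assign 28 0 ((var 28 + var 32 * .cell 34 ((bound - 1) * numV + .cell 7 0)) % .cell 5 4))

theorem testSlots_spec {A : ℕ → ℕ → Prop} (hA : ∀ ⦃x y⦄, A x y → A y x) {n k : ℕ} {σ : Mem}
    (h : Env A n k σ) (hk : 0 < k) (hkn : k ≤ n) (hs : σ 7 0 < n) :
    testSlots.den σ 28 0 ≠ 0 ↔ Extends A n k (σ 7) := by
  classical
  have hq : 0 < (4 * n) ^ n := Nat.pow_pos (by omega)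
  have key : testSlots.den σ 28 0 < (4 * n) ^ n ∧
      ((testSlots.den σ 28 0 : ℕ) : ZMod ((4 * n) ^ n))
      = ∑ x ∈ range (2 ^ k), (∏ j ∈ range k, if x.testBit j then -1 else 1) *
        walkCount _ n A (fun y => ∃ j < k, x.testBit j ∧ σ 7 j = y) (k - 1) (σ 7 0) := by
    rw [testSlots, den_seq]
    refine den_loop_induct (fun m ρ => ρ 28 0 < (4 * n) ^ n ∧
      ((ρ 28 0 : ℕ) : ZMod ((4 * n) ^ n))
        = ∑ x ∈ range m, (∏ j ∈ range k, if x.testBit j then -1 else 1) *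
          walkCount _ n A (fun y => ∃ j < k, x.testBit j ∧ σ 7 j = y) (k - 1) (σ 7 0))
      (N := 2 ^ k) (by simp [h.two]) (by simp [hq]) (by simp) ?_
    intro x ρ hx hfr hρ ⟨_, hI⟩
    have hf : ∀ b, b ≠ 28 → b ∉ select.writes → b ∉ fillTable.writes → b ≠ 29 → ρ b = σ b := by
      intro b h1 h2 h3 h4
      rw [hfr b (by simp [FProg.writes, h1, h2, h3, h4])]
      exact Mem.write_ne _ _ _ h1
    have hE := h.congr (hf 1 (by decide) (by decide) (by decide) (by decide))
      (hf 5 (by decide) (by decide) (by decide) (by decide))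
    have h7 : ρ 7 = σ 7 := hf 7 (by decide) (by decide) (by decide) (by decide)
    obtain ⟨h1, h2⟩ := select_spec hE (by omega)
    rw [hρ, h7] at h1
    rw [hρ] at h2
    have h3 := fillTable_spec hA (hE.den (P := select) (by decide) (by decide)) h1
    have hf₂ : ∀ b, b ∉ select.writes → b ∉ fillTable.writes →
        fillTable.den (select.den ρ) b = ρ b := fun b h1 h2 => by
      rw [den_of_notMem h2, den_of_notMem h1]
    have h32 : fillTable.den (select.den ρ) 32 = select.den ρ 32 := den_of_notMem (by decide) _
    have h28 := hf₂ 28 (by decide) (by decide)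
    have h7' := hf₂ 7 (by decide) (by decide)
    have hE₂ := hE.congr (hf₂ 1 (by decide) (by decide)) (hf₂ 5 (by decide) (by decide))
    have hval : (assign 28 0 ((var 28 + var 32 * .cell 34 ((bound - 1) * numV + .cell 7 0))
        % .cell 5 4)).den (fillTable.den (select.den ρ)) 28 0
        = (ρ 28 0 + select.den ρ 32 0 * fillTable.den (select.den ρ) 34 ((k - 1) * n + σ 7 0))
          % (4 * n) ^ n := by
      simp [h32, h28, h7', hE₂.numV, hE₂.bound, hE₂.modulus, h7]
    rw [den_seq, den_seq, hval]
    refine ⟨Nat.mod_lt _ hq, ?_⟩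
    rw [ZMod.natCast_mod, sum_range_succ, ← hI, ← h2, ← h3 (k - 1) (by omega) _ hs]
    push_cast
    rfl
  obtain ⟨hlt, heq⟩ := key
  -- The computed residue and the true number of walks are both below the modulus, so their
  -- congruence is an equality.
  rw [sum_walkCount, ZMod.natCast_eq_natCast_iff', Nat.mod_eq_of_lt hlt,
    Nat.mod_eq_of_lt ((Multiset.countP_le_card _ _).trans_lt (card_walks_lt (by omega)))] at heq
  rw [heq, countP_walks_ne_zero_iff hA hk hs, Extends]

end SafeSet

namespace SafeSet

open Finset RAM RAM.FProg

attribute [local simp] Mem.write_apply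

/-! ### The main loops -/

theorem supp_congr {k : ℕ} {s s' : ℕ → ℕ} (h : ∀ i < k, s i = s' i) : supp k s = supp k s' := by
  ext u
  simp only [mem_supp]
  exact exists_congr fun j => and_congr_right fun hj => by rw [h j hj]

theorem extends_congr {A : ℕ → ℕ → Prop} {n k : ℕ} {s s' : ℕ → ℕ} (h : ∀ i < k, s i = s' i) :
    Extends A n k s ↔ Extends A n k s' :=
  exists_congr fun T => and_congr_right fun _ => and_congr_right fun _ =>
    and_congr_left fun _ => forall₂_congr fun j hj => by rw [h j hj]

theorem update_congr {k : ℕ} {s s' : ℕ → ℕ} (h : ∀ i < k, s i = s' i) (j x : ℕ) :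
    ∀ i < k, Function.update s j x i = Function.update s' j x i := by
  intro i hi
  simp only [Function.update_apply, h i hi]

/-- The program initializes only the first `k` cells of its slot array, so it can be compared with
`fill` only there. -/
theorem pick_congr {A : ℕ → ℕ → Prop} {n k : ℕ} {s s' : ℕ → ℕ} (hk : 0 < k)
    (h : ∀ i < k, s i = s' i) (j d : ℕ) : pick A n k s j d = pick A n k s' j d := by
  have : (fun u => u ∉ supp k s ∧ Extends A n k (Function.update s j u))
      = fun u => u ∉ supp k s' ∧ Extends A n k (Function.update s' j u) := by
    funext u
    rw [supp_congr h, extends_congr (update_congr h j u)]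
  rw [pick, pick, this, supp_congr h, h 0 hk]

/-- For a big vertex the queue has more than `k ≥ d` entries, so the default value of `getD` is
never used. -/
theorem pick_lt {A : ℕ → ℕ → Prop} {n k : ℕ} {s : ℕ → ℕ} (hs : s 0 < n) (j : ℕ) {d : ℕ}
    (hd : d < k + 1) : pick A n k s j d < n := by
  rw [pick]
  cases hb : lastSat (Big A n k (supp k s)) n with
  | some u =>
    obtain ⟨hu, _, _, hlen⟩ := of_lastSat_eq_some hb
    simp only
    rw [List.getD_eq_getElem _ _ (by omega)]
    exact mem_bfs_lt hu (List.getElem_mem _)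
  | none =>
    simp only
    cases hg : lastSat (fun u => u ∉ supp k s ∧ Extends A n k (Function.update s j u)) n with
    | some u => exact (of_lastSat_eq_some hg).1
    | none => exact hs

/-- Fill the slot after the one in array `11` so that the slots can be covered by a small connected
set, if possible by a new vertex. -/
def greedy : FProg :=
  .assign 42 0 (.cell 7 0) ;;
  .loop 40 numV (.ite (.cell 10 (var 40)) .skip
    (.assign 7 (var 11 + 1) (var 40) ;; testSlots ;; .ite (var 28) (.assign 42 0 (var 40)) .skip)) ;;
  .assign 7 (var 11 + 1) (var 42)

/-- All tests write to the same slot, so up to that slot array `7` keeps its content; the last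
successful candidate survives in array `42`. Counter `11` starts at `0` while slot `0` is already
taken, hence the shift by one. -/
theorem greedy_spec {A : ℕ → ℕ → Prop} (hA : ∀ ⦃x y⦄, A x y → A y x) {n k : ℕ} {σ : Mem}
    (h : Env A n k σ) (hk : 0 < k) (hkn : k ≤ n) {S : Finset ℕ} (hS : Marks 10 n S σ)
    (hs : σ 7 0 < n) : greedy.den σ 7 = Function.update (σ 7) (σ 11 0 + 1)
      ((lastSat (fun u => u ∉ S ∧ Extends A n k (Function.update (σ 7) (σ 11 0 + 1) u)) n).getD
        (σ 7 0)) := by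
  rw [greedy, den_seq, den_seq]
  set p := fun u => u ∉ S ∧ Extends A n k (Function.update (σ 7) (σ 11 0 + 1) u) with hp
  have key := den_loop_induct (a := 40) (e := numV) (P := .ite (.cell 10 (var 40)) .skip
    (.assign 7 (var 11 + 1) (var 40) ;; testSlots ;; .ite (var 28) (.assign 42 0 (var 40)) .skip))
    (σ := (FProg.assign 42 0 (.cell 7 0)).den σ)
    (fun m ρ => ρ 42 0 = (lastSat p m).getD (σ 7 0) ∧
      ∃ x, ρ 7 = Function.update (σ 7) (σ 11 0 + 1) x) (N := n) (by simp [h.numV])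
      ⟨by simp [lastSat], σ 7 (σ 11 0 + 1), by
        rw [Function.update_eq_self]; exact Mem.write_ne _ _ _ (by decide)⟩
      (fun i ρ x hI => by
        rw [Mem.write_ne _ _ _ (by decide), Mem.write_ne _ _ _ (by decide)]; exact hI) ?_
  · obtain ⟨h1, x, h2⟩ := key
    have h11 : ∀ τ : Mem, τ = (FProg.loop 40 numV (.ite (.cell 10 (var 40)) .skip
        (.assign 7 (var 11 + 1) (var 40) ;; testSlots ;;
          .ite (var 28) (.assign 42 0 (var 40)) .skip))).den
        ((FProg.assign 42 0 (.cell 7 0)).den σ) → τ 11 = σ 11 := by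
      intro τ hτ
      rw [hτ, den_of_notMem (by decide), den_of_notMem (by decide)]
    simp only [den_assign, Mem.write_eq, Expr.eval_add, Expr.eval_cell, Expr.eval_zero,
      Expr.eval_one] at h1 h2 h11 ⊢
    rw [h1, h2, h11 _ rfl, Function.update_idem]
  intro u ρ hu hfr hρ ⟨h42, x, h7⟩
  have hf : ∀ b, b ∉ greedy.writes → ρ b = σ b := by
    intro b hb
    have hb' : b ≠ 42 := fun h => hb (by rw [h]; decide)
    rw [hfr b, den_of_notMem (by simpa [FProg.writes] using hb')]
    intro hmem
    apply hb
    simp only [greedy, FProg.writes, List.mem_append, List.mem_cons] at hmem ⊢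
    tauto
  have hE := h.congr (hf 1 (by decide)) (hf 5 (by decide))
  have hS' := hS.congr (hf 10 (by decide))
  have h11 : ρ 11 0 = σ 11 0 := by rw [hf 11 (by decide)]
  have hc : (Expr.cell 10 (var 40)).eval ρ ≠ 0 ↔ u ∈ S := by
    simpa [hρ] using hS'.ne_zero hu
  rw [den_ite, lastSat]
  by_cases huS : u ∈ S
  · rw [if_pos (hc.2 huS), if_neg (fun h => h.1 huS)]
    exact ⟨h42, x, h7⟩
  rw [if_neg (mt hc.1 huS), den_seq, den_seq]
  have h7' : (FProg.assign 7 (var 11 + 1) (var 40)).den ρ 7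
      = Function.update (σ 7) (σ 11 0 + 1) u := by
    simp only [den_assign, Mem.write_eq, Expr.eval_add, Expr.eval_cell, Expr.eval_zero,
      Expr.eval_one]
    rw [hρ, h7, h11, Function.update_idem]
  have ht := testSlots_spec hA (hE.den (P := .assign 7 (var 11 + 1) (var 40)) (by decide)
    (by decide)) hk hkn (by rw [h7', Function.update_of_ne (by omega)]; exact hs)
  rw [h7'] at ht
  have hf₂ : ∀ b, b ≠ 7 → b ∉ testSlots.writes →
      testSlots.den ((FProg.assign 7 (var 11 + 1) (var 40)).den ρ) b = ρ b := fun b h1 h2 => by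
    rw [den_of_notMem h2, den_of_notMem (by simpa [FProg.writes] using h1)]
  have h7₂ : testSlots.den ((FProg.assign 7 (var 11 + 1) (var 40)).den ρ) 7
      = Function.update (σ 7) (σ 11 0 + 1) u := by
    rw [den_of_notMem (by decide), h7']
  generalize testSlots.den ((FProg.assign 7 (var 11 + 1) (var 40)).den ρ) = ρ₂ at ht hf₂ h7₂
  have h42₂ : ρ₂ 42 0 = (lastSat p u).getD (σ 7 0) := by
    rw [hf₂ 42 (by decide) (by decide), h42]
  have h40 : ρ₂ 40 0 = u := by rw [hf₂ 40 (by decide) (by decide), hρ]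
  have hc₂ : (var 28).eval ρ₂ ≠ 0 ↔ p u := by
    simp only [Expr.eval_cell, Expr.eval_zero, ht, hp, huS, not_false_eq_true, true_and]
  rw [den_ite]
  by_cases hpu : p u
  · rw [if_pos (hc₂.2 hpu), if_pos hpu]
    exact ⟨by simp [h40], u, by rw [← h7₂]; exact Mem.write_ne _ _ _ (by decide)⟩
  · rw [if_neg (mt hc₂.1 hpu), if_neg hpu]
    exact ⟨h42₂, u, h7₂⟩

/-- Fill the slot after the one in array `11`; array `9` holds the code. -/
def fillSlot : FProg :=
  .assign 22 0 bound ;; markSlots ;; findBig ;;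
  .ite (var 23)
    (.assign 13 0 (var 24) ;; .assign 14 0 0 ;; search ;;
      .assign 7 (var 11 + 1) (.cell 16 (var 9 % (bound + 1))))
    greedy ;;
  .assign 9 0 (var 9 / (bound + 1))

theorem fillSlot_spec {A : ℕ → ℕ → Prop} (hA : ∀ ⦃x y⦄, A x y → A y x) {n k : ℕ} {σ : Mem}
    (h : Env A n k σ) (hk : 0 < k) (hkn : k ≤ n) (hs : ∀ i < k, σ 7 i < n) :
    fillSlot.den σ 7 = (step A n k (σ 11 0 + 1) (σ 7, σ 9 0)).1 ∧
      fillSlot.den σ 9 0 = (step A n k (σ 11 0 + 1) (σ 7, σ 9 0)).2 := by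
  rw [fillSlot, den_seq, den_seq, den_seq]
  set τ := findBig.den (markSlots.den ((FProg.assign 22 0 bound).den σ)) with hτ
  have hf : ∀ b, b ≠ 22 → b ∉ markSlots.writes → b ∉ findBig.writes → τ b = σ b :=
    fun b h1 h2 h3 => by
      rw [hτ, den_of_notMem h3, den_of_notMem h2, den_of_notMem (by simpa [FProg.writes] using h1)]
  have hE₁ := h.den (P := .assign 22 0 bound) (by decide) (by decide)
  have h7₁ : (FProg.assign 22 0 bound).den σ 7 = σ 7 := Mem.write_ne _ _ _ (by decide)
  obtain ⟨hm, -⟩ := markSlots_spec hE₁ (by rwa [h7₁])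
  rw [h7₁] at hm
  have hfound := findBig_spec (hE₁.den (P := markSlots) (by decide) (by decide)) hm
  have h22 : markSlots.den ((FProg.assign 22 0 bound).den σ) 22 0 = k := by
    rw [den_of_notMem (by decide)]
    simp [h.bound]
  rw [h22, ← hτ] at hfound
  have hS : Marks 10 n (supp k (σ 7)) τ := hm.congr (den_of_notMem (by decide) _)
  have hE := h.congr (hf 1 (by decide) (by decide) (by decide))
    (hf 5 (by decide) (by decide) (by decide))
  have h7 := hf 7 (by decide) (by decide) (by decide)
  have h9 := hf 9 (by decide) (by decide) (by decide)
  have h11 := hf 11 (by decide) (by decide) (by decide)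
  clear_value τ
  clear hf hm hE₁ h7₁ h22
  rw [den_seq]
  have key : ∀ ρ : Mem, ρ 5 = τ 5 → ρ 9 = τ 9 →
      ρ 7 = Function.update (σ 7) (σ 11 0 + 1)
        (pick A n k (σ 7) (σ 11 0 + 1) (σ 9 0 % (k + 1))) →
      (FProg.assign 9 0 (var 9 / (bound + 1))).den ρ 7
        = (step A n k (σ 11 0 + 1) (σ 7, σ 9 0)).1 ∧
      (FProg.assign 9 0 (var 9 / (bound + 1))).den ρ 9 0
        = (step A n k (σ 11 0 + 1) (σ 7, σ 9 0)).2 := by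
    intro ρ h5 h9' h7'
    refine ⟨?_, ?_⟩
    · rw [den_assign, Mem.write_ne _ _ _ (by decide), h7', step]
    · simp [step, h5, h9', h9, hE.bound]
  rw [den_ite]
  cases hb : lastSat (Big A n k (supp k (σ 7))) n with
  | none =>
    rw [hb] at hfound
    have h23 : τ 23 0 = 0 := hfound
    rw [if_neg (by simp [h23])]
    refine key _ (den_of_notMem (by decide) _) (den_of_notMem (by decide) _) ?_
    rw [greedy_spec hA hE hk hkn hS (by rw [h7]; exact hs 0 hk), h7, h11, pick, hb]
  | some u =>
    rw [hb] at hfound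
    obtain ⟨h23, h24⟩ : τ 23 0 = 1 ∧ τ 24 0 = u := hfound
    obtain ⟨hu, huS, _, hlen⟩ := of_lastSat_eq_some hb
    rw [if_pos (by simp [h23])]
    refine key _ (den_of_notMem (by decide) _) (den_of_notMem (by decide) _) ?_
    rw [den_seq, den_seq, den_seq]
    set ρ := (FProg.assign 14 0 0).den ((FProg.assign 13 0 (var 24)).den τ) with hρ
    have hf : ∀ b, b ≠ 13 → b ≠ 14 → ρ b = τ b := fun b h1 h2 => by
      rw [hρ, den_assign, Mem.write_ne _ _ _ h2, den_assign, Mem.write_ne _ _ _ h1]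
    have h13 : ρ 13 0 = u := by simp [hρ, h24]
    have h14 : ρ 14 0 = 0 := by simp [hρ]
    have hS' := hS.congr (hf 10 (by decide) (by decide))
    have hq := search_spec (σ := ρ) (ok := (· ∉ supp k (σ 7)))
      (hE.congr (hf 1 (by decide) (by decide)) (hf 5 (by decide) (by decide)))
      (fun w hw => by
        have := hS' w hw
        by_cases hwS : w ∈ supp k (σ 7) <;> simp [hwS, this, h14]) (by rwa [h13])
    rw [h13] at hq
    have hf₂ : ∀ b, b ∉ search.writes → b ≠ 13 → b ≠ 14 → search.den ρ b = τ b :=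
      fun b h1 h2 h3 => by rw [den_of_notMem h1, hf b h2 h3]
    have hd : σ 9 0 % (k + 1) < (bfs A n (· ∉ supp k (σ 7)) u).length :=
      (Nat.lt_succ_iff.1 (Nat.mod_lt _ (Nat.succ_pos k))).trans_lt hlen
    simp only [den_assign, Mem.write_eq, Expr.eval_add, Expr.eval_cell, Expr.eval_zero,
      Expr.eval_one, Expr.eval_mod]
    rw [hf₂ 7 (by decide) (by decide) (by decide), hf₂ 11 (by decide) (by decide) (by decide),
      hf₂ 9 (by decide) (by decide) (by decide), hf₂ 5 (by decide) (by decide) (by decide),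
      h7, h9, h11, hE.bound, hq.get _ hd, pick, hb]

/-- Check whether the set of the vertices in the slots is a solution, and return it if so; array
`6` holds the first vertex. -/
def check : FProg :=
  markSlots ;; .assign 13 0 (var 6) ;; .assign 14 0 1 ;; search ;;
  .ite (.op .eq (var 17) (var 21))
    (.assign 22 0 (var 21) ;; findBig ;;
      .ite (var 23) .skip
        (.assign 2 0 1 ;; .loop 20 numV (.assign 3 (var 20) (.cell 10 (var 20)))))
    .skip

/-- From `σ` to `τ`, the set `S` is returned if it is a solution, and the output is unchanged
otherwise. -/
def Returns (A : ℕ → ℕ → Prop) (n : ℕ) (S : Finset ℕ) (σ τ : Mem) : Prop :=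
  (Good A n S → τ 2 0 = 1 ∧ Marks 3 n S τ) ∧ (¬ Good A n S → τ 2 = σ 2 ∧ τ 3 = σ 3)

theorem check_spec {A : ℕ → ℕ → Prop} (hA : ∀ ⦃x y⦄, A x y → A y x) {n k : ℕ} {σ : Mem}
    (h : Env A n k σ) (hs : ∀ i < k, σ 7 i < n) (hv : σ 6 0 ∈ supp k (σ 7)) :
    Returns A n (supp k (σ 7)) σ (check.den σ) := by
  have hSn : supp k (σ 7) ⊆ range n := fun x hx => by
    obtain ⟨i, hi, rfl⟩ := mem_supp.1 hx
    exact mem_range.2 (hs i hi)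
  obtain ⟨hm, hcard⟩ := markSlots_spec h hs
  rw [Returns, good_iff hA hv hSn, check, den_seq, den_seq, den_seq, den_seq]
  generalize supp k (σ 7) = S at hv hSn hm hcard ⊢
  have hf₁ : ∀ b, b ∉ markSlots.writes → markSlots.den σ b = σ b := fun b hb => den_of_notMem hb σ
  have hE₁ := h.den (P := markSlots) (by decide) (by decide)
  generalize markSlots.den σ = τ at hm hcard hf₁ hE₁
  set ρ := (FProg.assign 14 0 1).den ((FProg.assign 13 0 (var 6)).den τ) with hρ
  have hf₂ : ∀ b, b ≠ 13 → b ≠ 14 → ρ b = τ b := fun b h1 h2 => by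
    rw [hρ, den_assign, Mem.write_ne _ _ _ h2, den_assign, Mem.write_ne _ _ _ h1]
  have h13 : ρ 13 0 = σ 6 0 := by simp [hρ, hf₁ 6 (by decide)]
  have h14 : ρ 14 0 = 1 := by simp [hρ]
  have hE₂ := hE₁.congr (hf₂ 1 (by decide) (by decide)) (hf₂ 5 (by decide) (by decide))
  have hS₂ := hm.congr (hf₂ 10 (by decide) (by decide))
  have hq := search_spec (ok := (· ∈ S)) hE₂ (fun w hw => by
    have := hS₂ w hw
    by_cases hwS : w ∈ S <;> simp [hwS, this, h14]) (by rw [h13]; exact mem_range.1 (hSn hv))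
  rw [h13] at hq
  have hf : ∀ b, b ∉ search.writes → b ≠ 13 → b ≠ 14 → search.den ρ b = τ b :=
    fun b h1 h2 h3 => by rw [den_of_notMem h1, hf₂ b h2 h3]
  generalize search.den ρ = τ₂ at hq hf
  have h2 : τ₂ 2 = σ 2 := by
    rw [hf 2 (by decide) (by decide) (by decide), hf₁ 2 (by decide)]
  have h3 : τ₂ 3 = σ 3 := by
    rw [hf 3 (by decide) (by decide) (by decide), hf₁ 3 (by decide)]
  have hS := hm.congr (hf 10 (by decide) (by decide) (by decide))
  have hE := hE₁.congr (hf 1 (by decide) (by decide) (by decide))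
    (hf 5 (by decide) (by decide) (by decide))
  have h21 : τ₂ 21 0 = S.card := by rw [hf 21 (by decide) (by decide) (by decide), hcard]
  have hc : (Expr.op .eq (var 17) (var 21)).eval τ₂ ≠ 0 ↔
      (bfs A n (· ∈ S) (σ 6 0)).length = S.card := by
    simp [hq.len, h21]
  rw [den_ite]
  by_cases hlen : (bfs A n (· ∈ S) (σ 6 0)).length = S.card
  swap
  · rw [if_neg (mt hc.1 hlen)]
    exact ⟨fun h => absurd h.1 hlen, fun _ => ⟨h2, h3⟩⟩
  rw [if_pos (hc.2 hlen), den_seq, den_seq]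
  set ρ₃ := (FProg.assign 22 0 (var 21)).den τ₂ with hρ₃
  have hf₃ : ∀ b, b ≠ 22 → ρ₃ b = τ₂ b := fun b hb => Mem.write_ne _ _ _ hb
  have hE₃ := hE.congr (hf₃ 1 (by decide)) (hf₃ 5 (by decide))
  have hS₃ := hS.congr (hf₃ 10 (by decide))
  have hfound := findBig_spec hE₃ hS₃
  rw [show ρ₃ 22 0 = S.card by simp [hρ₃, h21]] at hfound
  have hf₄ : ∀ b, b ≠ 22 → b ∉ findBig.writes → findBig.den ρ₃ b = τ₂ b :=
    fun b h1 h2 => by rw [den_of_notMem h2, hf₃ b h1]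
  generalize findBig.den ρ₃ = τ₄ at hfound hf₄
  have h2₄ := (hf₄ 2 (by decide) (by decide)).trans h2
  have h3₄ := (hf₄ 3 (by decide) (by decide)).trans h3
  have hS₄ := hS.congr (hf₄ 10 (by decide) (by decide))
  have hE₄ := hE.congr (hf₄ 1 (by decide) (by decide)) (hf₄ 5 (by decide) (by decide))
  rw [den_ite]
  cases hb : lastSat (Big A n S.card S) n with
  | some u =>
    rw [hb] at hfound
    obtain ⟨h23, -⟩ : τ₄ 23 0 = 1 ∧ τ₄ 24 0 = u := hfound
    rw [if_pos (by simp [h23])]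
    exact ⟨fun h => by simp at h, fun _ => ⟨h2₄, h3₄⟩⟩
  | none =>
    rw [hb] at hfound
    have h23 : τ₄ 23 0 = 0 := hfound
    rw [if_neg (by simp [h23])]
    refine ⟨fun _ => ⟨?_, ?_⟩, fun h => absurd ⟨hlen, rfl⟩ h⟩
    · rw [den_seq, den_of_notMem (by decide)]
      simp
    · rw [den_seq]
      refine den_loop_induct (fun m ρ => ∀ u < m, ρ 3 u = if u ∈ S then 1 else 0) (N := n)
        (by simp [hE₄.numV]) (by simp) (by simp) ?_
      intro m ρ hm hfr hρ hI u hu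
      have h10 : ρ 10 = τ₄ 10 := by
        rw [hfr 10 (by decide)]; exact Mem.write_ne _ _ _ (by decide)
      by_cases hum : u = m
      · subst hum
        simpa [hρ, h10] using hS₄ u hm
      · simpa [hρ, hum] using hI u (by omega)

/-- Run the algorithm for the first vertex in array `6` and the code in array `8`. -/
def trial : FProg :=
  .loop 20 bound (.assign 7 (var 20) (var 6)) ;; .assign 9 0 (var 8) ;;
  .loop 11 (bound - 1) fillSlot ;; check

theorem trial_spec {A : ℕ → ℕ → Prop} (hA : ∀ ⦃x y⦄, A x y → A y x) {n k : ℕ} {σ : Mem}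
    (h : Env A n k σ) (hk : 0 < k) (hkn : k ≤ n) (hv : σ 6 0 < n) :
    Returns A n (supp k (fill A n k 1 (fun _ => σ 6 0, σ 8 0) (k - 1)).1) σ (trial.den σ) := by
  rw [trial, den_seq, den_seq, den_seq]
  have h7 : ∀ i < k, (FProg.loop 20 bound (.assign 7 (var 20) (var 6))).den σ 7 i = σ 6 0 := by
    refine den_loop_induct (fun m ρ => ∀ i < m, ρ 7 i = σ 6 0) (N := k)
      (by simp [h.bound]) (by simp) (by simp) ?_
    intro m ρ hm hfr hρ hI i hi
    by_cases him : i = m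
    · simp [him, hρ, hfr 6 (by decide)]
    · simpa [him, hρ] using hI i (by omega)
  set τ := (FProg.assign 9 0 (var 8)).den
    ((FProg.loop 20 bound (.assign 7 (var 20) (var 6))).den σ) with hτ
  have hf : ∀ b, b ≠ 7 → b ≠ 9 → b ≠ 20 → τ b = σ b := fun b h1 h2 h3 => by
    rw [hτ, den_of_notMem (by simpa [FProg.writes] using h2),
      den_of_notMem (by simp [FProg.writes, h1, h3])]
  have h9 : τ 9 0 = σ 8 0 := by
    rw [hτ, den_assign]
    simp only [Expr.eval_zero, Mem.write_same, Expr.eval_cell]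
    rw [den_of_notMem (by decide)]
  have h7τ : ∀ i < k, τ 7 i = σ 6 0 := fun i hi => by
    rw [hτ, den_assign, Mem.write_ne _ _ _ (by decide), h7 i hi]
  have hE := h.congr (hf 1 (by decide) (by decide) (by decide))
    (hf 5 (by decide) (by decide) (by decide))
  have h6 := hf 6 (by decide) (by decide) (by decide)
  have h2 := hf 2 (by decide) (by decide) (by decide)
  have h3 := hf 3 (by decide) (by decide) (by decide)
  clear_value τ
  have key := den_loop_induct (a := 11) (e := bound - 1) (P := fillSlot) (σ := τ)
    (fun m ρ => (∀ i < k, ρ 7 i = (fill A n k 1 (fun _ => σ 6 0, σ 8 0) m).1 i) ∧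
      ρ 9 0 = (fill A n k 1 (fun _ => σ 6 0, σ 8 0) m).2 ∧ (∀ i < k, ρ 7 i < n) ∧
      ρ 7 0 = σ 6 0) (N := k - 1) (by simp [hE.bound])
      ⟨h7τ, h9, fun i hi => by rw [h7τ i hi]; exact hv, h7τ 0 hk⟩ (by simp) ?_
  · obtain ⟨k1, -, k3, k4⟩ := key
    rw [← supp_congr k1]
    have hf₂ : ∀ b, b ∉ 11 :: fillSlot.writes →
        (FProg.loop 11 (bound - 1) fillSlot).den τ b = τ b := fun b hb => den_of_notMem hb τ
    generalize (FProg.loop 11 (bound - 1) fillSlot).den τ = ρ at k1 k3 k4 hf₂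
    have := check_spec hA (hE.congr (hf₂ 1 (by decide)) (hf₂ 5 (by decide))) k3
      (mem_supp.2 ⟨0, hk, by rw [hf₂ 6 (by decide), h6, k4]⟩)
    rw [Returns, hf₂ 2 (by decide), hf₂ 3 (by decide), h2, h3] at this
    exact this
  intro m ρ hm hfr hρ ⟨k1, k2, k3, k4⟩
  have hEρ := hE.congr (hfr 1 (by decide)) (hfr 5 (by decide))
  obtain ⟨s1, s2⟩ := fillSlot_spec hA hEρ hk hkn k3
  rw [hρ] at s1 s2
  rw [s1, s2, fill]
  generalize fill A n k 1 (fun _ => σ 6 0, σ 8 0) m = q at k1 k2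
  have hp := pick_congr (A := A) (n := n) hk k1 (m + 1) (ρ 9 0 % (k + 1))
  rw [add_comm 1 m]
  refine ⟨?_, ?_, fun i hi => ?_, ?_⟩
  · simp only [step]
    rw [hp, k2]
    exact update_congr k1 _ _
  · simp only [step, k2]
  · simp only [step, Function.update_apply]
    split_ifs
    · exact pick_lt (k3 0 hk) _ (Nat.mod_lt _ (Nat.succ_pos k))
    · exact k3 i hi
  · simp only [step]
    rw [Function.update_of_ne (by omega), k4]

/-- Run all trials. -/
def runTrials : FProg :=
  .ite bound (.loop 6 numV (.loop 8 (.cell 5 3) trial)) .skip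

/-- A failing trial leaves the output alone and a successful one rewrites it completely, so the
loops need not stop at the first solution. -/
theorem runTrials_spec {A : ℕ → ℕ → Prop} (hA : ∀ ⦃x y⦄, A x y → A y x) {n k : ℕ} {σ : Mem}
    (h : Env A n k σ) (hkn : k ≤ n) (h2 : σ 2 0 = 0) :
    (runTrials.den σ 2 0 = 1 ∧ ∃ S, Good A n S ∧ S.card ≤ k ∧ Marks 3 n S (runTrials.den σ)) ∨
      (runTrials.den σ 2 0 = 0 ∧ ¬ ∃ S, Good A n S ∧ S.card ≤ k) := by
  rw [runTrials, den_ite]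
  rcases Nat.eq_zero_or_pos k with rfl | hk
  · rw [if_neg (by simp [h.bound])]
    refine .inr ⟨h2, ?_⟩
    rintro ⟨S, hS, hc⟩
    have := hS.1.1.card_pos
    omega
  rw [if_pos (by simp [h.bound]; omega)]
  let sol : ℕ → ℕ → Finset ℕ := fun v c => supp k (fill A n k 1 (fun _ => v, c) (k - 1)).1
  let I : (ℕ → ℕ → Prop) → Mem → Prop := fun done ρ =>
    (ρ 2 0 = 1 ∧ ∃ S, Good A n S ∧ S.card ≤ k ∧ Marks 3 n S ρ) ∨
      (ρ 2 0 = 0 ∧ ∀ v c, done v c → ¬ Good A n (sol v c))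
  have hI : ∀ done (ρ : Mem) a x, a ≠ 2 → a ≠ 3 → I done ρ → I done (ρ.write a 0 x) := by
    intro done ρ a x ha2 ha3 hI
    simpa only [I, Marks, Mem.write_ne _ _ _ ha2.symm, Mem.write_ne _ _ _ ha3.symm] using hI
  have key : I (fun v c => v < n ∧ c < (k + 1) ^ (k - 1))
      ((FProg.loop 6 numV (.loop 8 (.cell 5 3) trial)).den σ) := by
    refine den_loop_induct (fun m => I (fun v c => v < m ∧ c < (k + 1) ^ (k - 1))) (N := n)
      (by simp [h.numV]) (.inr ⟨h2, by simp⟩)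
      (fun i ρ x => hI _ ρ _ x (by decide) (by decide)) ?_
    intro v ρ hv hfr hρ hIv
    have hE := h.congr (hfr 1 (by decide)) (hfr 5 (by decide))
    have := den_loop_induct (a := 8) (e := .cell 5 3) (P := trial) (σ := ρ)
      (fun m => I (fun v' c => (v' < v ∧ c < (k + 1) ^ (k - 1)) ∨ (v' = v ∧ c < m)))
      (N := (k + 1) ^ (k - 1)) (by simp [hE.codes]) (by simpa using hIv)
      (fun i ρ x => hI _ ρ _ x (by decide) (by decide)) ?_
    · refine this.imp_right fun h => ⟨h.1, fun v' c hc => h.2 v' c ?_⟩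
      rcases Nat.lt_succ_iff_lt_or_eq.1 hc.1 with h | h
      exacts [.inl ⟨h, hc.2⟩, .inr ⟨h, hc.2⟩]
    intro c ρ₁ _ hf₁ h8 hIc
    have hE₁ := hE.congr (σ := ρ) (τ := ρ₁) (hf₁ 1 (by decide)) (hf₁ 5 (by decide))
    have h6 : ρ₁ 6 0 = v := by rw [hf₁ 6 (by decide)]; exact hρ
    have ht := trial_spec hA hE₁ hk hkn (by rwa [h6])
    rw [h6, h8] at ht
    by_cases hgood : Good A n (sol v c)
    · exact .inl ⟨(ht.1 hgood).1, _, hgood, card_supp_le k _, (ht.1 hgood).2⟩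
    · obtain ⟨t2, t3⟩ := ht.2 hgood
      simp only [I, Marks, t2, t3]
      refine hIc.imp_right fun h => ⟨h.1, fun v' c' hc => ?_⟩
      rcases hc with hc | ⟨rfl, hc⟩
      · exact h.2 v' c' (.inl hc)
      · rcases Nat.lt_succ_iff_lt_or_eq.1 hc with hc | rfl
        · exact h.2 _ c' (.inr ⟨rfl, hc⟩)
        · exact hgood
  refine key.imp_right fun h => ⟨h.1, ?_⟩
  rintro ⟨S, hS, hc⟩
  obtain ⟨v, hv, c, hc, hg⟩ := exists_good_fill hA hS hc
  exact h.2 v c ⟨hv, hc⟩ hg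

end SafeSet

namespace RAM

/-! ### Static bounds -/

theorem size_le_self (n : ℕ) : Nat.size n ≤ n := Nat.size_le.2 Nat.lt_two_pow_self

theorem size_pow_le (a b : ℕ) : Nat.size (a ^ b) ≤ b * Nat.size a + 1 := by
  induction b with
  | zero => simp
  | succ b ih =>
    rw [pow_succ, add_mul, one_mul]
    have := size_mul_le (a ^ b) a
    omega

/-- Expressions whose value is bounded by the memory contents; array `5` holds the modulus. -/
def Expr.tame : Expr → Bool
  | .lit c => c ≤ 1
  | .cell _ _ => true
  | .op .sub e _ => e.tame
  | .op .div e _ => e.tame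
  | .op .mod _ (.cell 5 (.lit 4)) => true
  | .op .mod e _ => e.tame
  | .op .lt _ _ => true
  | .op .eq _ _ => true
  | _ => false

/-- Expressions whose value exceeds the memory contents by at most one. -/
def Expr.increment : Expr → Bool
  | .op .add e (.lit 1) => e.tame
  | e => e.tame

/-- Products occur only under a reduction modulo cell `4` of array `5`, which is itself a cell of
the memory. It must be nonzero because `a % 0 = a`. -/
theorem Expr.eval_le_of_tame {e : Expr} (h : e.tame) {σ : Mem} {M : ℕ} (hM : 1 ≤ M)
    (hσ : Bounded M σ) (h4 : σ 5 4 ≠ 0) : e.eval σ ≤ M := by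
  induction e with
  | lit c => exact (by simpa [tame] using h : c ≤ 1).trans hM
  | cell a e => exact hσ _ _
  | op o e₁ e₂ ih₁ _ =>
    cases o with
    | add => simp [tame] at h
    | mul => simp [tame] at h
    | sub => exact (Nat.sub_le _ _).trans (ih₁ h)
    | div => exact (Nat.div_le_self _ _).trans (ih₁ h)
    | lt => exact (ite_le_one (by omega) (by omega)).trans hM
    | eq => exact (ite_le_one (by omega) (by omega)).trans hM
    | mod =>
      rw [tame.eq_def] at h
      split at h <;> simp_all [Expr.eval, Op.apply]
      · exact (Nat.mod_lt _ (Nat.pos_of_ne_zero h4)).le.trans (hσ 5 4)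
      · exact (Nat.mod_le _ _).trans ih₁

theorem Expr.eval_le_of_increment {e : Expr} (h : e.increment) {σ : Mem} {M : ℕ} (hM : 1 ≤ M)
    (hσ : Bounded M σ) (h4 : σ 5 4 ≠ 0) : e.eval σ ≤ M + 1 := by
  rw [increment.eq_def] at h
  split at h
  · exact Nat.succ_le_succ (eval_le_of_tame h hM hσ h4)
  · exact (eval_le_of_tame h hM hσ h4).trans (Nat.le_succ M)

/-- Limits that are bounded by the number of vertices. -/
def Expr.small : Expr → Bool
  | .cell 5 (.lit 0) => true
  | .cell 5 (.lit 1) => true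
  | .op .sub e _ => e.small
  | _ => false

theorem Expr.eval_le_of_small {e : Expr} (h : e.small) {s : ℕ → ℕ} (hs : s 1 ≤ s 0) :
    e.eval (fun _ => s) ≤ s 0 := by
  induction e with
  | lit c => simp [small] at h
  | cell a e =>
    rw [small.eq_def] at h
    split at h <;> simp_all [Expr.eval]
  | op o e₁ e₂ ih₁ _ =>
    rw [small.eq_def] at h
    split at h <;> simp_all [Expr.eval, Op.apply]
    omega

/-! ### Bounds on the number of steps -/

namespace FProg

/-- Boolean version of `Assigns`. -/
def assignsAll (p : Expr → Bool) : FProg → Bool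
  | skip => true
  | assign _ _ e => p e
  | seq P Q => P.assignsAll p && Q.assignsAll p
  | ite _ P Q => P.assignsAll p && Q.assignsAll p
  | loop _ _ P => P.assignsAll p

theorem assigns_of_assignsAll {p : Expr → Bool} {q : Expr → Prop} (hpq : ∀ e, p e → q e)
    {P : FProg} (h : P.assignsAll p) : P.Assigns q := by
  induction P with
  | skip => trivial
  | assign a i e => exact hpq e h
  | seq P Q ihP ihQ =>
    simp only [assignsAll, Bool.and_eq_true] at h
    exact ⟨ihP h.1, ihQ h.2⟩
  | ite e P Q ihP ihQ =>
    simp only [assignsAll, Bool.and_eq_true] at h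
    exact ⟨ihP h.1, ihQ h.2⟩
  | loop a e P ih => exact ih h

/-- All loop limits are small. -/
def smallLoops : FProg → Bool
  | skip => true
  | assign _ _ _ => true
  | seq P Q => P.smallLoops && Q.smallLoops
  | ite _ P Q => P.smallLoops && Q.smallLoops
  | loop _ e P => e.small && P.smallLoops

/-- The number of steps is at most `w` times a polynomial in the number of vertices. -/
def PolySteps (w : (ℕ → ℕ) → ℕ) (P : FProg) : Prop :=
  ∃ c d, ∀ s : ℕ → ℕ, s 1 ≤ s 0 → 1 ≤ s 2 → 1 ≤ s 3 → 1 ≤ w s ∧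
    P.steps s ≤ w s * (c * (s 0 + 1) ^ d)

theorem mul_pow_le_mul_pow {w c c' m d d' : ℕ} (hc : c ≤ c') (hd : d ≤ d') :
    w * (c * (m + 1) ^ d) ≤ w * (c' * (m + 1) ^ d') :=
  Nat.mul_le_mul_left _ (Nat.mul_le_mul hc (Nat.pow_le_pow_right (Nat.succ_pos m) hd))

theorem PolySteps.seq {w : (ℕ → ℕ) → ℕ} {P Q : FProg} (hP : PolySteps w P) (hQ : PolySteps w Q) :
    PolySteps w (.seq P Q) := by
  obtain ⟨c, d, hP⟩ := hP
  obtain ⟨c', d', hQ⟩ := hQ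
  refine ⟨c + c', max d d', fun s h1 h2 h3 => ⟨(hP s h1 h2 h3).1, ?_⟩⟩
  rw [steps, add_mul, mul_add]
  exact add_le_add
    ((hP s h1 h2 h3).2.trans (mul_pow_le_mul_pow le_rfl (le_max_left _ _)))
    ((hQ s h1 h2 h3).2.trans (mul_pow_le_mul_pow le_rfl (le_max_right _ _)))

theorem PolySteps.ite {w : (ℕ → ℕ) → ℕ} {e : Expr} {P Q : FProg} (hP : PolySteps w P)
    (hQ : PolySteps w Q) : PolySteps w (.ite e P Q) := by
  obtain ⟨c, d, h⟩ := hP.seq hQ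
  refine ⟨c + 1, d, fun s h1 h2 h3 => ⟨(h s h1 h2 h3).1, ?_⟩⟩
  have hpos : 1 ≤ w s * (1 * (s 0 + 1) ^ d) := by
    rw [one_mul]
    exact Nat.one_le_iff_ne_zero.2 (Nat.mul_ne_zero (Nat.one_le_iff_ne_zero.1 (h s h1 h2 h3).1)
      (by positivity))
  have := (h s h1 h2 h3).2
  simp only [steps] at this ⊢
  rw [add_mul, mul_add]
  omega

/-- The limit `m` may be exponential and goes into the weight; the constant rises by `4` to absorb
the overhead of the loop. -/
theorem PolySteps.loop {w m : (ℕ → ℕ) → ℕ} {a : ℕ} {e : Expr} {P : FProg} (hP : PolySteps w P)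
    (hm : ∀ s : ℕ → ℕ, 1 ≤ s 2 → 1 ≤ s 3 → 1 ≤ m s ∧ e.eval (fun _ => s) ≤ m s) :
    PolySteps (fun s => m s * w s) (.loop a e P) := by
  obtain ⟨c, d, h⟩ := hP
  refine ⟨c + 4, d, fun s h1 h2 h3 => ?_⟩
  obtain ⟨hw, hst⟩ := h s h1 h2 h3
  obtain ⟨hm1, hm2⟩ := hm s h2 h3
  refine ⟨Nat.mul_pos hm1 hw, ?_⟩
  have hp : 1 ≤ (s 0 + 1) ^ d := Nat.one_le_pow _ _ (Nat.succ_pos _)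
  rw [steps]
  calc e.eval (fun _ => s) * (P.steps s + 2) + 2
      ≤ m s * (w s * (c * (s 0 + 1) ^ d) + 2) + 2 := by gcongr
    _ ≤ m s * w s * ((c + 4) * (s 0 + 1) ^ d) := by
        have h4 : 1 ≤ w s * (s 0 + 1) ^ d := Nat.mul_pos hw hp
        have h5 : 1 ≤ m s * (w s * (s 0 + 1) ^ d) := Nat.mul_pos hm1 h4
        have h6 : m s ≤ m s * (w s * (s 0 + 1) ^ d) := Nat.le_mul_of_pos_right _ h4
        have h7 : m s * w s * ((c + 4) * (s 0 + 1) ^ d)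
            = m s * (w s * (c * (s 0 + 1) ^ d)) + 4 * (m s * (w s * (s 0 + 1) ^ d)) := by ring
        rw [h7, mul_add]
        omega

/-- A limit of at most the number of vertices raises the degree by one and leaves the weight alone.
-/
theorem PolySteps.loop_small {w : (ℕ → ℕ) → ℕ} {a : ℕ} {e : Expr} {P : FProg}
    (hP : PolySteps w P) (he : e.small) : PolySteps w (.loop a e P) := by
  obtain ⟨c, d, h⟩ := hP
  refine ⟨c + 4, d + 1, fun s h1 h2 h3 => ?_⟩
  obtain ⟨hw, hst⟩ := h s h1 h2 h3
  have hm := Expr.eval_le_of_small he h1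
  refine ⟨hw, ?_⟩
  have hp : 1 ≤ w s * (s 0 + 1) ^ d := Nat.mul_pos hw (Nat.one_le_pow _ _ (Nat.succ_pos _))
  rw [steps]
  calc e.eval (fun _ => s) * (P.steps s + 2) + 2
      ≤ s 0 * (w s * (c * (s 0 + 1) ^ d) + 2) + 2 := by gcongr
    _ ≤ w s * ((c + 4) * (s 0 + 1) ^ (d + 1)) := by
        have h7 : w s * ((c + 4) * (s 0 + 1) ^ (d + 1))
            = s 0 * (w s * (c * (s 0 + 1) ^ d)) + w s * (c * (s 0 + 1) ^ d)
              + 4 * (s 0 * (w s * (s 0 + 1) ^ d)) + 4 * (w s * (s 0 + 1) ^ d) := by ring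
        have h6 : s 0 ≤ s 0 * (w s * (s 0 + 1) ^ d) := Nat.le_mul_of_pos_right _ hp
        rw [h7, mul_add]
        omega

theorem PolySteps.of_smallLoops {w : (ℕ → ℕ) → ℕ} (hw : ∀ s : ℕ → ℕ, 1 ≤ s 2 → 1 ≤ s 3 → 1 ≤ w s)
    {P : FProg} (h : P.smallLoops) : PolySteps w P := by
  induction P with
  | skip => exact ⟨1, 0, fun s _ h2 h3 => ⟨hw s h2 h3, by simpa [steps] using hw s h2 h3⟩⟩
  | assign a i e => exact ⟨1, 0, fun s _ h2 h3 => ⟨hw s h2 h3, by simpa [steps] using hw s h2 h3⟩⟩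
  | seq P Q ihP ihQ =>
    simp only [smallLoops, Bool.and_eq_true] at h
    exact (ihP h.1).seq (ihQ h.2)
  | ite e P Q ihP ihQ =>
    simp only [smallLoops, Bool.and_eq_true] at h
    exact (ihP h.1).ite (ihQ h.2)
  | loop a e P ih =>
    simp only [smallLoops, Bool.and_eq_true] at h
    exact (ih h.2).loop_small h.1

end FProg

end RAM

/-! ### Step count of the main program -/

namespace SafeSet

open Finset RAM RAM.FProg

theorem testSlots_polySteps : PolySteps (fun s => s 2) testSlots := by
  have hw : ∀ s : ℕ → ℕ, 1 ≤ s 2 → 1 ≤ s 3 → 1 ≤ s 2 := fun _ h _ => h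
  refine .seq (.of_smallLoops hw (by decide)) ?_
  have := PolySteps.loop (w := fun _ => 1) (m := fun s => s 2) (a := 29) (e := .cell 5 2)
    (P := select ;; fillTable ;;
      .assign 28 0 ((var 28 + var 32 * .cell 34 ((bound - 1) * numV + .cell 7 0)) % .cell 5 4))
    (.of_smallLoops (fun _ _ _ => le_rfl) (by decide)) (fun s h2 _ => ⟨h2, le_rfl⟩)
  simpa only [mul_one] using this

/-- Only two loops are not small: the one over the `2 ^ k` selections in `testSlots`, whose limit is
cell `2`, and the one over the codes, whose limit is cell `3`. Being nested, they multiply. -/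
theorem runTrials_polySteps : PolySteps (fun s => s 3 * s 2) runTrials := by
  have hw : ∀ s : ℕ → ℕ, 1 ≤ s 2 → 1 ≤ s 3 → 1 ≤ s 2 := fun _ h _ => h
  have hw' : ∀ s : ℕ → ℕ, 1 ≤ s 2 → 1 ≤ s 3 → 1 ≤ s 3 * s 2 := fun _ h h' => Nat.mul_pos h' h
  have hg : PolySteps (fun s => s 2) greedy :=
    .seq (.of_smallLoops hw (by decide)) (.seq (.loop_small (.ite (.of_smallLoops hw (by decide))
      (.seq (.of_smallLoops hw (by decide)) (.seq testSlots_polySteps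
        (.of_smallLoops hw (by decide))))) (by decide)) (.of_smallLoops hw (by decide)))
  have hf : PolySteps (fun s => s 2) fillSlot :=
    .seq (.of_smallLoops hw (by decide)) (.seq (.of_smallLoops hw (by decide))
      (.seq (.of_smallLoops hw (by decide)) (.seq (.ite (.of_smallLoops hw (by decide)) hg)
        (.of_smallLoops hw (by decide)))))
  have ht : PolySteps (fun s => s 2) trial :=
    .seq (.of_smallLoops hw (by decide)) (.seq (.of_smallLoops hw (by decide))
      (.seq (.loop_small hf (by decide)) (.of_smallLoops hw (by decide))))
  exact .ite (.loop_small (.loop ht fun s _ h3 => ⟨h3, le_rfl⟩) (by decide))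
    (.of_smallLoops hw' (by decide))

theorem runTrials_wf : runTrials.wf 5 := by decide

theorem runTrials_increment : runTrials.assignsAll Expr.increment := by decide

end SafeSet

namespace SafeSet

open Finset RAM RAM.FProg

attribute [local simp] Mem.write_apply

/-! ### Preparation of the constants -/

/-- Copy the input parameters, replacing the size bound by its minimum with the number of
vertices. -/
def readInput : FProg :=
  .assign 4 0 (.cell 0 0) ;;
  .ite (.op .lt (.cell 0 1) (.cell 0 0)) (.assign 4 1 (.cell 0 1)) (.assign 4 1 (.cell 0 0))

theorem readInput_spec (σ : Mem) : readInput.den σ 4 0 = σ 0 0 ∧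
    readInput.den σ 4 1 = min (σ 0 1) (σ 0 0) := by
  by_cases h : σ 0 1 < σ 0 0
  · simp [readInput, h, h.le]
  · simp [readInput, h, not_lt.1 h]

/-- Multiply cell `i` of array `5` by `f`, as often as `e` says. -/
def multiply (i : ℕ) (e f : Expr) : FProg :=
  .loop 20 e (.assign 5 (.lit i) (.cell 5 (.lit i) * f))

theorem multiply_spec {i : ℕ} {e f : Expr} {σ : Mem} (hf : f.readsOnly 4) :
    (multiply i e f).den σ 5 i = σ 5 i * f.eval σ ^ e.eval σ ∧
      ∀ j ≠ i, (multiply i e f).den σ 5 j = σ 5 j := by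
  refine den_loop_induct (fun m τ => τ 5 i = σ 5 i * f.eval σ ^ m ∧ ∀ j ≠ i, τ 5 j = σ 5 j)
    rfl (by simp) ?_ ?_
  · intro m τ x hI
    simpa using hI
  · rintro m τ - hfr - ⟨h1, h2⟩
    have h4 : f.eval τ = f.eval σ :=
      Expr.eval_congr_of_readsOnly hf (hfr 4 (by simp [writes]))
    refine ⟨?_, fun j hj => ?_⟩
    · simp [Expr.eval, Op.apply, h1, h4, pow_succ, mul_assoc]
    · simp [Expr.eval, hj, h2]

/-- Compute the constants of the environment. -/
def setConstants : FProg :=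
  .assign 5 0 (.cell 4 0) ;; .assign 5 1 (.cell 4 1) ;; .assign 5 2 1 ;; .assign 5 3 1 ;;
  .assign 5 4 1 ;; multiply 2 (.cell 4 1) 2 ;; multiply 3 (.cell 4 1 - 1) (.cell 4 1 + 1) ;;
  multiply 4 (.cell 4 0) (4 * .cell 4 0)

theorem setConstants_spec {A : ℕ → ℕ → Prop} {σ : Mem} {n k : ℕ} (h0 : σ 4 0 = n)
    (h1 : σ 4 1 = k)
    (hA : ∀ u < n, ∀ w < n, (A u w → σ 1 (u * n + w) = 1) ∧ (¬ A u w → σ 1 (u * n + w) = 0)) :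
    Env A n k (setConstants.den σ) := by
  have e1 : setConstants.den σ 1 = σ 1 := den_of_notMem (by decide) σ
  have e4 : ∀ (τ : Mem) (i : ℕ) (e f : Expr), (multiply i e f).den τ 4 = τ 4 :=
    fun τ i e f => den_of_notMem (by simp [multiply, writes]) τ
  have key : ∀ (τ : Mem) (i : ℕ) (e f : Expr), f.readsOnly 4 →
      ∀ j, (multiply i e f).den τ 5 j = if j = i then τ 5 i * f.eval τ ^ e.eval τ else τ 5 j := by
    intro τ i e f hf j
    split_ifs with hj
    · rw [hj, (multiply_spec hf).1]
    · exact (multiply_spec hf).2 j hj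
  have k2 := fun τ => key τ 2 (.cell 4 1) 2 rfl
  have k3 := fun τ => key τ 3 (.cell 4 1 - 1) (.cell 4 1 + 1) rfl
  have k4 := fun τ => key τ 4 (.cell 4 0) (4 * .cell 4 0) rfl
  refine ⟨?_, ?_, ?_, ?_, ?_, by rwa [e1]⟩ <;>
    simp [setConstants, k2, k3, k4, e4, h0, h1]

/-- The powers are built by repeated multiplication with `2`, `s 1 + 1` and `4 * s 0`, all at most
`4 * s 0 + 4`. -/
theorem setConstants_grows {s : ℕ → ℕ} (h : s 1 ≤ s 0) :
    setConstants.Assigns (Grows 4 s 0 (fun M => (M + 1) * (4 * s 0 + 4))) := by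
  have hc : ∀ M x, x ≤ M + 1 → x ≤ (M + 1) * (4 * s 0 + 4) := fun M x hx =>
    hx.trans (Nat.le_mul_of_pos_right _ (by omega))
  have hm : ∀ (i : ℕ) (f : Expr), (∀ σ : Mem, σ 4 = s → f.eval σ ≤ 4 * s 0 + 4) →
      Grows 4 s 0 (fun M => (M + 1) * (4 * s 0 + 4)) (.cell 5 (.lit i) * f) := by
    intro i f hf σ M hσ _ hM
    exact Nat.mul_le_mul ((hM 5 i).trans (Nat.le_succ M)) (hf σ hσ)
  refine ⟨fun σ M _ _ hM => hc _ _ ((hM _ _).trans (Nat.le_succ M)),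
    fun σ M _ _ hM => hc _ _ ((hM _ _).trans (Nat.le_succ M)),
    fun σ M _ _ hM => hc _ _ (by simp), fun σ M _ _ hM => hc _ _ (by simp),
    fun σ M _ _ hM => hc _ _ (by simp), hm _ _ ?_, hm _ _ ?_, hm _ _ ?_⟩
  · intro σ hσ
    simp
  · intro σ hσ
    simp only [Expr.eval_add, Expr.eval_cell, Expr.eval_one, hσ]
    omega
  · intro σ hσ
    simp [hσ]

theorem setConstants_steps_le {s : ℕ → ℕ} (h : s 1 ≤ s 0) :
    setConstants.steps s ≤ 9 * s 0 + 11 := by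
  simp only [setConstants, multiply, steps, Expr.eval_cell, Expr.eval_sub, Expr.eval_one,
    Expr.eval_zero]
  omega

/-! ### The input -/

theorem input_bounded {n : ℕ} (G : SimpleGraph (Fin n)) (k : ℕ) :
    Bounded (n + k + 1) (input G k) := by
  intro a i
  unfold input
  split <;> try split_ifs
  all_goals omega

theorem input_adj {n : ℕ} (G : SimpleGraph (Fin n)) (k : ℕ) :
    ∀ u < n, ∀ w < n, (natAdj G u w → input G k 1 (u * n + w) = 1) ∧
      (¬ natAdj G u w → input G k 1 (u * n + w) = 0) := by
  intro u hu w hw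
  have key : (∃ x y : Fin n, u * n + w = x.val * n + y.val ∧ G.Adj x y) ↔ natAdj G u w := by
    constructor
    · rintro ⟨x, y, he, hxy⟩
      have hm := congrArg (· % n) he
      have hd := congrArg (· / n) he
      simp only [Nat.mul_add_mod_self_right, Nat.mod_eq_of_lt hw, Nat.mod_eq_of_lt y.2] at hm
      refine ⟨x, y, ?_, hm.symm, hxy⟩
      rw [hm] at he
      exact (Nat.eq_of_mul_eq_mul_right (by omega) (by omega : u * n = x * n)).symm
    · rintro ⟨x, y, rfl, rfl, hxy⟩
      exact ⟨x, y, rfl, hxy⟩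
  exact ⟨fun h => if_pos (key.2 h), fun h => if_neg (mt key.1 h)⟩

/-- Reading the answer off the final memory. -/
theorem isCorrect_of_marks {n : ℕ} {G : SimpleGraph (Fin n)} {k : ℕ} {σ : Mem}
    (h : (σ 2 0 = 1 ∧ ∃ S, Good (natAdj G) n S ∧ S.card ≤ min k n ∧ Marks 3 n S σ) ∨
      (σ 2 0 = 0 ∧ ¬ ∃ S, Good (natAdj G) n S ∧ S.card ≤ min k n)) : IsCorrect G k σ := by
  rcases h with ⟨h2, S, hS, hc, hm⟩ | ⟨h2, hno⟩
  · obtain ⟨T, rfl⟩ := exists_map_of_subset_range hS.2.1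
    have ho : outputSet n σ = T := by
      ext v
      have := hm v v.2
      by_cases hv : v ∈ T <;> simp_all [outputSet, Fin.val_inj]
    refine .inl ⟨h2, ?_, ?_⟩
    · rw [ho]
      exact (good_map_iff G T).1 hS
    · rw [ho]
      simpa using hc.trans (min_le_left _ _)
  · refine .inr ⟨h2, fun ⟨T, hT, hc⟩ => hno ⟨_, (good_map_iff G T).2 hT, ?_⟩⟩
    rw [card_map]
    exact le_min hc (by simpa using card_le_univ T)

/-! ### Estimates -/

/-- Only `c = 1` is needed; the free `c` lets the induction on `j` pass from `c` to `c + 1`, using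
`(c + j + 2) * c ≤ (c + 1) * (c + 1 + j)`. -/
theorem add_succ_pow_mul_le (j c : ℕ) : (c + j + 1) ^ j * c ≤ (c + j) ^ (j + 1) := by
  induction j generalizing c with
  | zero => simp
  | succ j ih =>
    calc (c + (j + 1) + 1) ^ (j + 1) * c = (c + 1 + j + 1) ^ j * ((c + j + 2) * c) := by ring
      _ ≤ (c + 1 + j + 1) ^ j * ((c + 1) * (c + 1 + j)) :=
        Nat.mul_le_mul_left _ (by nlinarith)
      _ = (c + 1 + j + 1) ^ j * (c + 1) * (c + 1 + j) := by ring
      _ ≤ (c + 1 + j) ^ (j + 1) * (c + 1 + j) := Nat.mul_le_mul_right _ (ih (c + 1))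
      _ = (c + (j + 1)) ^ (j + 1 + 1) := by ring

theorem succ_pow_pred_le (k : ℕ) : (k + 1) ^ (k - 1) ≤ k ^ k := by
  cases k with
  | zero => simp
  | succ m => simpa [add_comm 1 m] using add_succ_pow_mul_le m 1

theorem le_self_pow_self {a b : ℕ} (h : a ≤ b) : a ^ a ≤ b ^ b := by
  rcases Nat.eq_zero_or_pos a with rfl | ha
  · simpa using Nat.one_le_iff_ne_zero.2 (Nat.pow_self_pos).ne'
  · exact (Nat.pow_le_pow_left h a).trans (Nat.pow_le_pow_right (by omega) h)

theorem trials_le {k l : ℕ} (h : l ≤ k) : (l + 1) ^ (l - 1) * 2 ^ l ≤ 2 ^ k * k ^ k := by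
  rw [mul_comm]
  exact Nat.mul_le_mul (Nat.pow_le_pow_right (by omega) h)
    ((succ_pow_pred_le l).trans (le_self_pow_self h))

/-- As `(x + 1) * b + 1 ≤ (x + 1) * (b + 1)`, the quantity `x + 1` grows at most by the factor `b +
1` per round. -/
theorem iterate_le (b m M : ℕ) : (fun x => (x + 1) * b)^[m] M + 1 ≤ (M + 1) * (b + 1) ^ m := by
  induction m with
  | zero => simp
  | succ m ih =>
    rw [Function.iterate_succ_apply', pow_succ, ← mul_assoc]
    refine le_trans ?_ (Nat.mul_le_mul_right (b + 1) ih)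
    rw [mul_add, mul_one]
    omega

theorem size_add_le (a b : ℕ) : Nat.size (a + b) ≤ Nat.size a + Nat.size b + 2 := by
  have h1 : Nat.size (a + b) ≤ Nat.size ((a + 1) * (b + 1)) :=
    Nat.size_le_size (by nlinarith [Nat.zero_le (a * b)])
  have h2 := size_mul_le (a + 1) (b + 1)
  have h3 := size_succ_le a
  have h4 := size_succ_le b
  omega

theorem le_inputLength (n k : ℕ) : n ≤ inputLength n k ∧ Nat.size k ≤ inputLength n k := by
  have := Nat.le_mul_self n
  unfold inputLength
  omega

theorem size_iterate_le (n k b : ℕ) (hb : b ≤ 9 * n + 11) :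
    Nat.size ((fun x => (x + 1) * (4 * n + 4))^[b] (n + k + 5)) ≤
      2 * inputLength n k + 8 + (9 * inputLength n k + 11) * (4 * inputLength n k + 5) + 1 := by
  obtain ⟨hn, hk⟩ := le_inputLength n k
  have h1 := iterate_le (4 * n + 4) b (n + k + 5)
  have h2 := Nat.size_le_size ((Nat.le_succ _).trans h1)
  have h3 := size_mul_le (n + k + 5 + 1) ((4 * n + 4 + 1) ^ b)
  have h4 : Nat.size (n + k + 5 + 1) ≤ Nat.size ((n + 7) * (k + 1)) :=
    Nat.size_le_size (by nlinarith [Nat.zero_le (n * k)])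
  have h5 := size_mul_le (n + 7) (k + 1)
  have h6 := size_le_self (n + 7)
  have h7 := size_succ_le k
  have h8 := size_pow_le (4 * n + 4 + 1) b
  have h9 : b * Nat.size (4 * n + 4 + 1)
      ≤ (9 * inputLength n k + 11) * (4 * inputLength n k + 5) :=
    Nat.mul_le_mul (by omega) ((size_le_self _).trans (by omega))
  omega

/-- The number of steps is exponential, but only its bit length enters the cost of an operation. The
assumption `l ≤ n` keeps that length polynomial in the input length. -/
theorem size_steps_le (n k l c d : ℕ) (hl : l ≤ n) :
    Nat.size ((l + 1) ^ (l - 1) * 2 ^ l * (c * (n + 1) ^ d)) ≤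
      inputLength n k * (inputLength n k + 1) + 2 * inputLength n k + 2 + c +
        d * (inputLength n k + 1) + 1 := by
  obtain ⟨hn, -⟩ := le_inputLength n k
  have h1 := size_mul_le ((l + 1) ^ (l - 1) * 2 ^ l) (c * (n + 1) ^ d)
  have h2 := size_mul_le ((l + 1) ^ (l - 1)) (2 ^ l)
  have h3 := size_mul_le c ((n + 1) ^ d)
  have h4 := size_pow_le (l + 1) (l - 1)
  have h5 := size_pow_le 2 l
  have h6 := size_pow_le (n + 1) d
  have h7 := size_le_self c
  have h8 : (l - 1) * Nat.size (l + 1) ≤ inputLength n k * (inputLength n k + 1) :=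
    Nat.mul_le_mul (by omega) ((size_le_self _).trans (by omega))
  have h9 : l * Nat.size 2 ≤ 2 * inputLength n k := by
    rw [mul_comm]
    exact Nat.mul_le_mul (by decide) (by omega)
  have h10 : d * Nat.size (n + 1) ≤ d * (inputLength n k + 1) :=
    Nat.mul_le_mul le_rfl ((size_le_self _).trans (by omega))
  omega

theorem runTrials_grows {s : ℕ → ℕ} (h4 : s 4 ≠ 0) :
    runTrials.Assigns (Grows 5 s 1 Nat.succ) :=
  assigns_of_assignsAll (fun e he σ M hσ hM hB =>
    Expr.eval_le_of_increment he hM hB (by rwa [hσ])) runTrials_increment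

theorem readInput_grows (s : ℕ → ℕ) : readInput.Assigns (Grows 0 s 0 Nat.succ) :=
  ⟨fun _ M _ _ hM => (hM _ _).trans (Nat.le_succ M),
    fun _ M _ _ hM => (hM _ _).trans (Nat.le_succ M),
    fun _ M _ _ hM => (hM _ _).trans (Nat.le_succ M)⟩

end SafeSet

/-! ### Assembly of the three phases and the time bound -/

open SafeSet RAM RAM.FProg Polynomial in
theorem mainTheorem8 :
    ∃ P : RAM.Prog, SafeSet.SolvesInTimeOStar P (fun k => 2 ^ k * k ^ k) := by
  obtain ⟨CA, hA⟩ := readInput.exec_compile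
  obtain ⟨CB, hB⟩ := setConstants.exec_compile
  obtain ⟨CM, hM⟩ := runTrials.exec_compile
  obtain ⟨c, d, hs⟩ := runTrials_polySteps
  -- The value of `q` bounds the bit lengths of all cells: the first summands come from
  -- `size_iterate_le` for the constants, the bracket from `size_steps_le` for the growth in the
  -- main phase, and the final `2` from `size_add_le`.
  let q : Polynomial ℕ := 2 * X + 8 + (9 * X + 11) * (4 * X + 5) + 1 +
    (X * (X + 1) + 2 * X + 2 + C c + C d * (X + 1) + 1) + 2
  refine ⟨.seq readInput.compile (.seq setConstants.compile runTrials.compile),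
    (4 * C CA + (9 * X + 11) * C CB + C c * (X + 1) ^ d * C CM) * (q + 1) ^ 2,
    fun n G k => ?_⟩
  obtain ⟨hn, -⟩ := le_inputLength n k
  set N := inputLength n k with hN
  have hq : q.eval N = 2 * N + 8 + (9 * N + 11) * (4 * N + 5) + 1 +
    (N * (N + 1) + 2 * N + 2 + c + d * (N + 1) + 1) + 2 := by simp [q]
  set L := q.eval N with hL
  set l := min k n with hl
  have hln : l ≤ n := min_le_right _ _
  set σ := input G k with hσ
  set σ₁ := readInput.den σ with hσ₁
  set σ₂ := setConstants.den σ₁ with hσ₂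
  have h40 : σ₁ 4 0 = n := (readInput_spec σ).1
  have h41 : σ₁ 4 1 = l := (readInput_spec σ).2
  have h1 : σ₁ 1 = σ 1 := den_of_notMem (by decide) σ
  have henv : Env (natAdj G) n l σ₂ := by
    refine setConstants_spec h40 h41 ?_
    rw [h1]
    exact input_adj G k
  have h2 : σ₂ 2 0 = 0 := by
    have e1 : σ₂ 2 = σ₁ 2 := den_of_notMem (by decide) σ₁
    have e2 : σ₁ 2 = σ 2 := den_of_notMem (by decide) σ
    rw [e1, e2]
    rfl
  have hsteps := (hs (σ₂ 5) (by rw [henv.numV, henv.bound]; exact hln)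
    (by rw [henv.two]; exact Nat.one_le_two_pow)
    (by rw [henv.codes]; exact Nat.one_le_pow _ _ (Nat.succ_pos _))).2
  simp only [henv.numV, henv.two, henv.codes] at hsteps
  have h54 : σ₂ 5 4 ≠ 0 := by
    rw [henv.modulus]
    rcases Nat.eq_zero_or_pos n with rfl | hn
    · simp
    · positivity
  have hstepsB := setConstants_steps_le (s := σ₁ 4) (by rw [h40, h41]; exact hln)
  rw [h40] at hstepsB
  set m := runTrials.steps (σ₂ 5) with hm
  set b := setConstants.steps (σ₁ 4) with hb
  have hsize := size_iterate_le n k b hstepsB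
  have hsize' := (Nat.size_le_size hsteps).trans (size_steps_le n k l c d hln)
  rw [← hN] at hsize hsize'
  -- A bound for the memory after the constants are computed. The input is bounded by `n + k + 1`,
  -- and `readInput` counts as four steps, each allowed to add one.
  set MB := (fun x => (x + 1) * (4 * n + 4))^[b] (n + k + 5) with hMB
  have hMA : n + k + 5 ≤ MB :=
    Function.id_le_iterate_of_id_le (fun x => by
      show x ≤ (x + 1) * (4 * n + 4)
      nlinarith [Nat.zero_le (x * n)]) b _
  have hfin : Nat.size (MB + m) ≤ L := by
    have := size_add_le MB m
    omega
  obtain ⟨tA, xA, bA, BA⟩ := hA 0 (σ 0) 0 Nat.succ (fun _ => le_rfl) (by decide)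
    (readInput_grows _) σ (n + k + 1) L rfl (Nat.zero_le _) (input_bounded G k)
    ((Nat.size_le_size (by
      simp only [Nat.succ_iterate, readInput, steps]
      omega)).trans hfin)
  have BA' : Bounded (n + k + 5) σ₁ := BA.mono (by
    simp only [Nat.succ_iterate, readInput, steps]
    omega)
  obtain ⟨tB, xB, bB, BB⟩ := hB 4 (σ₁ 4) 0 (fun x => (x + 1) * (4 * σ₁ 4 0 + 4))
    (fun x => Nat.le_mul_of_pos_right _ (by omega)) (by decide)
    (setConstants_grows (by rw [h40, h41]; exact hln)) σ₁ (n + k + 5) L rfl (Nat.zero_le _) BA'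
    (by rw [h40]; exact (Nat.size_le_size (Nat.le_add_right _ _)).trans hfin)
  rw [h40] at BB
  -- Each phase has its own array of fixed loop limits: `0`, then `4`, now `5`. Growth is by one per
  -- step, so cells stay below `MB + m`.
  obtain ⟨tM, xM, bM, -⟩ := hM 5 (σ₂ 5) 1 Nat.succ (fun _ => le_rfl) runTrials_wf
    (runTrials_grows h54) σ₂ MB L rfl (by omega) BB (by rwa [Nat.succ_iterate])
  refine ⟨_, _, .seq xA (.seq xB xM), isCorrect_of_marks ?_, ?_⟩
  · rcases runTrials_spec (natAdj_symm G) henv hln h2 with ⟨h, S, hS, hc, hm⟩ | ⟨h, hno⟩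
    · exact .inl ⟨h, S, hS, hc, hm⟩
    · exact .inr ⟨h, hno⟩
  · have hF := trials_le (min_le_left k n)
    rw [← hl] at hF
    have hF1 : 1 ≤ 2 ^ k * k ^ k := Nat.mul_pos (by positivity) Nat.pow_self_pos
    have hp : ((4 * C CA + (9 * X + 11) * C CB + C c * (X + 1) ^ d * C CM) * (q + 1) ^ 2).eval N
        = (4 * CA + (9 * N + 11) * CB + c * (N + 1) ^ d * CM) * (L + 1) ^ 2 := by
      simp [hL]
    show tA + (tB + tM) ≤ 2 ^ k * k ^ k * _
    rw [hp]
    have a1 : tA ≤ 2 ^ k * k ^ k * (4 * (CA * (L + 1) ^ 2)) := by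
      refine (bA.trans (Nat.mul_le_mul_right _ ?_)).trans (Nat.le_mul_of_pos_left _ hF1)
      simp [readInput, steps]
    have a2 : tB ≤ 2 ^ k * k ^ k * ((9 * N + 11) * (CB * (L + 1) ^ 2)) :=
      (bB.trans (Nat.mul_le_mul_right _ (by omega))).trans (Nat.le_mul_of_pos_left _ hF1)
    have a3 : tM ≤ 2 ^ k * k ^ k * (c * (N + 1) ^ d) * (CM * (L + 1) ^ 2) := by
      refine bM.trans (Nat.mul_le_mul_right _ (hsteps.trans (Nat.mul_le_mul hF ?_)))
      gcongr
    calc tA + (tB + tM) ≤ _ := add_le_add a1 (add_le_add a2 a3)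
      _ = _ := by ring
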